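/- Notation. Let $D_X,D_Y,d_Y\in\mathbb N$, $\mathcal M_X\subset\mathbb R^{D_X}$, and for each $x\in\mathcal M_X$ let $\mathcal M_{Y|x}\subset\mathbb R^{D_Y}$. Put $\mathcal M=\{(x,y):x\in\mathcal M_X,\,y\in\mathcal M_{Y|x}\}$ and $\mathcal M_Y=\bigcup_{x\in\mathcal M_X}\mathcal M_{Y|x}$. $\|\cdot\|$ is the Euclidean norm, and $\mathbb B_U(u,r)=\{v\in U:\|v-u\|<r\}$. A set $M\subset\mathbb R^D$ is a $d$-dimensional submanifold if every $p\in M$ has a neighbourhood $V$ in $M$ and a homeomorphism $\xi:U\to V$ from an open set $U\subset\mathbb R^d$ whose differential exists and is injective at every point of $U$. Its tangent space $T_pM$ is the linear space (in general, the linear span) of the velocities $c'(0)$ of $C^1$ curves $c$ on $M$ with $c(0)=p$. Its reach is $$\sup\{\varepsilon:\ \text{every } z \text{ with } \operatorname{dist}(z,M)<\varepsilon \text{ has exactly one } q\in M \text{ with } \|z-q\|=\operatorname{dist}(z,M)\}\in[0,\infty].$$ A diffeomorphism between subsets of Euclidean spaces is a bijection that is $C^1$ together with its inverse. For $\alpha_1,\alpha_2,r>0$,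 $\mathcal H^{\alpha_1,\alpha_2}_r(\mathbb R^{d_1},\mathbb R^{d_2})$ is the set of $f:\mathbb R^{d_1}\times\mathbb R^{d_2}\to\mathbb R$ whose mixed partial derivatives $f^{(j_1,j_2)}$ exist for all $(j_1,j_2)\in\mathcal J=\{(j_1,j_2)\in\mathbb N_0^{d_1}\times\mathbb N_0^{d_2}:\frac{|j_1|}{\alpha_1}+\frac{|j_2|}{\alpha_2}<1\}$ and satisfy $$\sum_{\mathcal J}\sup_{u,v}|f^{(j_1,j_2)}(u,v)|+\sum_{\substack{\mathcal J\\ \frac{|j_1|+1}{\alpha_1}+\frac{|j_2|}{\alpha_2}\ge1}}\ \sup_{u\ne u',\,v}\frac{|f^{(j_1,j_2)}(u,v)-f^{(j_1,j_2)}(u',v)|}{\|u-u'\|^{\alpha_1-|j_1|-\frac{\alpha_1}{\alpha_2}|j_2|}}+\sum_{\substack{\mathcal J\\ \frac{|j_1|}{\alpha_1}+\frac{|j_2|+1}{\alpha_2}\ge1}}\ \sup_{u,\,v\ne v'}\frac{|f^{(j_1,j_2)}(u,v)-f^{(j_1,j_2)}(u,v')|}{\|v-v'\|^{\alpha_2-|j_2|-\frac{\alpha_2}{\alpha_1}|j_1|}}\le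 r.$$ For $U_1\subset\mathbb R^{d_1}$, $U_2\subset\mathbb R^{d_2}$, $\mathcal H^{\alpha_1,\alpha_2}_{r,m}(U_1,U_2)$ is the set of $f:U_1\times U_2\to\mathbb R^m$ each of whose components is the restriction of a function in $\mathcal H^{\alpha_1,\alpha_2}_r(\mathbb R^{d_1},\mathbb R^{d_2})$. If $U_1$ lies in a $d_1$-dimensional linear subspace $T$ of a Euclidean space, $T$ is identified with $\mathbb R^{d_1}$ by an orthonormal basis. Lemma (equivalent descriptions of $(\beta_Y,\beta_X)$-smooth submanifold families). Let $\beta_X>0$, $\beta_Y\ge2$, $\beta_Y\ge\beta_X$, and let $\mathcal M_{Y|x}$ be a $d_Y$-dimensional submanifold of $\mathbb R^{D_Y}$ for every $x\in\mathcal M_X$. The following are equivalent. (1) There exist constants $\tau,\tau_1,L>0$ such that for all $x\in\mathcal M_X$, $\mathcal M_{Y|x}$ is a closed $d_Y$-dimensional submanifold with reach larger than $\tau$; and for every $\omega_0=(x_0,y_0)\in\mathcal M$ there is a neighbourhood $U_{\omega_0}$ of $y_0$ in $\mathcal M_Y$ such that, for every $x\in\mathbb B_{\mathcal M_X}(x_0,\tau)$,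 the map $y\mapsto\operatorname{Proj}_{T_{y_0}\mathcal M_{Y|x_0}}(y-y_0)$ restricts to a diffeomorphism from $U_{\omega_0}\cap\mathcal M_{Y|x}$ onto $\mathbb B_{T_{y_0}\mathcal M_{Y|x_0}}(0,\tau_1)$, whose inverse $\phi_{\omega_0,x}$ is such that $(z,x)\mapsto\phi_{\omega_0,x}(z)$ belongs to $\mathcal H^{\beta_Y,\beta_X}_{L,D_Y}(\mathbb B_{T_{y_0}\mathcal M_{Y|x_0}}(0,\tau_1),\mathbb B_{\mathcal M_X}(x_0,\tau))$. (2) There exist constants $\widetilde\tau,\widetilde\tau_1,\widetilde L>0$ such that for every $\omega_0=(x_0,y_0)\in\mathcal M$ there is a neighbourhood $\widetilde U$ of $y_0$ in $\mathcal M_Y$ with the following property: for every $x\in\mathbb B_{\mathcal M_X}(x_0,\widetilde\tau)$, $\mathbb B_{\mathcal M_{Y|x}}(y_0,\widetilde\tau)\subset\widetilde U\cap\mathcal M_{Y|x}$, and there is an $\widetilde L$-Lipschitz diffeomorphism $\widetilde Q_{\omega_0}(\cdot,x)$ from $\widetilde U\cap\mathcal M_{Y|x}$ onto $\mathbb B_{\mathbb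 R^{d_Y}}(\mathbf 0,\widetilde\tau_1)$, with inverse $\widetilde G_{\omega_0}(\cdot,x)$, such that $\widetilde Q_{\omega_0}(y_0,x_0)=\mathbf 0$ and $\widetilde G_{\omega_0}\in\mathcal H^{\beta_Y,\beta_X}_{\widetilde L,D_Y}(\mathbb B_{\mathbb R^{d_Y}}(\mathbf 0,\widetilde\tau_1),\mathbb B_{\mathcal M_X}(x_0,\widetilde\tau))$. (3) There exist constants $\overline\tau,\overline\tau_1,\overline L>0$ such that $\mathcal M_Y\subset\mathbb B_{\mathbb R^{D_Y}}(\mathbf 0,\overline L)$ and for every $\omega_0=(x_0,y_0)\in\mathcal M$ there is a function $F_{\omega_0}\in\mathcal H^{\beta_Y,\beta_X}_{\overline L,D_Y-d_Y}(\mathbb B_{\mathbb R^{D_Y}}(y_0,\overline\tau),\mathbb B_{\mathcal M_X}(x_0,\overline\tau))$ such that for every $x\in\mathbb B_{\mathcal M_X}(x_0,\overline\tau)$ one has $\mathbb B_{\mathcal M_{Y|x}}(y_0,\overline\tau)=\{y\in\mathbb B_{\mathbb R^{D_Y}}(y_0,\overline\tau):F_{\omega_0}(y,x)=\mathbf 0\}$,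 and for every such $x$ and every $y\in\mathbb B_{\mathbb R^{D_Y}}(y_0,\overline\tau)$ the Jacobian matrix in $y$ satisfies $J_{F_{\omega_0}(\cdot,x)}(y)\,J_{F_{\omega_0}(\cdot,x)}(y)^T\succeq\overline\tau_1 I_{D_Y-d_Y}$. -/

import Mathlib

open Set Metric Topology
open scoped ENNReal

/-- `ℝᵈ` with its Euclidean norm. -/
abbrev Euc (d : ℕ) : Type := EuclideanSpace ℝ (Fin d)

noncomputable section

/-! ### Jointly (anisotropically) Hölder-smooth functions of two variables -/

/-- The size `|j| = j₁ + ⋯ + j_d` of a multi-index, as a real number. -/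
def miSize {d : ℕ} (j : Fin d → ℕ) : ℝ := ((∑ i, j i : ℕ) : ℝ)

/-- The index set `{(j₁, j₂) : |j₁|/α₁ + |j₂|/α₂ < 1}` of pairs of multi-indices. -/
def holderIndex (α₁ α₂ : ℝ) (d₁ d₂ : ℕ) : Set ((Fin d₁ → ℕ) × (Fin d₂ → ℕ)) :=
  {j | miSize j.1 / α₁ + miSize j.2 / α₂ < 1}

/-- The functions `D j`, for `j` in the set `J` of pairs of multi-indices, are the mixed partial
derivatives `f^(j₁, j₂)`: `D (0, 0) = f`, and whenever raising one coordinate of `j` by one leads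
to an index in `J`, the corresponding partial derivative of `D j` exists at every point and is the
function attached to the raised index. (If `J` is closed under lowering an index, as
`holderIndex` is, this determines `D` on `J`.) -/
structure IsMixedPartials {d₁ d₂ : ℕ} (J : Set ((Fin d₁ → ℕ) × (Fin d₂ → ℕ)))
    (f : Euc d₁ → Euc d₂ → ℝ)
    (D : (Fin d₁ → ℕ) × (Fin d₂ → ℕ) → Euc d₁ → Euc d₂ → ℝ) : Prop where
  zero : D (0, 0) = f
  fst : ∀ (j₁ : Fin d₁ → ℕ) (j₂ : Fin d₂ → ℕ) (i : Fin d₁), (j₁ + Pi.single i 1, j₂) ∈ J →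
    ∀ (x : Euc d₁) (y : Euc d₂),
      HasLineDerivAt ℝ (fun x' => D (j₁, j₂) x' y) (D (j₁ + Pi.single i 1, j₂) x y) x
        (EuclideanSpace.single i 1)
  snd : ∀ (j₁ : Fin d₁ → ℕ) (j₂ : Fin d₂ → ℕ) (i : Fin d₂), (j₁, j₂ + Pi.single i 1) ∈ J →
    ∀ (x : Euc d₁) (y : Euc d₂),
      HasLineDerivAt ℝ (fun y' => D (j₁, j₂) x y') (D (j₁, j₂ + Pi.single i 1) x y) y
        (EuclideanSpace.single i 1)

/-- The sum of the suprema of the mixed partial derivatives and of their Hölder quotients in each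
of the two variables, with values in `[0, ∞]`. -/
def holderSum (α₁ α₂ : ℝ) {d₁ d₂ : ℕ}
    (D : (Fin d₁ → ℕ) × (Fin d₂ → ℕ) → Euc d₁ → Euc d₂ → ℝ) : ℝ≥0∞ :=
  (∑' j : holderIndex α₁ α₂ d₁ d₂, ⨆ (x : Euc d₁) (y : Euc d₂), ENNReal.ofReal |D j x y|)
  + (∑' j : {j | j ∈ holderIndex α₁ α₂ d₁ d₂ ∧ 1 ≤ (miSize j.1 + 1) / α₁ + miSize j.2 / α₂},
      ⨆ (x : Euc d₁) (x₀ : Euc d₁) (y : Euc d₂) (_ : x ≠ x₀),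
        ENNReal.ofReal (|D j x y - D j x₀ y| /
          ‖x - x₀‖ ^ (α₁ - miSize j.1.1 - α₁ / α₂ * miSize j.1.2)))
  + (∑' j : {j | j ∈ holderIndex α₁ α₂ d₁ d₂ ∧ 1 ≤ miSize j.1 / α₁ + (miSize j.2 + 1) / α₂},
      ⨆ (x : Euc d₁) (y : Euc d₂) (y₀ : Euc d₂) (_ : y ≠ y₀),
        ENNReal.ofReal (|D j x y - D j x y₀| /
          ‖y - y₀‖ ^ (α₂ - miSize j.1.2 - α₂ / α₁ * miSize j.1.1)))

/-- The class `𝓗^{α₁,α₂}_r(ℝ^{d₁}, ℝ^{d₂})` of real-valued functions on the whole space. -/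
def HolderClass (α₁ α₂ r : ℝ) {d₁ d₂ : ℕ} (f : Euc d₁ → Euc d₂ → ℝ) : Prop :=
  ∃ D : (Fin d₁ → ℕ) × (Fin d₂ → ℕ) → Euc d₁ → Euc d₂ → ℝ,
    IsMixedPartials (holderIndex α₁ α₂ d₁ d₂) f D ∧ holderSum α₁ α₂ D ≤ ENNReal.ofReal r

/-- The class `𝓗^{α₁,α₂}_{r,m}(U₁, U₂)` of `ℝᵐ`-valued functions on `U₁ × U₂`: each component
extends to a function in `𝓗^{α₁,α₂}_r(ℝ^{d₁}, ℝ^{d₂})`. -/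
def HolderClassOn (α₁ α₂ r : ℝ) {d₁ d₂ m : ℕ} (U₁ : Set (Euc d₁)) (U₂ : Set (Euc d₂))
    (f : Euc d₁ → Euc d₂ → Euc m) : Prop :=
  ∀ i : Fin m, ∃ g : Euc d₁ → Euc d₂ → ℝ, HolderClass α₁ α₂ r g ∧
    ∀ x ∈ U₁, ∀ y ∈ U₂, g x y = f x y i

/-! ### Submanifolds of Euclidean space -/

/-- `M ⊆ ℝᴰ` is a `d`-dimensional submanifold: every point has a neighbourhood `V` in `M` that is
the homeomorphic image of an open `U ⊆ ℝᵈ` under a map whose differential exists and is injective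
at every point of `U`. -/
def IsSubmanifold (d : ℕ) {D : ℕ} (M : Set (Euc D)) : Prop :=
  ∀ p ∈ M, ∃ V : Set (Euc D), V ⊆ M ∧ V ∈ 𝓝[M] p ∧ ∃ U : Set (Euc d), IsOpen U ∧
    ∃ (ξ : Euc d → Euc D) (η : Euc D → Euc d),
      MapsTo ξ U V ∧ MapsTo η V U ∧ InvOn η ξ U V ∧ ContinuousOn ξ U ∧ ContinuousOn η V ∧
      ∀ u ∈ U, DifferentiableAt ℝ ξ u ∧ Function.Injective (fderiv ℝ ξ u)

/-- The tangent space at `p`: velocities at time `0` of `C¹` curves on `M` through `p`. For a `C¹`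
submanifold these velocities already form a linear subspace, so that taking the span adds
nothing. -/
def tangentSpaceAt {D : ℕ} (M : Set (Euc D)) (p : Euc D) : Submodule ℝ (Euc D) :=
  Submodule.span ℝ {v | ∃ c : ℝ → Euc D, ContDiffAt ℝ 1 c 0 ∧ c 0 = p ∧
    (∀ᶠ t in 𝓝 (0 : ℝ), c t ∈ M) ∧ deriv c 0 = v}

/-- The reach of `M`, with values in `[0, ∞]`. -/
def reach {D : ℕ} (M : Set (Euc D)) : ℝ≥0∞ :=
  sSup {ε | ∀ p : Euc D, infEDist p M < ε → ∃! q : Euc D, q ∈ M ∧ infEDist p M = edist p q}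

/-- `f` is a (`C¹`) diffeomorphism of the set `A` onto the set `B` with inverse `g`. -/
structure IsDiffeoOn {E F : Type*} [NormedAddCommGroup E] [NormedSpace ℝ E]
    [NormedAddCommGroup F] [NormedSpace ℝ F] (f : E → F) (g : F → E) (A : Set E) (B : Set F) :
    Prop where
  mapsTo : MapsTo f A B
  mapsTo_inv : MapsTo g B A
  invOn : InvOn g f A B
  contDiffOn : ContDiffOn ℝ 1 f A
  contDiffOn_inv : ContDiffOn ℝ 1 g B

/-- The Jacobian matrix of `f` at `p`, with entries `∂ f_i / ∂ x_k`. -/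
def jacobianAt {n m : ℕ} (f : Euc n → Euc m) (p : Euc n) : Matrix (Fin m) (Fin n) ℝ :=
  Matrix.of fun i k => fderiv ℝ f p (EuclideanSpace.single k 1) i

/-! ### Families of submanifolds `M x ⊆ ℝ^{D_Y}` indexed by `x ∈ MX ⊆ ℝ^{D_X}` -/

/-- The union `M_Y` of the members of the family. -/
def totalY {DX DY : ℕ} (MX : Set (Euc DX)) (M : Euc DX → Set (Euc DY)) : Set (Euc DY) :=
  ⋃ x ∈ MX, M x

/-- The class of `(β_Y, β_X)`-smooth submanifold families with constants `τ, τ₁, L`. The tangent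
space at `(x₀, y₀)` is identified with `ℝᵈ` by a linear isometry (an orthonormal basis) `e`. -/
structure SmoothFamily (βY βX τ τ₁ L : ℝ) (d : ℕ) {DX DY : ℕ} (MX : Set (Euc DX))
    (M : Euc DX → Set (Euc DY)) : Prop where
  submanifold : ∀ x ∈ MX, IsSubmanifold d (M x)
  closed : ∀ x ∈ MX, IsClosed (M x)
  reach_gt : ∀ x ∈ MX, ENNReal.ofReal τ < reach (M x)
  projection : ∀ x₀ ∈ MX, ∀ y₀ ∈ M x₀, ∃ U : Set (Euc DY),
    U ⊆ totalY MX M ∧ U ∈ 𝓝[totalY MX M] y₀ ∧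
    ∃ φ : tangentSpaceAt (M x₀) y₀ → Euc DX → Euc DY,
      (∀ x ∈ MX ∩ ball x₀ τ,
        IsDiffeoOn (fun y => (tangentSpaceAt (M x₀) y₀).orthogonalProjectionOnto (y - y₀))
          (fun z => φ z x) (U ∩ M x) (ball 0 τ₁)) ∧
      ∃ e : Euc d ≃ₗᵢ[ℝ] tangentSpaceAt (M x₀) y₀,
        HolderClassOn βY βX L (ball 0 τ₁) (MX ∩ ball x₀ τ) (fun z x => φ (e z) x)

/-- Existence of `x`-dependent smooth local charts with constants `τ, τ₁, L`. -/
def HasSmoothCharts (βY βX τ τ₁ L : ℝ) (d : ℕ) {DX DY : ℕ} (MX : Set (Euc DX))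
    (M : Euc DX → Set (Euc DY)) : Prop :=
  ∀ x₀ ∈ MX, ∀ y₀ ∈ M x₀, ∃ U : Set (Euc DY),
    U ⊆ totalY MX M ∧ U ∈ 𝓝[totalY MX M] y₀ ∧
    ∃ (Q : Euc DY → Euc DX → Euc d) (G : Euc d → Euc DX → Euc DY),
      (∀ x ∈ MX ∩ ball x₀ τ,
        M x ∩ ball y₀ τ ⊆ U ∩ M x ∧
        IsDiffeoOn (fun y => Q y x) (fun z => G z x) (U ∩ M x) (ball 0 τ₁) ∧
        ∀ y ∈ U ∩ M x, ∀ y' ∈ U ∩ M x, ‖Q y x - Q y' x‖ ≤ L * ‖y - y'‖) ∧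
      Q y₀ x₀ = 0 ∧
      HolderClassOn βY βX L (ball 0 τ₁) (MX ∩ ball x₀ τ) G

/-- Local description as solution sets of smooth defining equations with uniformly nondegenerate
Jacobian, with constants `τ, τ₁, L`. -/
def HasDefiningEquations (βY βX τ τ₁ L : ℝ) (d : ℕ) {DX DY : ℕ} (MX : Set (Euc DX))
    (M : Euc DX → Set (Euc DY)) : Prop :=
  totalY MX M ⊆ ball 0 L ∧
  ∀ x₀ ∈ MX, ∀ y₀ ∈ M x₀, ∃ F : Euc DY → Euc DX → Euc (DY - d),
    HolderClassOn βY βX L (ball y₀ τ) (MX ∩ ball x₀ τ) F ∧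
    (∀ x ∈ MX ∩ ball x₀ τ, M x ∩ ball y₀ τ = {y ∈ ball y₀ τ | F y x = 0}) ∧
    ∀ x ∈ MX ∩ ball x₀ τ, ∀ y ∈ ball y₀ τ,
      (jacobianAt (fun y' => F y' x) y * (jacobianAt (fun y' => F y' x) y).transpose
        - τ₁ • (1 : Matrix (Fin (DY - d)) (Fin (DY - d)) ℝ)).PosSemidef

end

set_option linter.unusedSectionVars false

/-! ### Calculus along coordinate lines -/

section CoordinateLines

variable {V F : Type*} [NormedAddCommGroup V] [NormedSpace ℝ V]
  [NormedAddCommGroup F] [NormedSpace ℝ F]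

/-! The implications proved are (1) ⇒ (3) ⇒ (2) ⇒ (1). Each builds new local data from old by affine
substitutions and, for (3) ⇒ (2) ⇒ (1), by solving an equation that is uniformly nondegenerate at
the base point. What is needed is a calculus of anisotropic Hölder classes with constants uniform
over all base points `ω = (x₀, y₀)`.

To get uniformity without tracking constants, a family indexed by `ω` is treated as one object. In
`AnisoHolder a s f` a derivative in coordinate `k` lowers the order `s` by the weight `a k`, and
once `s ≤ a k` the family is Hölder in that coordinate with exponent `s / a k`. With weight `1/β_Y`
on `y`, `1/β_X` on `x` and order `1` this is membership in the given Hölder class with a common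
constant (`anisoHolder_of_holderClass`, `exists_holderClass_of_anisoHolder`). Because the definition
is recursive, the product, chain and inverse rules are inductions on the order. In a composition, an
inner component may vary only along coordinates of at least its own weight. As `β_X ≤ β_Y`, the
`y`-components may depend on everything, while `x` is only translated. The implicit function theorem
(`AnisoHolder.implicitFunction`) comes from a contraction whose fixed point is bootstrapped by the
differentiated equation.

(3) ⇒ (2): split `ℝ^{D_Y}` into the kernel of `A = D_yF` at the base point and the range of a right
inverse `B`, and solve `F(y₀ + Eu + Bw, x) = 0` for `w`. The Jacobian bound makes `B` uniformly
bounded, and `u` is the chart.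

(2) ⇒ (1): the Lipschitz bound on the charts makes `A = D_zG` uniformly injective, with the tangent
space as range. Solving "tangential part of `G(w, x) - y₀` equals `u`" for `w` turns the charts into
graphs. A lower bound on the reach follows from a second order Taylor estimate
(`le_reach_of_taylor`); closedness follows from the uniform size of the charts.

(1) ⇒ (3): with `P` the tangential and `N` the normal part at the base point, take `F(y, x) = N(y -
g(P(y - y₀), x))`. The difficulty is that the neighbourhoods in (1) have no uniform size, so other
pieces of the same member might come close to `y₀`. The reach excludes this: nearest points along a
short segment give a path inside the member, and a clopen argument keeps that path on the graph
(`SmoothFamily.exists_isGraphFamily`). -/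

theorem hasDerivAt_of_hasLineDerivAt {f f' : V → F} {v : V}
    (h : ∀ z, HasLineDerivAt ℝ f (f' z) z v) (z : V) (t : ℝ) :
    HasDerivAt (fun s : ℝ => f (z + s • v)) (f' (z + t • v)) t := by
  have h1 : HasDerivAt (fun s : ℝ => f (z + t • v + s • v)) (f' (z + t • v)) (t - t) := by
    rw [sub_self]; exact h (z + t • v)
  have h2 := h1.comp_sub_const t t
  refine h2.congr_of_eventuallyEq (Filter.Eventually.of_forall fun s => ?_)
  have : z + s • v = z + t • v + (s - t) • v := by rw [sub_smul]; abel
  simp [this]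

/-- The mean value inequality for `s ↦ f (z + s • v) - s • w`, with `w` a guess for the derivative.
-/
theorem norm_line_sub_sub_le {f f' : V → F} {v : V}
    (h : ∀ z, HasLineDerivAt ℝ f (f' z) z v) (z : V) (t : ℝ) (w : F) {C : ℝ}
    (hC : ∀ s : ℝ, |s| ≤ |t| → ‖f' (z + s • v) - w‖ ≤ C) :
    ‖f (z + t • v) - f z - t • w‖ ≤ C * |t| := by
  have key := (convex_uIcc (0 : ℝ) t).norm_image_sub_le_of_norm_hasDerivWithin_le
    (f := fun s : ℝ => f (z + s • v) - s • w) (f' := fun s => f' (z + s • v) - w) (C := C)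
    (fun s _ => by
      have h1 := ((hasDerivAt_of_hasLineDerivAt h z s).sub
        ((hasDerivAt_id s).smul_const w)).hasDerivWithinAt (s := uIcc 0 t)
      rw [one_smul] at h1
      exact h1)
    (fun s hs => hC s (by simpa using abs_sub_left_of_mem_uIcc hs))
    left_mem_uIcc right_mem_uIcc
  simpa [sub_right_comm] using key

theorem norm_line_sub_le {f f' : V → F} {v : V}
    (h : ∀ z, HasLineDerivAt ℝ f (f' z) z v) {C : ℝ} (hC : ∀ z, ‖f' z‖ ≤ C) (z : V) (t : ℝ) :
    ‖f (z + t • v) - f z‖ ≤ C * |t| := by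
  simpa using norm_line_sub_sub_le h z t 0 (C := C) (fun s _ => by simpa using hC _)

end CoordinateLines

/-! ### Increments and a chain rule from coordinate derivatives. -/

section Coordinates

variable {K : Type*} [DecidableEq K] {F : Type*} [NormedAddCommGroup F]

/-- The coordinate vector `e k` of `ℝ^K`. -/
abbrev coordVec (k : K) : K → ℝ := Pi.single k 1

theorem update_add_smul_coordVec (w : K → ℝ) (k : K) (x : ℝ) :
    Function.update w k x + (w k - x) • coordVec k = w := by
  ext j
  by_cases hj : j = k
  · subst hj; simp
  · simp [hj]

theorem norm_sub_le_sum_of_coord (S : Finset K) {f : (K → ℝ) → F} {ω : K → ℝ → ℝ}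
    (h : ∀ k ∈ S, ∀ z t, ‖f (z + t • coordVec k) - f z‖ ≤ ω k t) (z w : K → ℝ)
    (hw : ∀ k, k ∉ S → w k = z k) : ‖f w - f z‖ ≤ ∑ k ∈ S, ω k (w k - z k) := by
  induction S using Finset.induction_on generalizing w with
  | empty =>
    have : w = z := funext fun k => hw k (by simp)
    simp [this]
  | insert k S hk ih =>
    set w' := Function.update w k (z k) with hw'
    have e1 : w' + (w k - z k) • coordVec k = w := update_add_smul_coordVec w k (z k)
    have h1 := h k (by simp) w' (w k - z k)
    rw [e1] at h1
    have h2 := ih (fun j hj => h j (by simp [hj])) w' (fun j hj => by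
      by_cases hjk : j = k
      · subst hjk; simp [hw']
      · simpa [hw', hjk] using hw j (by simp [hjk, hj]))
    rw [Finset.sum_insert hk]
    have h3 : ∑ j ∈ S, ω j (w' j - z j) = ∑ j ∈ S, ω j (w j - z j) :=
      Finset.sum_congr rfl fun j hj => by
        have : j ≠ k := fun e => hk (e ▸ hj)
        simp [hw', this]
    rw [h3] at h2
    calc ‖f w - f z‖ = ‖(f w - f w') + (f w' - f z)‖ := by rw [sub_add_sub_cancel]
      _ ≤ _ := (norm_add_le _ _).trans (add_le_add h1 h2)

variable [Fintype K] [NormedSpace ℝ F]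

/-- A chain rule for an `f` that may be nondifferentiable in some directions: continuous partials
are needed only along the coordinates in `S`, since the inner map does not move the others. -/
theorem hasFDerivAt_comp_coord {W : Type*} [NormedAddCommGroup W] [NormedSpace ℝ W]
    (S : Finset K) {f : (K → ℝ) → F} {f' : K → (K → ℝ) → F}
    (hf : ∀ k ∈ S, ∀ z, HasLineDerivAt ℝ f (f' k z) z (coordVec k))
    (hf' : ∀ k ∈ S, Continuous (f' k)) {c : W → K → ℝ} {c' : K → W →L[ℝ] ℝ} {w : W}
    (hc : ∀ k ∈ S, HasFDerivAt (fun x => c x k) (c' k) w)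
    (hn : ∀ k, k ∉ S → ∀ x, c x k = c w k) :
    HasFDerivAt (fun x => f (c x)) (∑ k ∈ S, (c' k).smulRight (f' k (c w))) w := by
  induction S using Finset.induction_on generalizing c with
  | empty =>
    have : (fun x => f (c x)) = fun _ => f (c w) :=
      funext fun x => by rw [show c x = c w from funext fun k => hn k (by simp) x]
    rw [this]
    simpa using hasFDerivAt_const (f (c w)) w
  | insert k S hk ih =>
    rw [Finset.sum_insert hk]
    have hcc : ContinuousAt c w := by
      rw [continuousAt_pi]
      intro j
      by_cases hj : j ∈ insert k S
      · exact (hc j hj).continuousAt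
      · exact continuousAt_const.congr (Filter.Eventually.of_forall fun x => (hn j hj x).symm)
    -- Coordinate `k` is frozen at its value at `w`. The induction hypothesis differentiates `f ∘
    -- c₁`, and the mean value inequality along `k` handles `f (c x) - f (c₁ x)`.
    set c₁ : W → K → ℝ := fun x => Function.update (c x) k (c w k) with hc₁
    have hcw : c₁ w = c w := by simp [hc₁]
    have h1 := ih (c := c₁) (fun j hj => hf j (by simp [hj])) (fun j hj => hf' j (by simp [hj]))
      (fun j hj => by
        have : j ≠ k := fun e => hk (e ▸ hj)
        simpa [hc₁, this] using hc j (by simp [hj]))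
      (fun j hj x => by
        by_cases hjk : j = k
        · subst hjk; simp [hc₁]
        · simpa [hc₁, hjk] using hn j (by simp [hjk, hj]) x)
    rw [hcw] at h1
    have hck := hc k (by simp)
    have h2 : HasFDerivAt (fun x => (c x k - c w k) • f' k (c w))
        ((c' k).smulRight (f' k (c w))) w := (hck.sub_const _).smul_const _
    have h3 : HasFDerivAt (fun x => f (c x) - f (c₁ x) - (c x k - c w k) • f' k (c w))
        (0 : W →L[ℝ] F) w := by
      have hO : (fun x => c x k - c w k) =O[𝓝 w] fun x => x - w := hck.isBigO_sub
      have ho : (fun x => f (c x) - f (c₁ x) - (c x k - c w k) • f' k (c w)) =o[𝓝 w]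
          fun x => c x k - c w k := by
        rw [Asymptotics.isLittleO_iff]
        intro ε hε
        obtain ⟨δ, hδ, hδ'⟩ := Metric.continuousAt_iff.1
          ((hf' k (by simp)).continuousAt (x := c w)) ε hε
        -- Points on the segment involved lie within three times `‖c x - c w‖` of `c w`.
        have h4 := Metric.continuousAt_iff'.1 hcc (δ / 3) (by positivity)
        filter_upwards [h4] with x hx
        have e1 : c₁ x + (c x k - c w k) • coordVec k = c x :=
          update_add_smul_coordVec (c x) k (c w k)
        have := norm_line_sub_sub_le (hf k (by simp)) (c₁ x) (c x k - c w k) (f' k (c w))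
          (C := ε) (fun s hs => by
            rw [← dist_eq_norm]
            refine (hδ' ?_).le
            have e2 : c₁ x + s • coordVec k
                = c x + (s - (c x k - c w k)) • coordVec k := by
              rw [sub_smul, ← sub_eq_iff_eq_add.2 e1.symm]; abel
            rw [dist_eq_norm] at hx ⊢
            have h5 : |c x k - c w k| ≤ ‖c x - c w‖ := by
              simpa using norm_le_pi_norm (c x - c w) k
            have h6 : ‖(s - (c x k - c w k)) • (coordVec k : K → ℝ)‖ ≤ 2 * ‖c x - c w‖ := by
              rw [norm_smul]
              simp only [Pi.norm_single, norm_one, mul_one, Real.norm_eq_abs]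
              calc |s - (c x k - c w k)| ≤ |s| + |c x k - c w k| := abs_sub _ _
                _ ≤ _ := by linarith
            calc ‖c₁ x + s • coordVec k - c w‖
                = ‖(c x - c w) + (s - (c x k - c w k)) • (coordVec k : K → ℝ)‖ := by
                  rw [e2]; congr 1; abel
              _ ≤ ‖c x - c w‖ + 2 * ‖c x - c w‖ := (norm_add_le _ _).trans (by gcongr)
              _ < δ := by linarith)
        rw [e1] at this
        simpa using this
      refine HasFDerivAt.of_isLittleO ?_
      simpa [hcw] using ho.trans_isBigO hO
    have h4 := (h2.add h3).add h1
    rw [add_zero] at h4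
    refine h4.congr_of_eventuallyEq (Filter.Eventually.of_forall fun x => ?_)
    simp only [Pi.add_apply]; abel

end Coordinates

/-! ### Families of anisotropically Hölder-smooth functions, with uniform bounds -/

section AnisoHolder

variable {K : Type*} [Fintype K] [DecidableEq K] {F : Type*} [NormedAddCommGroup F]
  [NormedSpace ℝ F] {ι : Type*}

/-- The family of partial derivatives in direction `k` of a family of functions on `ℝ^K`. -/
noncomputable def pderivFam (k : K) (f : ι → (K → ℝ) → F) : ι → (K → ℝ) → F :=
  fun i z => lineDeriv ℝ (f i) z (coordVec k)

/-- The family `f` of functions on `ℝ^K` is uniformly anisotropically Hölder-smooth of order `s`,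
where differentiating once in the coordinate `k` costs `a k`. -/
inductive AnisoHolder (a : K → ℝ) : ℝ → (ι → (K → ℝ) → F) → Prop
  | mk {s : ℝ} {f : ι → (K → ℝ) → F}
      (bdd : ∃ C, ∀ i z, ‖f i z‖ ≤ C)
      (diff : ∀ k, a k < s → ∀ i z, LineDifferentiableAt ℝ (f i) z (coordVec k))
      (der : ∀ k, a k < s → AnisoHolder a (s - a k) (pderivFam k f))
      (hol : ∀ k, s ≤ a k → ∃ C, ∀ i z t,
        ‖f i (z + t • coordVec k) - f i z‖ ≤ C * |t| ^ (s / a k)) : AnisoHolder a s f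

/-- There are finitely many positive weights, so every derivative costs at least a fixed `δ > 0` and
the recursion on the order terminates. -/
theorem weight_induction {a : K → ℝ} (ha : ∀ k, 0 < a k) {P : ℝ → Prop}
    (h : ∀ s, 0 < s → (∀ s', 0 < s' → (∃ k, s' ≤ s - a k) → P s') → P s) : ∀ s, 0 < s → P s := by
  obtain ⟨δ, hδ, hδa⟩ : ∃ δ > 0, ∀ k, δ ≤ a k := by
    rcases isEmpty_or_nonempty K with hK | hK
    · exact ⟨1, one_pos, fun k => hK.elim k⟩
    · obtain ⟨k, hk⟩ := Finite.exists_min a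
      exact ⟨a k, ha k, hk⟩
  have key : ∀ n : ℕ, ∀ s, 0 < s → s ≤ n * δ → P s := by
    intro n
    induction n with
    | zero => intro s hs hs'; simp at hs'; linarith
    | succ n ih =>
      intro s hs hs'
      refine h s hs fun s' hs0 ⟨k, hk⟩ => ih s' hs0 ?_
      have := hδa k
      push_cast at hs'
      linarith
  intro s hs
  obtain ⟨n, hn⟩ := exists_nat_ge (s / δ)
  exact key n s hs ((div_le_iff₀ hδ).1 hn)

namespace AnisoHolder

variable {a : K → ℝ} {s : ℝ} {f : ι → (K → ℝ) → F}

theorem bound (h : AnisoHolder a s f) : ∃ C, 0 ≤ C ∧ ∀ i z, ‖f i z‖ ≤ C := by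
  cases h with
  | mk bdd _ _ _ =>
    obtain ⟨C, hC⟩ := bdd
    exact ⟨max C 0, le_max_right _ _, fun i z => (hC i z).trans (le_max_left _ _)⟩

theorem hasLineDerivAt (h : AnisoHolder a s f) {k : K} (hk : a k < s) (i : ι) (z : K → ℝ) :
    HasLineDerivAt ℝ (f i) (pderivFam k f i z) z (coordVec k) := by
  cases h with
  | mk _ diff _ _ => exact (diff k hk i z).hasLineDerivAt

theorem pderiv (h : AnisoHolder a s f) {k : K} (hk : a k < s) :
    AnisoHolder a (s - a k) (pderivFam k f) := by
  cases h with
  | mk _ _ der _ => exact der k hk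

theorem lipschitz (h : AnisoHolder a s f) {k : K} (hk : a k < s) :
    ∃ C, 0 ≤ C ∧ ∀ i z t, ‖f i (z + t • coordVec k) - f i z‖ ≤ C * |t| := by
  obtain ⟨C, hC0, hC⟩ := (h.pderiv hk).bound
  exact ⟨C, hC0, fun i z t => norm_line_sub_le (h.hasLineDerivAt hk i) (hC i) z t⟩

/-- Extending a Hölder bound for small increments to all increments of a bounded family. -/
theorem holder_extend {θ C M : ℝ} (hθ : 0 < θ) (hM : ∀ i z, ‖f i z‖ ≤ M) {k : K}
    (hC : ∀ i z t, |t| ≤ 1 → ‖f i (z + t • coordVec k) - f i z‖ ≤ C * |t| ^ θ) (i : ι)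
    (z : K → ℝ) (t : ℝ) :
    ‖f i (z + t • coordVec k) - f i z‖ ≤ max C (M + M) * |t| ^ θ := by
  rcases le_total |t| 1 with ht | ht
  · exact (hC i z t ht).trans (by gcongr; exact le_max_left _ _)
  · have h1 : 1 ≤ |t| ^ θ := Real.one_le_rpow ht hθ.le
    have h2 : 0 ≤ M + M := by
      have := (norm_nonneg _).trans (hM i z); linarith
    calc _ ≤ M + M := (norm_sub_le _ _).trans (add_le_add (hM _ _) (hM _ _))
      _ ≤ max C (M + M) := le_max_right _ _
      _ ≤ _ := le_mul_of_one_le_right (h2.trans (le_max_right _ _)) h1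

/-- One Hölder estimate for both regimes. For `|t| ≤ 1` a smaller exponent is weaker, whether one
starts from the Lipschitz bound or from the defining quotient; for larger `t` boundedness suffices.
-/
theorem holder (ha : ∀ k, 0 < a k) (h : AnisoHolder a s f) (k : K) {θ : ℝ} (hθ : 0 < θ)
    (hθ1 : θ ≤ 1) (hθs : θ * a k ≤ s) :
    ∃ C, 0 ≤ C ∧ ∀ i z t, ‖f i (z + t • coordVec k) - f i z‖ ≤ C * |t| ^ θ := by
  obtain ⟨M, hM0, hM⟩ := h.bound
  obtain ⟨C, hC0, hC⟩ : ∃ C, 0 ≤ C ∧ ∀ i z t, |t| ≤ 1 →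
      ‖f i (z + t • coordVec k) - f i z‖ ≤ C * |t| ^ θ := by
    rcases lt_or_ge (a k) s with hk | hk
    · obtain ⟨C, hC0, hC⟩ := h.lipschitz hk
      refine ⟨C, hC0, fun i z t ht => (hC i z t).trans ?_⟩
      gcongr
      simpa using Real.rpow_le_rpow_of_exponent_ge_of_imp (abs_nonneg t) ht hθ1
        (fun _ h0 => absurd h0 one_ne_zero)
    · cases h with
      | mk _ _ _ hol =>
        obtain ⟨C, hC⟩ := hol k hk
        refine ⟨max C 0, le_max_right _ _, fun i z t ht => (hC i z t).trans ?_⟩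
        gcongr ?_ * ?_
        · exact le_max_left _ _
        · exact Real.rpow_le_rpow_of_exponent_ge_of_imp (abs_nonneg t) ht
            ((le_div_iff₀ (ha k)).2 hθs) (fun _ h0 => absurd h0 (hθ.trans_le ((le_div_iff₀ (ha k)).2 hθs)).ne')
  exact ⟨max C (M + M), le_max_of_le_left hC0, holder_extend hθ hM hC⟩

/-- The constructor in usable form: candidate derivatives may be supplied, and Hölder bounds are
needed only for small increments. -/
theorem intro (ha : ∀ k, 0 < a k) (hs : 0 < s) (bdd : ∃ C, ∀ i z, ‖f i z‖ ≤ C)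
    (der : ∀ k, a k < s → ∃ g : ι → (K → ℝ) → F,
      (∀ i z, HasLineDerivAt ℝ (f i) (g i z) z (coordVec k)) ∧ AnisoHolder a (s - a k) g)
    (hol : ∀ k, s ≤ a k → ∃ C, ∀ i z t, |t| ≤ 1 →
        ‖f i (z + t • coordVec k) - f i z‖ ≤ C * |t| ^ (s / a k)) : AnisoHolder a s f := by
  refine .mk bdd (fun k hk i z => ?_) (fun k hk => ?_) (fun k hk => ?_)
  · obtain ⟨g, hg, -⟩ := der k hk
    exact (hg i z).lineDifferentiableAt
  · obtain ⟨g, hg, hg'⟩ := der k hk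
    rwa [show pderivFam k f = g from funext fun i => funext fun z => (hg i z).lineDeriv]
  · obtain ⟨M, hM⟩ := bdd
    obtain ⟨C, hC⟩ := hol k hk
    exact ⟨_, holder_extend (div_pos hs (ha k)) hM hC⟩

theorem mono (ha : ∀ k, 0 < a k) (h : AnisoHolder a s f) {s' : ℝ} (hs' : 0 < s') (hss : s' ≤ s) :
    AnisoHolder a s' f := by
  induction h generalizing s' with
  | @mk s f bdd diff der hol ih =>
    have hf : AnisoHolder a s f := .mk bdd diff der hol
    refine intro ha hs' bdd (fun k hk => ⟨pderivFam k f,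
      hf.hasLineDerivAt (hk.trans_le hss), ih k (hk.trans_le hss) (by linarith) (by linarith)⟩)
      (fun k hk => ?_)
    obtain ⟨C, -, hC⟩ := hf.holder ha k (θ := s' / a k) (div_pos hs' (ha k))
      ((div_le_one (ha k)).2 hk) (by rw [div_mul_cancel₀ _ (ha k).ne']; exact hss)
    exact ⟨C, fun i z t _ => hC i z t⟩

theorem continuous (ha : ∀ k, 0 < a k) (hs : 0 < s) (h : AnisoHolder a s f) (i : ι) :
    Continuous (f i) := by
  have h1 : ∀ k, ∃ C, ∃ θ : ℝ, 0 < θ ∧ ∀ z t,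
      ‖f i (z + t • coordVec k) - f i z‖ ≤ C * |t| ^ θ := fun k => by
    obtain ⟨C, -, hC⟩ := h.holder ha k (θ := min 1 (s / a k))
      (lt_min one_pos (div_pos hs (ha k))) (min_le_left _ _)
      ((le_div_iff₀ (ha k)).1 (min_le_right _ _))
    exact ⟨C, _, lt_min one_pos (div_pos hs (ha k)), hC i⟩
  choose C θ hθ hC using h1
  refine continuous_iff_continuousAt.2 fun z => ?_
  refine tendsto_iff_norm_sub_tendsto_zero.2 ?_
  refine squeeze_zero (fun _ => norm_nonneg _) (fun w => norm_sub_le_sum_of_coord Finset.univ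
    (f := f i) (ω := fun k t => C k * |t| ^ θ k) (fun k _ => hC k) z w (by simp)) ?_
  have : Continuous fun w : K → ℝ => ∑ k, C k * |w k - z k| ^ θ k :=
    continuous_finsetSum _ fun k _ => continuous_const.mul
      (((continuous_apply k).sub continuous_const).abs.rpow_const fun _ => Or.inr (hθ k).le)
  convert this.tendsto z using 2
  simp [(hθ _).ne']

theorem const (ha : ∀ k, 0 < a k) (hs : 0 < s) {c : ι → F} (hc : ∃ C, ∀ i, ‖c i‖ ≤ C) :
    AnisoHolder a s (fun i (_ : K → ℝ) => c i) := by
  revert c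
  refine weight_induction ha (P := fun s => ∀ {c : ι → F}, (∃ C, ∀ i, ‖c i‖ ≤ C) →
    AnisoHolder a s (fun i (_ : K → ℝ) => c i)) (fun s hs ih c hc => ?_) s hs
  refine intro ha hs (hc.imp fun C h i _ => h i) (fun k hk => ⟨fun _ _ => 0, fun i z => ?_,
    ih _ (sub_pos.2 hk) ⟨k, le_rfl⟩ (c := fun _ => 0) ⟨0, by simp⟩⟩) (fun k hk => ⟨0, by simp⟩)
  exact hasDerivAt_const _ _

theorem add (ha : ∀ k, 0 < a k) (hs : 0 < s) {g : ι → (K → ℝ) → F} (hf : AnisoHolder a s f)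
    (hg : AnisoHolder a s g) : AnisoHolder a s (fun i z => f i z + g i z) := by
  induction hf generalizing g with
  | @mk s f bdd diff der hol ih =>
    have hf : AnisoHolder a s f := .mk bdd diff der hol
    obtain ⟨M, -, hM⟩ := hf.bound
    obtain ⟨M', -, hM'⟩ := hg.bound
    refine intro ha hs ⟨M + M', fun i z => (norm_add_le _ _).trans (add_le_add (hM i z) (hM' i z))⟩
      (fun k hk => ⟨_, fun i z => ?_, ih k hk (sub_pos.2 hk) (hg.pderiv hk)⟩) (fun k hk => ?_)
    · exact HasDerivAt.add (hf.hasLineDerivAt hk i z) (hg.hasLineDerivAt hk i z)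
    · have hθ : 0 < s / a k := div_pos hs (ha k)
      have hθ1 : s / a k ≤ 1 := (div_le_one (ha k)).2 hk
      have hθs : s / a k * a k ≤ s := (div_mul_cancel₀ _ (ha k).ne').le
      obtain ⟨C, -, hC⟩ := hf.holder ha k hθ hθ1 hθs
      obtain ⟨C', -, hC'⟩ := hg.holder ha k hθ hθ1 hθs
      refine ⟨C + C', fun i z t _ => ?_⟩
      rw [add_sub_add_comm, add_mul]
      exact (norm_add_le _ _).trans (add_le_add (hC i z t) (hC' i z t))

theorem sum (ha : ∀ k, 0 < a k) (hs : 0 < s) {J : Type*} (S : Finset J)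
    {f : J → ι → (K → ℝ) → F} (h : ∀ j ∈ S, AnisoHolder a s (f j)) :
    AnisoHolder a s (fun i z => ∑ j ∈ S, f j i z) := by
  classical
  induction S using Finset.induction_on with
  | empty => simpa using const (F := F) ha hs (c := fun _ : ι => 0) ⟨0, by simp⟩
  | insert j S hj ih =>
    simp only [Finset.sum_insert hj]
    exact (h j (by simp)).add ha hs (ih fun k hk => h k (by simp [hk]))

/-- The product rule, by induction on the order: in each term one factor is differentiated and the
other is lowered to the same order by `mono`. -/
theorem bilin {G H : Type*} [NormedAddCommGroup G] [NormedSpace ℝ G] [NormedAddCommGroup H]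
    [NormedSpace ℝ H] (B : F →L[ℝ] G →L[ℝ] H) (ha : ∀ k, 0 < a k) (hs : 0 < s)
    {g : ι → (K → ℝ) → G} (hf : AnisoHolder a s f) (hg : AnisoHolder a s g) :
    AnisoHolder a s (fun i z => B (f i z) (g i z)) := by
  revert f g
  refine weight_induction ha (P := fun s => ∀ {f : ι → (K → ℝ) → F} {g : ι → (K → ℝ) → G},
    AnisoHolder a s f → AnisoHolder a s g → AnisoHolder a s (fun i z => B (f i z) (g i z)))
    (fun s hs ih f g hf hg => ?_) s hs
  obtain ⟨M, hM0, hM⟩ := hf.bound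
  obtain ⟨M', hM0', hM'⟩ := hg.bound
  have hB : ∀ x y, ‖B x y‖ ≤ ‖B‖ * ‖x‖ * ‖y‖ := B.le_opNorm₂
  refine intro ha hs ⟨‖B‖ * M * M', fun i z => (hB _ _).trans ?_⟩ (fun k hk => ?_) (fun k hk => ?_)
  · gcongr
    exacts [hM i z, hM' i z]
  · have hk' := sub_pos.2 hk
    refine ⟨fun i z => B (f i z) (pderivFam k g i z) + B (pderivFam k f i z) (g i z),
      fun i z => ?_, ?_⟩
    · have := B.hasFDerivAt_of_bilinear (hf.hasLineDerivAt hk i z).hasFDerivAt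
        (hg.hasLineDerivAt hk i z).hasFDerivAt
      have h2 := this.hasDerivAt
      simpa [HasLineDerivAt] using! h2
    · exact add ha hk' (ih _ hk' ⟨k, le_rfl⟩ (hf.mono ha hk' (by linarith [ha k])) (hg.pderiv hk))
        (ih _ hk' ⟨k, le_rfl⟩ (hf.pderiv hk) (hg.mono ha hk' (by linarith [ha k])))
  · have hθ : 0 < s / a k := div_pos hs (ha k)
    have hθ1 : s / a k ≤ 1 := (div_le_one (ha k)).2 hk
    have hθs : s / a k * a k ≤ s := (div_mul_cancel₀ _ (ha k).ne').le
    obtain ⟨C, hC0, hC⟩ := hf.holder ha k hθ hθ1 hθs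
    obtain ⟨C', hC0', hC'⟩ := hg.holder ha k hθ hθ1 hθs
    refine ⟨‖B‖ * M * C' + ‖B‖ * C * M', fun i z t _ => ?_⟩
    have e : B (f i (z + t • coordVec k)) (g i (z + t • coordVec k)) - B (f i z) (g i z)
        = B (f i (z + t • coordVec k)) (g i (z + t • coordVec k) - g i z)
          + B (f i (z + t • coordVec k) - f i z) (g i z) := by
      simp
    rw [e]
    calc _ ≤ ‖B‖ * M * (C' * |t| ^ (s / a k)) + ‖B‖ * (C * |t| ^ (s / a k)) * M' := by
          refine (norm_add_le _ _).trans (add_le_add ((hB _ _).trans ?_) ((hB _ _).trans ?_))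
          · gcongr
            exacts [hM _ _, hC' i z t]
          · gcongr
            exacts [hC i z t, hM' _ _]
      _ = _ := by ring

theorem smul (ha : ∀ k, 0 < a k) (hs : 0 < s) {f : ι → (K → ℝ) → ℝ} {g : ι → (K → ℝ) → F}
    (hf : AnisoHolder a s f) (hg : AnisoHolder a s g) :
    AnisoHolder a s (fun i z => f i z • g i z) :=
  bilin (ContinuousLinearMap.lsmul ℝ ℝ) ha hs hf hg

theorem clm {G : Type*} [NormedAddCommGroup G] [NormedSpace ℝ G] (ha : ∀ k, 0 < a k) (hs : 0 < s)
    (A : F →L[ℝ] G) (hf : AnisoHolder a s f) : AnisoHolder a s (fun i z => A (f i z)) :=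
  bilin (ContinuousLinearMap.id ℝ (F →L[ℝ] G)) ha hs
    (const (F := F →L[ℝ] G) (c := fun _ => A) ha hs ⟨‖A‖, fun _ => le_rfl⟩) hf

theorem neg (ha : ∀ k, 0 < a k) (hs : 0 < s) (hf : AnisoHolder a s f) :
    AnisoHolder a s (fun i z => -f i z) := by
  simpa using hf.clm ha hs (-ContinuousLinearMap.id ℝ F)

theorem sub (ha : ∀ k, 0 < a k) (hs : 0 < s) {g : ι → (K → ℝ) → F} (hf : AnisoHolder a s f)
    (hg : AnisoHolder a s g) : AnisoHolder a s (fun i z => f i z - g i z) := by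
  simpa [sub_eq_add_neg] using hf.add ha hs (hg.neg ha hs)

end AnisoHolder

end AnisoHolder

/-! ### Composition with maps adapted to the weights. -/

section Composition

variable {K K' : Type*} [Fintype K] [DecidableEq K] [Fintype K'] [DecidableEq K']
  {F : Type*} [NormedAddCommGroup F] [NormedSpace ℝ F] {ι : Type*}

/-- A family of maps `ℝ^K → ℝ^K'` of order `s` adapted to the weights `a` and `a'`: a component of
weight `a' k'` may depend on the coordinate `k` only if `a' k' ≤ a k`. The components need not be
bounded. -/
structure AnisoMap (a : K → ℝ) (a' : K' → ℝ) (s : ℝ) (H : ι → (K → ℝ) → K' → ℝ) : Prop where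
  indep : ∀ k k', a k < a' k' → ∀ i z (t : ℝ), H i (z + t • coordVec k) k' = H i z k'
  der : ∀ k k', a' k' ≤ a k → a k < s → ∃ g : ι → (K → ℝ) → ℝ,
    (∀ i z, HasLineDerivAt ℝ (fun w => H i w k') (g i z) z (coordVec k)) ∧
      AnisoHolder a (s - a k) g
  hol : ∀ k k', a' k' ≤ a k → s ≤ a k → ∃ C, 0 ≤ C ∧ ∀ i z (t : ℝ), |t| ≤ 1 →
    |H i (z + t • coordVec k) k' - H i z k'| ≤ C * |t| ^ (max (a' k') s / a k)

variable {a : K → ℝ} {a' : K' → ℝ} {s : ℝ} {H : ι → (K → ℝ) → K' → ℝ}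

theorem AnisoMap.mono (ha : ∀ k, 0 < a k) (hH : AnisoMap a a' s H) {s' : ℝ} (hs' : 0 < s')
    (hss : s' ≤ s) : AnisoMap a a' s' H where
  indep := hH.indep
  der k k' hk hks := by
    obtain ⟨g, hg, hg'⟩ := hH.der k k' hk (hks.trans_le hss)
    exact ⟨g, hg, hg'.mono ha (sub_pos.2 hks) (by linarith)⟩
  hol k k' hk hks := by
    have hpos : 0 < max (a' k') s' / a k := div_pos (lt_max_of_lt_right hs') (ha k)
    rcases lt_or_ge (a k) s with h | h
    · obtain ⟨g, hg, hg'⟩ := hH.der k k' hk h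
      obtain ⟨C, hC0, hC⟩ := hg'.bound
      refine ⟨C, hC0, fun i z t ht => (norm_line_sub_le (hg i) (hC i) z t).trans ?_⟩
      gcongr
      simpa using Real.rpow_le_rpow_of_exponent_ge_of_imp (abs_nonneg t) ht
        ((div_le_one (ha k)).2 (max_le hk hks)) (fun _ h0 => absurd h0 one_ne_zero)
    · obtain ⟨C, hC0, hC⟩ := hH.hol k k' hk h
      refine ⟨C, hC0, fun i z t ht => (hC i z t ht).trans ?_⟩
      have hle : max (a' k') s' / a k ≤ max (a' k') s / a k := by
        have := ha k
        gcongr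
      gcongr ?_ * ?_
      exact Real.rpow_le_rpow_of_exponent_ge_of_imp (abs_nonneg t) ht hle
        (fun _ h0 => absurd h0 (hpos.trans_le hle).ne')

theorem AnisoMap.hasFDerivAt_line {f : ι → (K' → ℝ) → F} (ha' : ∀ k, 0 < a' k)
    (hf : AnisoHolder a' s f) (hH : AnisoMap a a' s H) {k : K} (hk : a k < s)
    {g : K' → ι → (K → ℝ) → ℝ} (hg : ∀ k', a' k' ≤ a k → ∀ i z,
      HasLineDerivAt ℝ (fun w => H i w k') (g k' i z) z (coordVec k)) (i : ι) (z : K → ℝ) :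
    HasLineDerivAt ℝ (fun w => f i (H i w))
      (∑ k' with a' k' ≤ a k, g k' i z • pderivFam k' f i (H i z)) z (coordVec k) := by
  have h0 : z + (0 : ℝ) • (coordVec k : K → ℝ) = z := by simp
  have := (hasFDerivAt_comp_coord (W := ℝ) (Finset.univ.filter fun k' => a' k' ≤ a k) (f := f i)
    (f' := fun k' => pderivFam k' f i)
    (c := fun t : ℝ => H i (z + t • coordVec k)) (w := 0)
    (c' := fun k' => ContinuousLinearMap.toSpanSingleton ℝ (g k' i z))
    (fun k' hk' => hf.hasLineDerivAt ((Finset.mem_filter.1 hk').2.trans_lt hk) i)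
    (fun k' hk' => by
      have h1 := (Finset.mem_filter.1 hk').2.trans_lt hk
      exact (hf.pderiv h1).continuous ha' (sub_pos.2 h1) i)
    (fun k' hk' => HasDerivAt.hasFDerivAt (hg k' (Finset.mem_filter.1 hk').2 i z))
    (fun k' hk' t => by
      simp only [Finset.mem_filter, Finset.mem_univ, true_and, not_le] at hk'
      rw [hH.indep k k' hk', hH.indep k k' hk'])).hasDerivAt
  simpa [HasLineDerivAt, h0] using! this

/-- Only inner components with `a' k' ≤ a k` move along `k`. Differentiating `f` in such a `k'`
leaves order `s - a' k' ≥ s - a k`, so the chain rule closes the induction on the order. -/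
theorem AnisoHolder.comp {f : ι → (K' → ℝ) → F} (ha : ∀ k, 0 < a k) (ha' : ∀ k, 0 < a' k)
    (hs : 0 < s) (hf : AnisoHolder a' s f) (hH : AnisoMap a a' s H) :
    AnisoHolder a s (fun i z => f i (H i z)) := by
  revert f
  refine weight_induction ha (P := fun s => AnisoMap a a' s H → ∀ {f : ι → (K' → ℝ) → F},
    AnisoHolder a' s f → AnisoHolder a s (fun i z => f i (H i z)))
    (fun s hs ih hH f hf => ?_) s hs hH
  refine intro ha hs (hf.bound.imp fun C h i z => h.2 i _) (fun k hk => ?_) (fun k hk => ?_)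
  · have hks := sub_pos.2 hk
    choose! g hg hg' using fun k' (hk' : a' k' ≤ a k) => hH.der k k' hk' hk
    refine ⟨_, hH.hasFDerivAt_line ha' hf hk hg, ?_⟩
    refine sum ha hks _ fun k' hk' => ?_
    have hk'' := (Finset.mem_filter.1 hk').2
    refine smul ha hks (hg' k' hk'') ?_
    exact ih (s - a k) hks ⟨k, le_rfl⟩ (hH.mono ha hks (by linarith [ha k]))
      ((hf.pderiv (hk''.trans_lt hk)).mono ha' hks (by linarith))
  · choose! C hC0 hC using fun k' (hk' : a' k' ≤ a k) => hH.hol k k' hk' hk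
    -- The outer exponent is `θ = min 1 (s / a' k')`, and `max (a' k') s * θ = s` in both cases.
    -- This identity is why the exponent in `AnisoMap.hol` contains the maximum.
    have h1 : ∀ k', ∃ θ M : ℝ, 0 < θ ∧ 0 ≤ M ∧ (a' k' ≤ a k → s / a k ≤ max (a' k') s / a k * θ) ∧
        ∀ i z t, ‖f i (z + t • coordVec k') - f i z‖ ≤ M * |t| ^ θ := fun k' => by
      have hθ0 : 0 < min 1 (s / a' k') := lt_min one_pos (div_pos hs (ha' k'))
      obtain ⟨M, hM0, hM⟩ := hf.holder ha' k' (θ := min 1 (s / a' k')) hθ0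
        (min_le_left _ _) ((le_div_iff₀ (ha' k')).1 (min_le_right _ _))
      refine ⟨_, M, hθ0, hM0, fun _ => ?_, hM⟩
      rw [div_mul_eq_mul_div]
      have := ha k
      gcongr
      rcases le_total (a' k') s with h | h
      · rw [max_eq_right h, min_eq_left ((one_le_div (ha' k')).2 h), mul_one]
      · rw [max_eq_left h, min_eq_right ((div_le_one (ha' k')).2 h), mul_div_cancel₀ _ (ha' k').ne']
    choose θ M hθ0 hM0 hθ hM using h1
    refine ⟨∑ k' with a' k' ≤ a k, M k' * C k' ^ θ k', fun i z t ht => ?_⟩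
    refine (norm_sub_le_sum_of_coord (Finset.univ.filter fun k' => a' k' ≤ a k)
      (ω := fun k' t => M k' * |t| ^ θ k') (fun k' _ => hM k' i) _ _ (fun k' hk' => ?_)).trans ?_
    · simp only [Finset.mem_filter, Finset.mem_univ, true_and, not_le] at hk'
      exact hH.indep k k' hk' i z t
    · rw [Finset.sum_mul]
      refine Finset.sum_le_sum fun k' hk' => ?_
      have hk'' := (Finset.mem_filter.1 hk').2
      rw [mul_assoc]
      refine mul_le_mul_of_nonneg_left ?_ (hM0 k')
      have hle := hθ k' hk''
      calc |H i (z + t • coordVec k) k' - H i z k'| ^ θ k'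
          ≤ (C k' * |t| ^ (max (a' k') s / a k)) ^ θ k' := by
            refine Real.rpow_le_rpow (abs_nonneg _) (hC k' hk'' i z t ht) (hθ0 k').le
        _ = C k' ^ θ k' * |t| ^ (max (a' k') s / a k * θ k') := by
            rw [Real.mul_rpow (hC0 k' hk'') (by positivity), ← Real.rpow_mul (abs_nonneg t)]
        _ ≤ C k' ^ θ k' * |t| ^ (s / a k) := by
            refine mul_le_mul_of_nonneg_left ?_ (Real.rpow_nonneg (hC0 k' hk'') _)
            exact Real.rpow_le_rpow_of_exponent_ge_of_imp (abs_nonneg t) ht hle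
              (fun _ h0 => absurd h0 ((div_pos hs (ha k)).trans_le hle).ne')

/-- Affine families with bounded coefficients are adapted. -/
theorem AnisoMap.of_affine (ha : ∀ k, 0 < a k) {A : ι → K' → K → ℝ}
    (e : ∀ i z (t : ℝ) k k', H i (z + t • coordVec k) k' = H i z k' + t * A i k' k)
    (hA : ∃ C, ∀ i k' k, |A i k' k| ≤ C) (h0 : ∀ i k' k, a k < a' k' → A i k' k = 0) :
    AnisoMap a a' s H := by
  obtain ⟨C, hC⟩ := hA
  refine ⟨fun k k' hk i z t => ?_, fun k k' hk hks => ?_, fun k k' hk hks => ?_⟩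
  · rw [e, h0 i k' k hk, mul_zero, add_zero]
  · refine ⟨fun i _ => A i k' k, fun i z => ?_, AnisoHolder.const ha (sub_pos.2 hks)
      ⟨C, fun i => hC i k' k⟩⟩
    unfold HasLineDerivAt
    simp only [e]
    simpa using ((hasDerivAt_id (0 : ℝ)).mul_const (A i k' k)).const_add (H i z k')
  · refine ⟨max C 0, le_max_right _ _, fun i z t ht => ?_⟩
    have hle : max (a' k') s / a k ≤ 1 := (div_le_one (ha k)).2 (max_le hk hks)
    rw [e, add_sub_cancel_left, abs_mul, mul_comm]
    gcongr ?_ * ?_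
    · exact (hC i k' k).trans (le_max_left _ _)
    · simpa using Real.rpow_le_rpow_of_exponent_ge_of_imp (abs_nonneg t) ht hle
        (fun _ h0 => absurd h0 one_ne_zero)

end Composition

/-! ### Inversion of units. -/

section Inverse

variable {K : Type*} [Fintype K] [DecidableEq K] {ι : Type*} {a : K → ℝ} {s : ℝ}
  {A : Type*} [NormedRing A] [NormedAlgebra ℝ A] [HasSummableGeomSeries A]

theorem AnisoHolder.ringInverse (ha : ∀ k, 0 < a k) (hs : 0 < s) {f : ι → (K → ℝ) → A}
    (hf : AnisoHolder a s f) (hu : ∀ i z, IsUnit (f i z)) {C : ℝ}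
    (hC : ∀ i z, ‖Ring.inverse (f i z)‖ ≤ C) :
    AnisoHolder a s (fun i z => Ring.inverse (f i z)) := by
  revert hf
  refine weight_induction ha (P := fun s => AnisoHolder a s f →
    AnisoHolder a s (fun i z => Ring.inverse (f i z))) (fun s hs ih hf => ?_) s hs
  refine intro ha hs ⟨C, hC⟩ (fun k hk => ?_) (fun k hk => ?_)
  · have hks := sub_pos.2 hk
    -- The derivative of the inverse involves the inverse itself only at the lower order `s - a k`,
    -- where the induction hypothesis applies.
    refine ⟨fun i z => -(Ring.inverse (f i z) * pderivFam k f i z * Ring.inverse (f i z)),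
      fun i z => ?_, ?_⟩
    · obtain ⟨u, hu⟩ := hu i z
      have h0 : z + (0 : ℝ) • (coordVec k : K → ℝ) = z := by simp
      have h1 := hf.hasLineDerivAt hk i z
      have h2 : HasFDerivAt Ring.inverse (-ContinuousLinearMap.mulLeftRight ℝ A ↑u⁻¹ ↑u⁻¹)
          (f i (z + (0 : ℝ) • coordVec k)) := by
        rw [h0, ← hu]; exact hasFDerivAt_ringInverse u
      have h3 := h2.comp_hasDerivAt (0 : ℝ) h1
      beta_reduce
      rw [← hu, Ring.inverse_unit]
      simpa [HasLineDerivAt] using! h3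
    · have h1 := ih _ hks ⟨k, le_rfl⟩ (hf.mono ha hks (by linarith [ha k]))
      exact neg ha hks (bilin (ContinuousLinearMap.mul ℝ A) ha hks
        (bilin (ContinuousLinearMap.mul ℝ A) ha hks h1 (hf.pderiv hk)) h1)
  · have hθ : 0 < s / a k := div_pos hs (ha k)
    obtain ⟨M, hM0, hM⟩ := hf.holder ha k hθ ((div_le_one (ha k)).2 hk)
      (div_mul_cancel₀ _ (ha k).ne').le
    refine ⟨C * M * C, fun i z t _ => ?_⟩
    have hC0 : 0 ≤ C := (norm_nonneg _).trans (hC i z)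
    set w := z + t • coordVec k
    have e : Ring.inverse (f i w) - Ring.inverse (f i z)
        = -(Ring.inverse (f i w) * (f i w - f i z) * Ring.inverse (f i z)) := by
      rw [mul_sub, Ring.inverse_mul_cancel _ (hu i w), sub_mul, mul_assoc,
        Ring.mul_inverse_cancel _ (hu i z)]
      simp
    rw [e, norm_neg]
    calc _ ≤ C * (M * |t| ^ (s / a k)) * C := by
          refine (norm_mul_le _ _).trans (mul_le_mul ((norm_mul_le _ _).trans ?_) (hC _ _)
            (norm_nonneg _) (by positivity))
          exact mul_le_mul (hC _ _) (hM i z t) (norm_nonneg _) hC0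
      _ = _ := by ring

end Inverse

/-! ### Smoothness of fixed points of uniform contractions. -/

section FixedPoint

theorem Sum.elim_add_smul_coordVec_inl {P J : Type*} [DecidableEq P] [DecidableEq J] (p : P → ℝ)
    (q : J → ℝ) (k : P) (t : ℝ) :
    Sum.elim (p + t • coordVec k) q = Sum.elim p q + t • coordVec (Sum.inl k) := by
  ext (j | j) <;> simp [Pi.single_apply]

theorem Sum.elim_add_smul_coordVec_inr {P J : Type*} [DecidableEq P] [DecidableEq J] (p : P → ℝ)
    (q : J → ℝ) (k : J) (t : ℝ) :
    Sum.elim p (q + t • coordVec k) = Sum.elim p q + t • coordVec (Sum.inr k) := by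
  ext (j | j) <;> simp [Pi.single_apply]

theorem abs_rpow_le_abs_rpow {t x y : ℝ} (ht : |t| ≤ 1) (hx : 0 < x) (hxy : x ≤ y) :
    |t| ^ y ≤ |t| ^ x :=
  Real.rpow_le_rpow_of_exponent_ge_of_imp (abs_nonneg t) ht hxy
    (fun _ h0 => absurd h0 (hx.trans_le hxy).ne')

variable {P J : Type*} [Fintype P] [DecidableEq P] [Fintype J] [DecidableEq J] {ι : Type*}
  {a : P → ℝ} {a₀ : ℝ}

/-- The new coordinates carry the smallest weight `a₀`, so they may depend on all of `p`. The
exponents in `hol` belong to order `1`: at a lower order `s < a₀` an adapted map still needs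
exponent `a₀ / a k`, more than order `s` of `b` provides. -/
theorem AnisoMap.graph (ha : ∀ k, 0 < a k) (ha₁ : ∀ k, a₀ ≤ a k) {b : ι → (P → ℝ) → J → ℝ} {s : ℝ}
    (hs : 0 < s) (hb : AnisoHolder a s b)
    (hol : ∀ k, ∃ C, ∀ i p t, |t| ≤ 1 →
      ‖b i (p + t • coordVec k) - b i p‖ ≤ C * |t| ^ min 1 (1 / a k)) (h01 : a₀ ≤ 1) (hs1 : s ≤ 1) :
    AnisoMap a (Sum.elim a fun _ : J => a₀) s (fun i p => Sum.elim p (b i p)) := by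
  refine ⟨?_, ?_, ?_⟩
  · rintro k (l | j) hk i z t
    · have : l ≠ k := by rintro rfl; simp at hk
      simp [this]
    · exact absurd (ha₁ k) (by simpa using hk)
  · rintro k (l | j) - hks
    · refine ⟨fun _ _ => coordVec k l, fun i z => ?_,
        AnisoHolder.const ha (sub_pos.2 hks) ⟨‖(coordVec k l : ℝ)‖, fun _ => le_rfl⟩⟩
      have h := ((hasDerivAt_id (0 : ℝ)).mul_const (coordVec k l : ℝ)).const_add (z l)
      simpa [HasLineDerivAt] using h
    · refine ⟨fun i z => pderivFam k b i z j, fun i z => ?_, ?_⟩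
      · exact hasDerivAt_pi.1 (hb.hasLineDerivAt hks i z) j
      · exact (hb.pderiv hks).clm ha (sub_pos.2 hks) (ContinuousLinearMap.proj (R := ℝ) j)
  · rintro k (l | j) hk hks
    · refine ⟨1, zero_le_one, fun i z t ht => ?_⟩
      have h1 := abs_rpow_le_abs_rpow ht (div_pos (lt_max_of_lt_right hs) (ha k))
        ((div_le_one (ha k)).2 (max_le hk hks))
      have h2 : |(Pi.single k 1 : P → ℝ) l| ≤ 1 := by
        by_cases h : l = k
        · subst h; simp
        · simp [h]
      simp only [Sum.elim_inl, Pi.add_apply, Pi.smul_apply, smul_eq_mul, add_sub_cancel_left,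
        abs_mul, one_mul]
      calc _ ≤ |t| * 1 := by gcongr
        _ ≤ _ := by simpa using h1
    · obtain ⟨C, hC⟩ := hol k
      refine ⟨max C 0, le_max_right _ _, fun i z t ht => ?_⟩
      refine ((norm_le_pi_norm (b i (z + t • coordVec k) - b i z) j).trans (hC i z t ht)).trans ?_
      have h3 := abs_rpow_le_abs_rpow ht (x := max a₀ s / a k) (y := min 1 (1 / a k))
        (div_pos (lt_max_of_lt_right hs) (ha k))
        (le_min ((div_le_one (ha k)).2 (max_le (ha₁ k) hks)) (by
          have := ha k
          gcongr
          exact max_le h01 hs1))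
      exact mul_le_mul (le_max_left _ _) h3 (by positivity) (le_max_right _ _)

/-- The partial differential in the last group of coordinates. -/
noncomputable def partialFDeriv (r : ι → (P ⊕ J → ℝ) → J → ℝ) (i : ι) (z : P ⊕ J → ℝ) :
    (J → ℝ) →L[ℝ] (J → ℝ) :=
  ∑ j, (ContinuousLinearMap.proj (R := ℝ) j).smulRight (pderivFam (Sum.inr j) r i z)

variable {r : ι → (P ⊕ J → ℝ) → J → ℝ}

theorem AnisoHolder.hasFDerivAt_line_prod (ha : ∀ k, 0 < a k) (h0 : 0 < a₀) (h01 : a₀ < 1)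
    (hr : AnisoHolder (Sum.elim a fun _ : J => a₀) 1 r) {k : P} (hk : a k < 1) (i : ι) (p : P → ℝ)
    (q : J → ℝ) :
    HasFDerivAt (fun x : ℝ × (J → ℝ) => r i (Sum.elim (p + x.1 • coordVec k) x.2))
      ((ContinuousLinearMap.fst ℝ ℝ (J → ℝ)).smulRight (pderivFam (Sum.inl k) r i (Sum.elim p q))
        + (partialFDeriv r i (Sum.elim p q)).comp (ContinuousLinearMap.snd ℝ ℝ (J → ℝ)))
      ((0 : ℝ), q) := by
  have ha' : ∀ l, 0 < (Sum.elim a fun _ : J => a₀) l := by rintro (l | l) <;> simp [ha, h0]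
  have hS : ∀ l ∈ insert (Sum.inl k) (Finset.univ.image (Sum.inr : J → P ⊕ J)),
      (Sum.elim a fun _ : J => a₀) l < 1 := by
    intro l hl
    simp only [Finset.mem_insert, Finset.mem_image, Finset.mem_univ, true_and] at hl
    rcases hl with rfl | ⟨j, rfl⟩ <;> simpa
  have h1 := hasFDerivAt_comp_coord (W := ℝ × (J → ℝ))
    (insert (Sum.inl k) (Finset.univ.image (Sum.inr : J → P ⊕ J))) (f := r i)
    (f' := fun l => pderivFam l r i)
    (c := fun x => Sum.elim (p + x.1 • coordVec k) x.2) (w := ((0 : ℝ), q))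
    (c' := Sum.elim (fun _ => ContinuousLinearMap.fst ℝ ℝ (J → ℝ))
      fun j => (ContinuousLinearMap.proj (R := ℝ) j).comp (ContinuousLinearMap.snd ℝ ℝ (J → ℝ)))
    (fun l hl => hr.hasLineDerivAt (hS l hl) i)
    (fun l hl => (hr.pderiv (hS l hl)).continuous ha' (sub_pos.2 (hS l hl)) i)
    (by
      intro l hl
      simp only [Finset.mem_insert, Finset.mem_image, Finset.mem_univ, true_and] at hl
      rcases hl with rfl | ⟨j, rfl⟩
      · have := (ContinuousLinearMap.fst ℝ ℝ (J → ℝ)).hasFDerivAt (x := ((0 : ℝ), q))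
        simpa using this.const_add (p k)
      · exact ((ContinuousLinearMap.proj (R := ℝ) j).comp
          (ContinuousLinearMap.snd ℝ ℝ (J → ℝ))).hasFDerivAt)
    (by
      rintro (l | j) hl x
      · have : l ≠ k := by rintro rfl; simp at hl
        simp [this]
      · simp at hl)
  refine h1.congr_fderiv ?_
  rw [Finset.sum_insert (by simp), Finset.sum_image Sum.inr_injective.injOn]
  ext x j <;> simp [partialFDeriv]

theorem AnisoHolder.hasFDerivAt_last (ha : ∀ k, 0 < a k) (h0 : 0 < a₀) (h01 : a₀ < 1)
    (hr : AnisoHolder (Sum.elim a fun _ : J => a₀) 1 r) (i : ι) (p : P → ℝ) (q : J → ℝ) :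
    HasFDerivAt (fun q => r i (Sum.elim p q)) (partialFDeriv r i (Sum.elim p q)) q := by
  have ha' : ∀ l, 0 < (Sum.elim a fun _ : J => a₀) l := by rintro (l | l) <;> simp [ha, h0]
  have hS : ∀ l ∈ Finset.univ.image (Sum.inr : J → P ⊕ J),
      (Sum.elim a fun _ : J => a₀) l < 1 := by
    intro l hl
    simp only [Finset.mem_image, Finset.mem_univ, true_and] at hl
    rcases hl with ⟨j, rfl⟩; simpa
  have h1 := hasFDerivAt_comp_coord (W := J → ℝ)
    (Finset.univ.image (Sum.inr : J → P ⊕ J)) (f := r i)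
    (f' := fun l => pderivFam l r i) (c := fun x => Sum.elim p x) (w := q)
    (c' := Sum.elim (fun _ => 0) fun j => (ContinuousLinearMap.proj (R := ℝ) j))
    (fun l hl => hr.hasLineDerivAt (hS l hl) i)
    (fun l hl => (hr.pderiv (hS l hl)).continuous ha' (sub_pos.2 (hS l hl)) i)
    (by
      intro l hl
      simp only [Finset.mem_image, Finset.mem_univ, true_and] at hl
      rcases hl with ⟨j, rfl⟩
      exact hasFDerivAt_apply j q)
    (by
      rintro (l | j) hl x
      · simp
      · simp at hl)
  refine h1.congr_fderiv ?_
  rw [Finset.sum_image Sum.inr_injective.injOn]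
  simp [partialFDeriv]

theorem norm_ringInverse_one_sub_le {E : Type*} [NormedAddCommGroup E] [NormedSpace ℝ E]
    [CompleteSpace E] {R : E →L[ℝ] E} (hR : ‖R‖ ≤ 1 / 2) :
    IsUnit (1 - R) ∧ ‖Ring.inverse (1 - R)‖ ≤ 2 := by
  have hu : IsUnit (1 - R) := isUnit_one_sub_of_norm_lt_one (by linarith)
  refine ⟨hu, ?_⟩
  have h1 : Ring.inverse (1 - R) = 1 + R * Ring.inverse (1 - R) := by
    have := Ring.mul_inverse_cancel _ hu
    rw [sub_mul, one_mul] at this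
    exact sub_eq_iff_eq_add.1 this
  have h2 : ‖Ring.inverse (1 - R)‖ ≤ 1 + 1 / 2 * ‖Ring.inverse (1 - R)‖ := by
    calc _ = ‖1 + R * Ring.inverse (1 - R)‖ := by rw [← h1]
      _ ≤ ‖(1 : E →L[ℝ] E)‖ + ‖R * Ring.inverse (1 - R)‖ := norm_add_le _ _
      _ ≤ 1 + ‖R‖ * ‖Ring.inverse (1 - R)‖ :=
        add_le_add ContinuousLinearMap.norm_id_le (norm_mul_le _ _)
      _ ≤ _ := by gcongr
  linarith

/-- The solution of a uniformly contracting fixed point equation inherits its smoothness. -/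
theorem AnisoHolder.fixedPoint (ha : ∀ k, 0 < a k) (h0 : 0 < a₀) (h01 : a₀ < 1)
    (ha₁ : ∀ k, a₀ ≤ a k) (hr : AnisoHolder (Sum.elim a fun _ : J => a₀) 1 r)
    (hlip : ∀ i p q q', ‖r i (Sum.elim p q) - r i (Sum.elim p q')‖ ≤ 1 / 2 * ‖q - q'‖)
    {b : ι → (P → ℝ) → J → ℝ} (hb : ∀ i p, b i p = r i (Sum.elim p (b i p))) :
    AnisoHolder a 1 b := by
  have ha' : ∀ l, 0 < (Sum.elim a fun _ : J => a₀) l := by rintro (l | l) <;> simp [ha, h0]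
  -- A priori estimate: the increment of `b` is at most half of itself plus the increment of `r` in
  -- `p`.
  have hol : ∀ k, ∃ C, 0 ≤ C ∧ ∀ i p t,
      ‖b i (p + t • coordVec k) - b i p‖ ≤ C * |t| ^ min 1 (1 / a k) := fun k => by
    obtain ⟨C, hC0, hC⟩ := hr.holder ha' (Sum.inl k) (θ := min 1 (1 / a k))
      (lt_min one_pos (one_div_pos.2 (ha k))) (min_le_left _ _)
      ((le_div_iff₀ (ha k)).1 (min_le_right _ _))
    refine ⟨2 * C, by positivity, fun i p t => ?_⟩
    have h1 := hlip i (p + t • coordVec k) (b i (p + t • coordVec k)) (b i p)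
    have h2 := hC i (Sum.elim p (b i p)) t
    rw [← Sum.elim_add_smul_coordVec_inl] at h2
    have h3 := norm_sub_le_norm_sub_add_norm_sub
      (r i (Sum.elim (p + t • coordVec k) (b i (p + t • coordVec k))))
      (r i (Sum.elim (p + t • coordVec k) (b i p))) (r i (Sum.elim p (b i p)))
    rw [← hb, ← hb] at h3
    rw [← hb] at h1 h2
    linarith
  have hR : ∀ i p q, ‖partialFDeriv r i (Sum.elim p q)‖ ≤ 1 / 2 := fun i p q =>
    (hr.hasFDerivAt_last ha h0 h01 i p q).le_of_lip' (by norm_num)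
      (Filter.Eventually.of_forall fun q' => hlip i p q' q)
  -- Differentiating `b = r(p, b)` gives `(1 - ∂_q r) ∂_k b = ∂_k r`; `N` inverts the factor on the
  -- left, with norm at most `2`.
  set N : ι → (P → ℝ) → (J → ℝ) →L[ℝ] (J → ℝ) := fun i p =>
    Ring.inverse (1 - partialFDeriv r i (Sum.elim p (b i p))) with hN
  have hder : ∀ k, a k < 1 → ∀ i p, HasLineDerivAt ℝ (b i)
      (N i p (pderivFam (Sum.inl k) r i (Sum.elim p (b i p)))) p (coordVec k) := by
    intro k hk i p
    have hz : p + (0 : ℝ) • (coordVec k : P → ℝ) = p := by simp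
    set ρ := pderivFam (Sum.inl k) r i (Sum.elim p (b i p))
    set R := partialFDeriv r i (Sum.elim p (b i p)) with hRdef
    obtain ⟨C, hC0, hC⟩ := hol k
    rw [min_eq_left ((one_le_div (ha k)).2 hk.le)] at hC
    set β : ℝ → J → ℝ := fun t => b i (p + t • coordVec k) with hβ
    have hβ0 : β 0 = b i p := by simp [hβ]
    have hβO : (fun t => (t, β t) - ((0 : ℝ), b i p)) =O[𝓝 0] fun t : ℝ => t - 0 := by
      refine Asymptotics.IsBigO.of_bound (max 1 C) (Filter.Eventually.of_forall fun t => ?_)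
      rw [Prod.mk_sub_mk, Prod.norm_mk, sub_zero, max_mul_of_nonneg _ _ (norm_nonneg t)]
      refine max_le_max (by simp) ?_
      simpa using hC i p t
    have hβc : Filter.Tendsto (fun t => (t, β t)) (𝓝 0) (𝓝 ((0 : ℝ), b i p)) := by
      rw [tendsto_iff_norm_sub_tendsto_zero]
      exact hβO.norm_left.trans_tendsto (by simpa using! Filter.tendsto_id)
    have h1 := ((hr.hasFDerivAt_line_prod ha h0 h01 hk i p (b i p)).isLittleO.comp_tendsto
      hβc).trans_isBigO hβO
    have hu := norm_ringInverse_one_sub_le (hR i p (b i p))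
    have h2 := (N i p).isBigO_comp (fun t : ℝ => (1 - R) (β t - β 0) - t • ρ) (𝓝 0)
    have h3 : (fun t : ℝ => (1 - R) (β t - β 0) - t • ρ) =o[𝓝 0] fun t : ℝ => t - 0 := by
      refine h1.congr_left fun t => ?_
      have e1 : r i (Sum.elim (p + t • coordVec k) (β t)) = β t := (hb i _).symm
      simp only [Function.comp_apply, hz, e1, ← hb i p, hβ0, Prod.mk_sub_mk, sub_zero]
      simp [R, ρ]
      abel
    have h4 := h2.trans_isLittleO h3
    refine HasDerivAt.congr_deriv (f' := N i p ρ) ?_ rfl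
    rw [hasDerivAt_iff_isLittleO]
    refine h4.congr_left fun t => ?_
    have e2 : N i p ((1 - R) (β t - β 0)) = β t - β 0 := by
      rw [← mul_apply_eq_comp, hN]
      simp only [← hRdef]
      rw [Ring.inverse_mul_cancel _ hu.1]; rfl
    rw [map_sub, e2, map_smul]
    simp [β]
  -- Bootstrap: order `s - a k` of `b` gives order `s - a k` of `N` and of `∂_k r` along the graph
  -- of `b`, hence order `s` of `b`.
  refine weight_induction ha (P := fun s => s ≤ 1 → AnisoHolder a s b) (fun s hs ih hs1 => ?_)
    1 one_pos le_rfl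
  refine intro ha hs (hr.bound.imp fun C h i z => by rw [hb]; exact h.2 _ _) (fun k hk => ?_)
    (fun k hk => ?_)
  · have hks := sub_pos.2 hk
    have hk1 := hk.trans_le hs1
    refine ⟨_, hder k hk1, ?_⟩
    have hH := AnisoMap.graph ha ha₁ hks (ih (s - a k) hks ⟨k, le_rfl⟩ (by linarith [ha k]))
      (fun k => (hol k).imp fun C h i p t _ => h.2 i p t) h01.le (by linarith [ha k])
    have hcomp : ∀ l, (Sum.elim a fun _ : J => a₀) l ≤ a k →
        AnisoHolder a (s - a k) (fun i p => pderivFam l r i (Sum.elim p (b i p))) := fun l hl =>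
      AnisoHolder.comp ha ha' hks ((hr.pderiv (hl.trans_lt hk1)).mono ha' hks (by linarith)) hH
    refine bilin (ContinuousLinearMap.id ℝ ((J → ℝ) →L[ℝ] (J → ℝ))) ha hks ?_ (hcomp _ le_rfl)
    refine ringInverse ha hks (sub ha hks (const ha hks ⟨‖(1 : (J → ℝ) →L[ℝ] (J → ℝ))‖,
      fun _ => le_rfl⟩) ?_) (fun i p => (norm_ringInverse_one_sub_le (hR i p _)).1)
      (fun i p => (norm_ringInverse_one_sub_le (hR i p _)).2)
    exact sum ha hks _ fun j _ => (hcomp (Sum.inr j) (ha₁ k)).clm ha hks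
      (ContinuousLinearMap.smulRightL ℝ (J → ℝ) (J → ℝ) (ContinuousLinearMap.proj (R := ℝ) j))
  · obtain ⟨C, hC0, hC⟩ := hol k
    refine ⟨C, fun i p t ht => (hC i p t).trans ?_⟩
    gcongr ?_ * ?_
    refine abs_rpow_le_abs_rpow ht (div_pos hs (ha k)) (le_min ((div_le_one (ha k)).2 hk) ?_)
    have := ha k
    gcongr

end FixedPoint

/-! ### Uniform continuity and basic examples. -/

section Continuity

variable {K : Type*} [Fintype K] [DecidableEq K] {F : Type*} [NormedAddCommGroup F]
  [NormedSpace ℝ F] {ι : Type*} {a : K → ℝ} {s : ℝ} {f : ι → (K → ℝ) → F}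

namespace AnisoHolder

theorem equicontinuous (ha : ∀ k, 0 < a k) (hs : 0 < s) (h : AnisoHolder a s f) {ε : ℝ}
    (hε : 0 < ε) : ∃ δ > 0, ∀ i z w, ‖w - z‖ ≤ δ → ‖f i w - f i z‖ ≤ ε := by
  have h1 : ∀ k, ∃ C, ∃ θ : ℝ, 0 < θ ∧ ∀ i z t,
      ‖f i (z + t • coordVec k) - f i z‖ ≤ C * |t| ^ θ := fun k => by
    obtain ⟨C, -, hC⟩ := h.holder ha k (θ := min 1 (s / a k))
      (lt_min one_pos (div_pos hs (ha k))) (min_le_left _ _)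
      ((le_div_iff₀ (ha k)).1 (min_le_right _ _))
    exact ⟨C, _, lt_min one_pos (div_pos hs (ha k)), hC⟩
  choose C θ hθ hC using h1
  have hc : Continuous fun w : K → ℝ => ∑ k, C k * |w k| ^ θ k :=
    continuous_finsetSum _ fun k _ => continuous_const.mul
      ((continuous_apply k).abs.rpow_const fun _ => Or.inr (hθ k).le)
  obtain ⟨δ, hδ, hδ'⟩ := Metric.continuousAt_iff.1 (hc.continuousAt (x := 0)) ε hε
  refine ⟨δ / 2, by positivity, fun i z w hw => ?_⟩
  have h2 := hδ' (x := w - z) (by rw [dist_zero_right]; linarith)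
  refine (norm_sub_le_sum_of_coord Finset.univ
    (f := f i) (ω := fun k t => C k * |t| ^ θ k) (fun k _ => hC k i) z w (by simp)).trans ?_
  rw [Real.dist_eq] at h2
  simp only [Pi.zero_apply, abs_zero, Real.zero_rpow (hθ _).ne', mul_zero, Finset.sum_const_zero,
    sub_zero] at h2
  exact (le_abs_self _).trans h2.le

variable {W : Type*} [NormedAddCommGroup W] [NormedSpace ℝ W]

theorem hasFDerivAt_affine (ha : ∀ k, 0 < a k) (h : AnisoHolder a s f) (S : Finset K)
    (hS : ∀ k ∈ S, a k < s) (A : W →L[ℝ] (K → ℝ)) (hA : ∀ k, k ∉ S → ∀ w, A w k = 0) (c : K → ℝ)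
    (i : ι) (w : W) :
    HasFDerivAt (fun w => f i (A w + c)) (∑ k ∈ S, ((ContinuousLinearMap.proj (R := ℝ) k).comp
      A).smulRight (pderivFam k f i (A w + c))) w := by
  refine hasFDerivAt_comp_coord (c := fun w => A w + c) S
    (fun k hk => h.hasLineDerivAt (hS k hk) i)
    (fun k hk => (h.pderiv (hS k hk)).continuous ha (sub_pos.2 (hS k hk)) i) (fun k _ => ?_)
    (fun k hk x => by simp [hA k hk])
  exact ((ContinuousLinearMap.proj (R := ℝ) k).comp A).hasFDerivAt.add_const (c k)

theorem contDiff_affine (ha : ∀ k, 0 < a k) (h : AnisoHolder a s f) (S : Finset K)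
    (hS : ∀ k ∈ S, a k < s) (A : W →L[ℝ] (K → ℝ)) (hA : ∀ k, k ∉ S → ∀ w, A w k = 0) (c : K → ℝ)
    (i : ι) : ContDiff ℝ 1 (fun w => f i (A w + c)) := by
  have h1 := h.hasFDerivAt_affine ha S hS A hA c i
  refine contDiff_one_iff_fderiv.2 ⟨fun w => (h1 w).differentiableAt, ?_⟩
  rw [show fderiv ℝ (fun w => f i (A w + c)) = _ from funext fun w => (h1 w).fderiv]
  refine continuous_finsetSum _ fun k hk => ?_
  have h2 := ((h.pderiv (hS k hk)).continuous ha (sub_pos.2 (hS k hk)) i).comp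
    (A.continuous.add (continuous_const (y := c)))
  exact ((ContinuousLinearMap.smulRightL ℝ W F
    ((ContinuousLinearMap.proj (R := ℝ) k).comp A)).continuous.comp h2)

theorem pi (ha : ∀ k, 0 < a k) (hs : 0 < s) {J : Type*} [Fintype J]
    {f : ι → (K → ℝ) → J → ℝ} (h : ∀ j, AnisoHolder a s (fun i z => f i z j)) :
    AnisoHolder a s f := by
  classical
  have := sum ha hs Finset.univ (f := fun j i z => (ContinuousLinearMap.single ℝ (fun _ => ℝ) j)
    (f i z j)) (fun j _ => (h j).clm ha hs (ContinuousLinearMap.single ℝ (fun _ : J => ℝ) j))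
  convert this using 3 with i z
  ext l
  simp [Finset.sum_apply, Pi.single_apply]

/-- All derivatives of a compactly supported smooth function are bounded and of the same kind, so
every order is allowed. -/
theorem coord (ha : ∀ k, 0 < a k) (hs : 0 < s) {g : ℝ → F} (hg : ContDiff ℝ (⊤ : ℕ∞) g)
    (hg' : HasCompactSupport g) (k : K) : AnisoHolder a s (fun (_ : ι) z => g (z k)) := by
  revert g
  refine weight_induction ha (P := fun s => ∀ {g : ℝ → F}, ContDiff ℝ (⊤ : ℕ∞) g →
    HasCompactSupport g → AnisoHolder a s (fun (_ : ι) z => g (z k))) (fun s hs ih g hg hg' => ?_)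
    s hs
  have hd : ∀ t, HasDerivAt g (deriv g t) t := fun t =>
    (hg.differentiable (by simp) t).hasDerivAt
  have hd' : ContDiff ℝ (⊤ : ℕ∞) (deriv g) := (contDiff_infty_iff_deriv.1 hg).2
  have hline : ∀ l (z : K → ℝ), HasLineDerivAt ℝ (fun w : K → ℝ => g (w k))
      ((coordVec l k : ℝ) • deriv g (z k)) z (coordVec l) := fun l z => by
    have h1 : HasDerivAt (fun t : ℝ => z k + t * coordVec l k) (coordVec l k) 0 := by
      simpa using ((hasDerivAt_id (0 : ℝ)).mul_const (coordVec l k : ℝ)).const_add (z k)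
    have h2 : HasDerivAt g (deriv g (z k)) (z k + 0 * coordVec l k) := by simpa using hd (z k)
    exact h2.scomp (0 : ℝ) h1
  obtain ⟨C, hC⟩ := hg'.exists_bound_of_continuous hg.continuous
  obtain ⟨C', hC'⟩ := hg'.deriv.exists_bound_of_continuous hd'.continuous
  refine intro ha hs ⟨C, fun i z => hC _⟩ (fun l hl => ⟨_, fun i z => hline l z, ?_⟩)
    (fun l hl => ?_)
  · exact smul ha (sub_pos.2 hl) (const ha (sub_pos.2 hl) (c := fun _ => coordVec l k)
      ⟨‖(coordVec l k : ℝ)‖, fun _ => le_rfl⟩) (ih _ (sub_pos.2 hl) ⟨l, le_rfl⟩ hd' hg'.deriv)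
  · have hb : ∀ z : K → ℝ, ‖(coordVec l k : ℝ) • deriv g (z k)‖ ≤ ‖(coordVec l k : ℝ)‖ * C' :=
      fun z => by rw [norm_smul]; gcongr; exact hC' _
    have hC0 : 0 ≤ ‖(coordVec l k : ℝ)‖ * C' := (norm_nonneg _).trans (hb 0)
    refine ⟨_, fun i z t ht => (norm_line_sub_le (hline l) hb z t).trans
      (mul_le_mul_of_nonneg_left ?_ hC0)⟩
    simpa using abs_rpow_le_abs_rpow ht (div_pos hs (ha l)) ((div_le_one (ha l)).2 hl)

end AnisoHolder

end Continuity

/-! ### Smooth truncation of coordinates. -/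

section Clip

/-- A smooth compactly supported function that agrees with the identity on `[-ρ, ρ]`. -/
noncomputable def clip (ρ t : ℝ) : ℝ :=
  t * (⟨1, 2, one_pos, one_lt_two⟩ : ContDiffBump (0 : ℝ)) (t / ρ)

theorem clip_of_abs_le {ρ t : ℝ} (hρ : 0 < ρ) (ht : |t| ≤ ρ) : clip ρ t = t := by
  rw [clip, ContDiffBump.one_of_mem_closedBall, mul_one]
  simpa [abs_div, abs_of_pos hρ, div_le_one hρ] using ht

theorem clip_eq_mul {ρ : ℝ} (hρ : 0 < ρ) (t : ℝ) : clip ρ t = ρ * clip 1 (t / ρ) := by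
  simp only [clip, div_one]
  field_simp

theorem contDiff_clip (ρ : ℝ) : ContDiff ℝ (⊤ : ℕ∞) (clip ρ) :=
  contDiff_id.mul ((ContDiffBump.contDiff _).comp (contDiff_id.div_const ρ))

theorem clip_eq_zero {ρ t : ℝ} (hρ : 0 < ρ) (ht : 2 * ρ ≤ |t|) : clip ρ t = 0 := by
  rw [clip, ContDiffBump.zero_of_le_dist, mul_zero]
  simpa [abs_div, abs_of_pos hρ, le_div_iff₀ hρ] using ht

theorem abs_clip_le {ρ : ℝ} (hρ : 0 < ρ) (t : ℝ) : |clip ρ t| ≤ 2 * ρ := by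
  rcases le_total (2 * ρ) |t| with h | h
  · rw [clip_eq_zero hρ h, abs_zero]; positivity
  · rw [clip, abs_mul]
    calc _ ≤ 2 * ρ * 1 := by
          gcongr
          rw [abs_of_nonneg (ContDiffBump.nonneg _)]
          exact ContDiffBump.le_one _
      _ = _ := mul_one _

theorem hasCompactSupport_clip {ρ : ℝ} (hρ : 0 < ρ) : HasCompactSupport (clip ρ) := by
  refine HasCompactSupport.intro (isCompact_closedBall (0 : ℝ) (2 * ρ)) fun t ht => ?_
  exact clip_eq_zero hρ (by simpa using (not_le.1 (by simpa using ht)).le)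

/-- By scaling, the constant does not depend on `ρ`. This matters because the implicit function
theorem chooses `ρ` after `C`. -/
theorem exists_lipschitz_clip : ∃ C : ℝ, 1 ≤ C ∧ ∀ ρ > 0, ∀ t t',
    |clip ρ t - clip ρ t'| ≤ C * |t - t'| := by
  have h1 := contDiff_clip 1
  obtain ⟨C, hC⟩ := (hasCompactSupport_clip one_pos).deriv.exists_bound_of_continuous
    (contDiff_infty_iff_deriv.1 h1).2.continuous
  have h2 : ∀ t t', |clip 1 t - clip 1 t'| ≤ C * |t - t'| := fun t t' =>
    convex_univ.norm_image_sub_le_of_norm_deriv_le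
      (fun x _ => h1.differentiable (by simp) x) (fun x _ => hC x) (mem_univ t') (mem_univ t)
  refine ⟨max 1 C, le_max_left _ _, fun ρ hρ t t' => ?_⟩
  rw [clip_eq_mul hρ, clip_eq_mul hρ t', ← mul_sub, abs_mul, abs_of_pos hρ]
  calc ρ * |clip 1 (t / ρ) - clip 1 (t' / ρ)| ≤ ρ * (max 1 C * |t / ρ - t' / ρ|) := by
        gcongr
        exact (h2 _ _).trans (by gcongr; exact le_max_right _ _)
    _ = max 1 C * |t - t'| := by
        rw [← sub_div, abs_div, abs_of_pos hρ]
        field_simp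

variable {K : Type*} [Fintype K] [DecidableEq K] {ι : Type*} {a : K → ℝ} {s : ℝ}

theorem AnisoMap.translate_clip (ha : ∀ k, 0 < a k) (hs : 0 < s) {ρ : ℝ} (hρ : 0 < ρ)
    (c : ι → K → ℝ) : AnisoMap a a s (fun i z k => c i k + clip ρ (z k)) := by
  have hcs : ∀ k, ∀ s' > 0, AnisoHolder a s' (fun (_ : ι) (z : K → ℝ) => clip ρ (z k)) :=
    fun k s' hs' => AnisoHolder.coord ha hs' (contDiff_clip ρ) (hasCompactSupport_clip hρ) k
  obtain ⟨C, hC1, hC⟩ := exists_lipschitz_clip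
  refine ⟨fun k k' hk i z t => ?_, fun k k' hk hks => ?_, fun k k' hk hks => ?_⟩
  · have : k' ≠ k := by rintro rfl; exact lt_irrefl _ hk
    simp [this]
  · refine ⟨_, fun i z => ?_, (hcs k' s hs).pderiv hks⟩
    exact HasDerivAt.const_add (c i k') ((hcs k' s hs).hasLineDerivAt hks i z)
  · refine ⟨C, by linarith, fun i z t ht => ?_⟩
    rw [add_sub_add_left_eq_sub]
    refine (hC ρ hρ _ _).trans ?_
    gcongr
    by_cases h : k' = k
    · subst h
      simp [max_eq_left hks, (ha k').ne']
    · simp only [Pi.add_apply, Pi.smul_apply, Pi.single_apply, h, if_false, smul_zero, add_zero,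
        sub_self, abs_zero]
      positivity

end Clip

/-! ### The uniform implicit function theorem. -/

section ImplicitFunction

variable {P J : Type*} [Fintype P] [DecidableEq P] [Fintype J] [DecidableEq J] {ι : Type*}
  {a : P → ℝ} {a₀ : ℝ}

theorem norm_sum_elim {p : P → ℝ} {q : J → ℝ} {r : ℝ} (hr : 0 ≤ r) (hp : ‖p‖ ≤ r) (hq : ‖q‖ ≤ r) :
    ‖Sum.elim p q‖ ≤ r := by
  rw [pi_norm_le_iff_of_nonneg hr]
  rintro (l | j)
  · exact (norm_le_pi_norm p l).trans hp
  · exact (norm_le_pi_norm q j).trans hq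

/-- The implicit function theorem in anisotropic Hölder classes, uniform over a family. -/
theorem AnisoHolder.implicitFunction (ha : ∀ k, 0 < a k) (h0 : 0 < a₀) (h01 : a₀ < 1)
    (ha₁ : ∀ k, a₀ ≤ a k) {Φ : ι → (P ⊕ J → ℝ) → J → ℝ}
    (hΦ : AnisoHolder (Sum.elim a fun _ : J => a₀) 1 Φ) (hΦ0 : ∀ i, Φ i 0 = 0)
    (hΦ1 : ∀ i, partialFDeriv Φ i 0 = 1) {R : ℝ} (hR : 0 < R) :
    ∃ ρ σ : ℝ, 0 < ρ ∧ ρ ≤ R ∧ 0 < σ ∧ ∃ b : ι → (P → ℝ) → J → ℝ, AnisoHolder a 1 b ∧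
      (∀ i, b i 0 = 0) ∧ ∀ i p, ‖p‖ ≤ σ → ‖b i p‖ < ρ ∧
        ∀ q, ‖q‖ ≤ ρ → (Φ i (Sum.elim p q) = 0 ↔ q = b i p) := by
  have ha' : ∀ l, 0 < (Sum.elim a fun _ : J => a₀) l := by rintro (l | l) <;> simp [ha, h0]
  obtain ⟨C, hC1, hC⟩ := exists_lipschitz_clip
  have hC0 : 0 < C := by linarith
  have hpd : AnisoHolder (Sum.elim a fun _ : J => a₀) (1 - a₀) (partialFDeriv Φ) :=
    sum ha' (sub_pos.2 h01) _ fun j _ => (hΦ.pderiv (k := Sum.inr j) h01).clm ha' (sub_pos.2 h01)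
      (ContinuousLinearMap.smulRightL ℝ (J → ℝ) (J → ℝ) (ContinuousLinearMap.proj (R := ℝ) j))
  -- With `∂_q Φ` within `1 / (2C)` of the identity, and clipping `C`-Lipschitz, `r` below contracts
  -- by `1/2` in `q`. Clipped vectors have norm at most `2ρ`, hence `ρ ≤ δ / 2`.
  obtain ⟨δ, hδ, hδ'⟩ := hpd.equicontinuous ha' (sub_pos.2 h01) (ε := 1 / (2 * C)) (by positivity)
  set ρ := min (δ / 2) R with hρdef
  have hρ : 0 < ρ := lt_min (by positivity) hR
  have hρδ : 2 * ρ ≤ δ := by linarith [min_le_left (δ / 2) R]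
  set cl : (J → ℝ) → J → ℝ := fun q j => clip ρ (q j) with hcl
  set clP : (P → ℝ) → P → ℝ := fun q j => clip ρ (q j) with hclP
  have hcl_le : ∀ q, ‖cl q‖ ≤ 2 * ρ := fun q =>
    (pi_norm_le_iff_of_nonneg (by positivity)).2 fun j => abs_clip_le hρ _
  have hclP_le : ∀ q, ‖clP q‖ ≤ 2 * ρ := fun q =>
    (pi_norm_le_iff_of_nonneg (by positivity)).2 fun j => abs_clip_le hρ _
  have hcl_lip : ∀ q q', ‖cl q - cl q'‖ ≤ C * ‖q - q'‖ := fun q q' =>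
    (pi_norm_le_iff_of_nonneg (by positivity)).2 fun j => (hC ρ hρ _ _).trans (by
      gcongr; exact norm_le_pi_norm (q - q') j)
  -- Newton's map `q - Φ(p, q)` with both variables clipped: it is globally defined and bounded, and
  -- where clipping is the identity its fixed points are the zeros of `Φ`.
  set r : ι → (P ⊕ J → ℝ) → J → ℝ := fun i z =>
    cl (fun j => z (Sum.inr j)) - Φ i (fun k => 0 + clip ρ (z k)) with hr
  have hr_elim : ∀ i p q, r i (Sum.elim p q) = cl q - Φ i (Sum.elim (clP p) (cl q)) := by
    intro i p q
    simp only [hr, Sum.elim_inr]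
    congr 2
    ext (l | l) <;> simp [hclP, hcl]
  have hrH : AnisoHolder (Sum.elim a fun _ : J => a₀) 1 r := by
    refine sub ha' one_pos (pi ha' one_pos fun j => ?_) ?_
    · exact coord ha' one_pos (contDiff_clip ρ) (hasCompactSupport_clip hρ) (Sum.inr j)
    · exact comp ha' ha' one_pos hΦ (AnisoMap.translate_clip ha' one_pos hρ fun _ => 0)
  have hlip : ∀ i p q q', ‖r i (Sum.elim p q) - r i (Sum.elim p q')‖ ≤ 1 / 2 * ‖q - q'‖ := by
    intro i p q q'
    have h1 : ‖(cl q - Φ i (Sum.elim (clP p) (cl q))) - (cl q' - Φ i (Sum.elim (clP p) (cl q')))‖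
        ≤ 1 / (2 * C) * ‖cl q - cl q'‖ := by
      refine (convex_closedBall (0 : J → ℝ) (2 * ρ)).norm_image_sub_le_of_norm_hasFDerivWithin_le
        (f := fun q => q - Φ i (Sum.elim (clP p) q))
        (f' := fun q => 1 - partialFDeriv Φ i (Sum.elim (clP p) q))
        (fun q _ => ((hasFDerivAt_id q).sub
          (hΦ.hasFDerivAt_last ha h0 h01 i (clP p) q)).hasFDerivWithinAt) (fun q hq => ?_)
        (by simpa using hcl_le q') (by simpa using hcl_le q)
      rw [norm_sub_rev, ← hΦ1 i]
      refine hδ' i 0 _ ?_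
      rw [sub_zero]
      exact (norm_sum_elim (by positivity) (hclP_le p) (by simpa using hq)).trans hρδ
    rw [hr_elim, hr_elim]
    refine h1.trans ?_
    calc _ ≤ 1 / (2 * C) * (C * ‖q - q'‖) := by gcongr; exact hcl_lip q q'
      _ = _ := by field_simp
  have hcontr : ∀ i p, ContractingWith (1 / 2) fun q => r i (Sum.elim p q) := fun i p =>
    ⟨by rw [← NNReal.coe_lt_coe]; norm_num, LipschitzWith.of_dist_le_mul fun q q' => by
      simpa [dist_eq_norm] using hlip i p q q'⟩
  set b : ι → (P → ℝ) → J → ℝ := fun i p => (hcontr i p).fixedPoint _ with hb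
  have hbfix : ∀ i p, r i (Sum.elim p (b i p)) = b i p := fun i p =>
    (hcontr i p).fixedPoint_isFixedPt
  have hbH := hrH.fixedPoint ha h0 h01 ha₁ hlip (fun i p => (hbfix i p).symm)
  have hbuniq : ∀ i p q, r i (Sum.elim p q) = q ↔ q = b i p := fun i p q =>
    ⟨fun h => (hcontr i p).fixedPoint_unique h, fun h => by rw [h]; exact hbfix i p⟩
  have hclP_id : ∀ p, ‖p‖ ≤ ρ → clP p = p := fun p hp =>
    funext fun k => clip_of_abs_le hρ ((norm_le_pi_norm p k).trans hp)
  have hcl_id : ∀ q, ‖q‖ ≤ ρ → cl q = q := fun p hp =>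
    funext fun k => clip_of_abs_le hρ ((norm_le_pi_norm p k).trans hp)
  have hz : (Sum.elim 0 0 : P ⊕ J → ℝ) = 0 := by ext (l | l) <;> simp
  have hb0 : ∀ i, b i 0 = 0 := fun i => by
    refine ((hbuniq i 0 0).1 ?_).symm
    rw [hr_elim, hclP_id 0 (by simpa using hρ.le), hcl_id 0 (by simpa using hρ.le), hz, hΦ0,
      sub_zero]
  obtain ⟨σ, hσ, hσ'⟩ := hbH.equicontinuous ha one_pos (ε := ρ / 2) (by positivity)
  refine ⟨ρ, min σ ρ, hρ, min_le_right _ _, lt_min hσ hρ, b, hbH, hb0, fun i p hp => ⟨?_, ?_⟩⟩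
  · have := hσ' i 0 p (by rw [sub_zero]; exact hp.trans (min_le_left _ _))
    rw [hb0, sub_zero] at this
    linarith
  · intro q hq
    rw [← hbuniq, hr_elim, hclP_id p (hp.trans (min_le_right _ _)), hcl_id q hq, sub_eq_self]

end ImplicitFunction

/-! ### Symmetry of mixed partial derivatives. -/

section MixedPartials

/-- Two applications of the mean value inequality, first along `v` and then along `w`. -/
theorem norm_doubleDifference_sub_le {V F : Type*} [NormedAddCommGroup V] [NormedSpace ℝ V]
    [NormedAddCommGroup F] [NormedSpace ℝ F] {f f' g : V → F} {v w z : V}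
    (hf : ∀ z, HasLineDerivAt ℝ f (f' z) z v) (hf' : ∀ z, HasLineDerivAt ℝ f' (g z) z w)
    (hg : ContinuousAt g z) {ε : ℝ} (hε : 0 < ε) : ∃ δ > 0, ∀ σ τ : ℝ, |σ| ≤ δ → |τ| ≤ δ →
      ‖f (z + σ • v + τ • w) - f (z + σ • v) - (f (z + τ • w) - f z) - σ • τ • g z‖
        ≤ ε * |τ| * |σ| := by
  have hc : ContinuousAt (fun p : ℝ × ℝ => g (z + p.1 • v + p.2 • w)) (0, 0) := by
    refine ContinuousAt.comp (f := fun p : ℝ × ℝ => z + p.1 • v + p.2 • w) (by simpa using hg) ?_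
    fun_prop
  obtain ⟨δ, hδ, hδ'⟩ := Metric.continuousAt_iff.1 hc ε hε
  refine ⟨δ / 2, by positivity, fun σ τ hσ hτ => ?_⟩
  have h1 : ∀ y, HasLineDerivAt ℝ (fun y => f (y + τ • w) - f y) (f' (y + τ • w) - f' y) y v := by
    intro y
    have h2 : HasDerivAt (fun t : ℝ => f (y + t • v + τ • w)) (f' (y + τ • w)) 0 := by
      have := hf (y + τ • w)
      unfold HasLineDerivAt at this
      simpa only [add_right_comm] using this
    exact h2.sub (hf y)
  refine norm_line_sub_sub_le h1 z σ (τ • g z) (C := ε * |τ|) fun θ hθ => ?_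
  refine norm_line_sub_sub_le hf' (z + θ • v) τ (g z) (C := ε) fun θ' hθ' => ?_
  rw [← dist_eq_norm]
  have h3 := @hδ' (θ, θ') (by
    rw [Prod.dist_eq, Real.dist_eq, Real.dist_eq, sub_zero, sub_zero]
    exact max_lt (by linarith) (by linarith))
  simpa using h3.le

variable {K : Type*} [Fintype K] [DecidableEq K] {F : Type*} [NormedAddCommGroup F]
  [NormedSpace ℝ F] {ι : Type*} {a : K → ℝ} {s : ℝ} {f : ι → (K → ℝ) → F}

/-- Both mixed partials approximate the same symmetric double difference divided by `t²`, and both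
are continuous. -/
theorem AnisoHolder.pderivFam_comm (ha : ∀ k, 0 < a k) (hf : AnisoHolder a s f) {k l : K}
    (hkl : a k + a l < s) : pderivFam k (pderivFam l f) = pderivFam l (pderivFam k f) := by
  have hk : a k < s := by linarith [ha l]
  have hl : a l < s := by linarith [ha k]
  have hkl' : a k < s - a l := by linarith
  have hlk' : a l < s - a k := by linarith
  funext i z
  have hckl := ((hf.pderiv hl).pderiv hkl').continuous ha (by linarith) i
  have hclk := ((hf.pderiv hk).pderiv hlk').continuous ha (by linarith) i
  refine eq_of_forall_dist_le fun ε hε => ?_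
  obtain ⟨δ, hδ, h1⟩ := norm_doubleDifference_sub_le (hf.hasLineDerivAt hl i)
    ((hf.pderiv hl).hasLineDerivAt hkl' i) (hckl.continuousAt (x := z)) (half_pos hε)
  obtain ⟨δ', hδ', h2⟩ := norm_doubleDifference_sub_le (hf.hasLineDerivAt hk i)
    ((hf.pderiv hk).hasLineDerivAt hlk' i) (hclk.continuousAt (x := z)) (half_pos hε)
  set t := min δ δ' with ht
  have ht0 : 0 < t := lt_min hδ hδ'
  have h3 := h1 t t (by rw [abs_of_pos ht0]; exact min_le_left _ _)
    (by rw [abs_of_pos ht0]; exact min_le_left _ _)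
  have h4 := h2 t t (by rw [abs_of_pos ht0]; exact min_le_right _ _)
    (by rw [abs_of_pos ht0]; exact min_le_right _ _)
  rw [abs_of_pos ht0] at h3 h4
  set A := pderivFam k (pderivFam l f) i z
  set B := pderivFam l (pderivFam k f) i z
  have h5 : ‖t • t • A - t • t • B‖ ≤ ε / 2 * t * t + ε / 2 * t * t := by
    refine le_trans (le_of_eq ?_) ((norm_sub_le _ _).trans (add_le_add h4 h3))
    congr 1
    rw [add_right_comm z (t • coordVec k) (t • coordVec l)]
    abel
  rw [← smul_sub, ← smul_sub, norm_smul, norm_smul, Real.norm_eq_abs, abs_of_pos ht0] at h5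
  rw [dist_eq_norm]
  have h6 : t * t * ‖A - B‖ ≤ t * t * ε := by linarith
  exact le_of_mul_le_mul_left h6 (by positivity)

/-- Iterated partial derivatives along a list of coordinates. -/
noncomputable def pderivList (l : List K) (f : ι → (K → ℝ) → F) : ι → (K → ℝ) → F :=
  l.foldr pderivFam f

theorem AnisoHolder.pderivList (ha : ∀ k, 0 < a k) (hf : AnisoHolder a s f) (l : List K)
    (hl : (l.map a).sum < s) : AnisoHolder a (s - (l.map a).sum) (pderivList l f) := by
  induction l with
  | nil => simpa [_root_.pderivList] using hf
  | cons k l ih =>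
    rw [List.map_cons, List.sum_cons] at hl ⊢
    have h1 := (ih (by linarith [ha k])).pderiv (k := k) (by linarith)
    rwa [sub_sub, add_comm] at h1

theorem AnisoHolder.pderivList_perm (ha : ∀ k, 0 < a k) (hf : AnisoHolder a s f) {l l' : List K}
    (h : l.Perm l') (hl : (l.map a).sum < s) :
    _root_.pderivList l f = _root_.pderivList l' f := by
  induction h with
  | nil => rfl
  | cons k _ ih =>
    rw [List.map_cons, List.sum_cons] at hl
    exact congrArg (pderivFam k) (ih (by linarith [ha k]))
  | swap k k' l =>
    simp only [List.map_cons, List.sum_cons] at hl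
    exact (hf.pderivList ha l (by linarith [ha k, ha k'])).pderivFam_comm ha (by linarith)
  | trans h₁ _ ih₁ ih₂ =>
    exact (ih₁ hl).trans (ih₂ (by rwa [← (h₁.map a).sum_eq]))

/-- A consistent system of mixed partial derivatives of an anisotropically Hölder family. -/
theorem AnisoHolder.exists_mixedPartials (ha : ∀ k, 0 < a k) (hf : AnisoHolder a s f) :
    ∃ D : (K → ℕ) → ι → (K → ℝ) → F, D 0 = f ∧
      (∀ j, ∑ k, j k * a k < s → AnisoHolder a (s - ∑ k, j k * a k) (D j)) ∧
      ∀ j k, ∑ l, (j l : ℝ) * a l + a k < s → ∀ i z,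
        HasLineDerivAt ℝ (D j i) (D (j + Pi.single k 1) i z) z (coordVec k) := by
  -- The coordinates are differentiated in an arbitrary order; `pderivList_perm` makes the choice
  -- harmless.
  set L : (K → ℕ) → List K := fun j => (∑ k, j k • ({k} : Multiset K)).toList with hL
  have hLw : ∀ j, ((L j).map a).sum = ∑ k, j k * a k := fun j => by
    rw [← Multiset.sum_coe, ← Multiset.map_coe, hL, Multiset.coe_toList]
    rw [← Multiset.coe_mapAddMonoidHom, map_sum, ← Multiset.coe_sumAddMonoidHom, map_sum]
    simp [Multiset.map_nsmul, Multiset.sum_nsmul]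
  refine ⟨fun j => _root_.pderivList (L j) f, ?_, fun j hj => ?_, fun j k hjk i z => ?_⟩
  · simp [hL, _root_.pderivList]
  · have := hf.pderivList ha (L j) (by rwa [hLw])
    rwa [hLw] at this
  · have hperm : (k :: L j).Perm (L (j + Pi.single k 1)) := by
      rw [← Multiset.coe_eq_coe, ← Multiset.cons_coe, hL, Multiset.coe_toList, Multiset.coe_toList]
      simp only [Pi.add_apply, add_smul, Finset.sum_add_distrib]
      rw [Finset.sum_eq_single (f := fun x => (Pi.single k 1 : K → ℕ) x • ({x} : Multiset K)) k
        (fun l _ hl => by simp [hl]) (by simp)]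
      simp [add_comm _ ({k} : Multiset K)]
    show HasLineDerivAt ℝ _ (_root_.pderivList (L (j + Pi.single k 1)) f i z) _ _
    rw [← hf.pderivList_perm ha hperm (by rw [List.map_cons, List.sum_cons, hLw]; linarith)]
    exact (hf.pderivList ha (L j) (by rw [hLw]; linarith [ha k])).hasLineDerivAt
      (by rw [hLw]; linarith) i z

end MixedPartials

/-! ### Translation to and from the stated Hölder classes. -/

section Bridge

variable {d₁ d₂ : ℕ} {α β : ℝ} {ι : Type*}

/-- The weights `1/α`, `1/β` of the two groups of variables. -/
noncomputable def holderWeight (α β : ℝ) (d₁ d₂ : ℕ) : Fin d₁ ⊕ Fin d₂ → ℝ :=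
  Sum.elim (fun _ => 1 / α) fun _ => 1 / β

/-- A function of two Euclidean variables as a function of all coordinates. -/
def eucPair {F : Type*} (f : Euc d₁ → Euc d₂ → F) (z : Fin d₁ ⊕ Fin d₂ → ℝ) : F :=
  f (WithLp.toLp 2 fun i => z (Sum.inl i)) (WithLp.toLp 2 fun i => z (Sum.inr i))

theorem holderWeight_pos (hα : 0 < α) (hβ : 0 < β) (k : Fin d₁ ⊕ Fin d₂) :
    0 < holderWeight α β d₁ d₂ k := by
  rcases k with k | k <;> simp [holderWeight, hα, hβ]

theorem toLp_inl_add (z : Fin d₁ ⊕ Fin d₂ → ℝ) (t : ℝ) (k : Fin d₁) :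
    (WithLp.toLp 2 fun i => (z + t • coordVec (Sum.inl k) : Fin d₁ ⊕ Fin d₂ → ℝ) (Sum.inl i) : Euc d₁)
      = (WithLp.toLp 2 fun i => z (Sum.inl i)) + t • EuclideanSpace.single k 1 := by
  ext i; simp [Pi.single_apply]

theorem toLp_inr_add (z : Fin d₁ ⊕ Fin d₂ → ℝ) (t : ℝ) (k : Fin d₂) :
    (WithLp.toLp 2 fun i => (z + t • coordVec (Sum.inr k) : Fin d₁ ⊕ Fin d₂ → ℝ) (Sum.inr i) : Euc d₂)
      = (WithLp.toLp 2 fun i => z (Sum.inr i)) + t • EuclideanSpace.single k 1 := by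
  ext i; simp [Pi.single_apply]

theorem le_max_of_ofReal_le {x L : ℝ} (h : ENNReal.ofReal x ≤ ENNReal.ofReal L) : x ≤ max L 0 := by
  rcases ENNReal.ofReal_le_ofReal_iff'.1 h with h | h
  · exact h.trans (le_max_left _ _)
  · exact h.trans (le_max_right _ _)

theorem miSize_add_single {d : ℕ} (j : Fin d → ℕ) (k : Fin d) :
    miSize (j + Pi.single k 1) = miSize j + 1 := by
  simp [miSize, Finset.sum_add_distrib]

/-- The order left after differentiation, divided by the weight, is the exponent of the Hölder
quotient. -/
theorem holder_exponent_fst (hα : 0 < α) (hβ : 0 < β) (x y : ℝ) :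
    (1 - (x / α + y / β)) / (1 / α) = α - x - α / β * y := by
  field_simp; ring

theorem holder_exponent_snd (hα : 0 < α) (hβ : 0 < β) (x y : ℝ) :
    (1 - (x / α + y / β)) / (1 / β) = β - y - β / α * x := by
  field_simp; ring

/-- By induction on the remaining order `1 - |j₁|/α - |j₂|/β`, each `D j` satisfies the recursive
definition: every term of the sum in the Hölder norm is bounded by `L`. -/
theorem anisoHolder_of_holderClass (hα : 0 < α) (hβ : 0 < β) {L : ℝ}
    {f : ι → Euc d₁ → Euc d₂ → ℝ} (hf : ∀ i, HolderClass α β L (f i)) :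
    AnisoHolder (holderWeight α β d₁ d₂) 1 (fun i => eucPair (f i)) := by
  have ha := holderWeight_pos (d₁ := d₁) (d₂ := d₂) hα hβ
  choose D hD hL using hf
  have key := weight_induction ha (P := fun s => ∀ j : (Fin d₁ → ℕ) × (Fin d₂ → ℕ),
    1 - (miSize j.1 / α + miSize j.2 / β) = s →
      AnisoHolder (holderWeight α β d₁ d₂) s (fun i => eucPair (D i j))) (fun s hs ih j hj => ?_)
    1 one_pos (0, 0) (by simp [miSize])
  · simpa only [(hD _).zero] using key
  have hjJ : j ∈ holderIndex α β d₁ d₂ := by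
    show _ < (1 : ℝ); linarith
  refine AnisoHolder.intro ha hs ⟨max L 0, fun i z => ?_⟩ (fun k hk => ?_) (fun k hk => ?_)
  · refine le_max_of_ofReal_le (le_trans ?_ (hL i))
    refine le_trans ?_ (le_add_right (le_add_right (ENNReal.le_tsum ⟨j, hjJ⟩)))
    exact le_iSup₂_of_le (WithLp.toLp 2 fun i => z (Sum.inl i))
      (WithLp.toLp 2 fun i => z (Sum.inr i)) le_rfl
  · rcases k with k | k
    · simp only [holderWeight, Sum.elim_inl] at hk ⊢
      have e : (miSize j.1 + 1) / α = miSize j.1 / α + 1 / α := add_div _ _ _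
      have hJ : (j.1 + Pi.single k 1, j.2) ∈ holderIndex α β d₁ d₂ := by
        show _ < (1 : ℝ)
        rw [miSize_add_single]; linarith
      refine ⟨fun i => eucPair (D i (j.1 + Pi.single k 1, j.2)), fun i z => ?_, ?_⟩
      · have := (hD i).fst j.1 j.2 k hJ (WithLp.toLp 2 fun i => z (Sum.inl i))
          (WithLp.toLp 2 fun i => z (Sum.inr i))
        unfold HasLineDerivAt at this ⊢
        simp only [← toLp_inl_add z] at this
        simpa [eucPair] using this
      · refine ih _ (sub_pos.2 hk) ⟨Sum.inl k, by simp [holderWeight]⟩ _ ?_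
        rw [miSize_add_single]; linarith
    · simp only [holderWeight, Sum.elim_inr] at hk ⊢
      have e : (miSize j.2 + 1) / β = miSize j.2 / β + 1 / β := add_div _ _ _
      have hJ : (j.1, j.2 + Pi.single k 1) ∈ holderIndex α β d₁ d₂ := by
        show _ < (1 : ℝ)
        rw [miSize_add_single]; linarith
      refine ⟨fun i => eucPair (D i (j.1, j.2 + Pi.single k 1)), fun i z => ?_, ?_⟩
      · have := (hD i).snd j.1 j.2 k hJ (WithLp.toLp 2 fun i => z (Sum.inl i))
          (WithLp.toLp 2 fun i => z (Sum.inr i))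
        unfold HasLineDerivAt at this ⊢
        simp only [← toLp_inr_add z] at this
        simpa [eucPair] using this
      · refine ih _ (sub_pos.2 hk) ⟨Sum.inr k, by simp [holderWeight]⟩ _ ?_
        rw [miSize_add_single]; linarith
  · refine ⟨max L 0, fun i z t _ => ?_⟩
    rcases eq_or_ne t 0 with rfl | ht
    · simp only [zero_smul, add_zero, sub_self, norm_zero]
      positivity
    have htp : 0 < |t| := abs_pos.2 ht
    rcases k with k | k
    · simp only [holderWeight, Sum.elim_inl] at hk ⊢
      have e : (miSize j.1 + 1) / α = miSize j.1 / α + 1 / α := add_div _ _ _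
      have hJ : j ∈ {j | j ∈ holderIndex α β d₁ d₂ ∧
          1 ≤ (miSize j.1 + 1) / α + miSize j.2 / β} := ⟨hjJ, by linarith⟩
      rw [← hj, holder_exponent_fst hα hβ]
      rw [← div_le_iff₀ (Real.rpow_pos_of_pos htp _)]
      refine le_max_of_ofReal_le (le_trans ?_ (hL i))
      refine le_trans ?_ (le_add_right (le_add_left (ENNReal.le_tsum ⟨j, hJ⟩)))
      set x : Euc d₁ := WithLp.toLp 2 fun i => z (Sum.inl i) with hx
      refine le_iSup₂_of_le (x + t • EuclideanSpace.single k 1) x ?_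
      refine le_iSup₂_of_le (WithLp.toLp 2 fun i => z (Sum.inr i)) (by simp [ht]) ?_
      rw [add_sub_cancel_left, norm_smul, PiLp.norm_single, norm_one, mul_one,
        Real.norm_eq_abs, Real.norm_eq_abs, hx, ← toLp_inl_add]
      simp [eucPair]
    · simp only [holderWeight, Sum.elim_inr] at hk ⊢
      have e : (miSize j.2 + 1) / β = miSize j.2 / β + 1 / β := add_div _ _ _
      have hJ : j ∈ {j | j ∈ holderIndex α β d₁ d₂ ∧
          1 ≤ miSize j.1 / α + (miSize j.2 + 1) / β} := ⟨hjJ, by linarith⟩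
      rw [← hj, holder_exponent_snd hα hβ]
      rw [← div_le_iff₀ (Real.rpow_pos_of_pos htp _)]
      refine le_max_of_ofReal_le (le_trans ?_ (hL i))
      refine le_trans ?_ (le_add_left (ENNReal.le_tsum ⟨j, hJ⟩))
      set y : Euc d₂ := WithLp.toLp 2 fun i => z (Sum.inr i) with hy
      refine le_iSup₂_of_le (WithLp.toLp 2 fun i => z (Sum.inl i))
        (y + t • EuclideanSpace.single k 1) ?_
      refine le_iSup₂_of_le y (by simp [ht]) ?_
      rw [add_sub_cancel_left, norm_smul, PiLp.norm_single, norm_one, mul_one,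
        Real.norm_eq_abs, Real.norm_eq_abs, hy, ← toLp_inr_add]
      simp [eucPair]

theorem holderIndex_finite (hα : 0 < α) (hβ : 0 < β) : (holderIndex α β d₁ d₂).Finite := by
  obtain ⟨N, hN⟩ := exists_nat_ge (max α β)
  refine ((finite_Iic (fun _ : Fin d₁ => N)).prod (finite_Iic (fun _ : Fin d₂ => N))).subset ?_
  have hle : ∀ {d : ℕ} (j : Fin d → ℕ) k, (j k : ℝ) ≤ miSize j := fun j k => by
    unfold miSize
    exact_mod_cast Finset.single_le_sum (f := j) (fun _ _ => Nat.zero_le _) (Finset.mem_univ k)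
  have h0 : ∀ {d : ℕ} (j : Fin d → ℕ), 0 ≤ miSize j := fun j => by unfold miSize; positivity
  intro j (hj : _ < (1 : ℝ))
  have h1 : 0 ≤ miSize j.1 / α := div_nonneg (h0 _) hα.le
  have h2 : 0 ≤ miSize j.2 / β := div_nonneg (h0 _) hβ.le
  refine ⟨fun k => ?_, fun k => ?_⟩
  · have h3 := (div_lt_one hα).1 (show miSize j.1 / α < 1 by linarith)
    have : (j.1 k : ℝ) ≤ N := by linarith [hle j.1 k, le_max_left α β]
    exact_mod_cast this
  · have h3 := (div_lt_one hβ).1 (show miSize j.2 / β < 1 by linarith)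
    have : (j.2 k : ℝ) ≤ N := by linarith [hle j.2 k, le_max_right α β]
    exact_mod_cast this

theorem exists_tsum_le_ofReal {J : Type*} [Finite J] {t : ι → J → ℝ≥0∞}
    (h : ∀ j, ∃ C : ℝ, ∀ i, t i j ≤ ENNReal.ofReal C) :
    ∃ M : ℝ, 0 ≤ M ∧ ∀ i, ∑' j, t i j ≤ ENNReal.ofReal M := by
  have := Fintype.ofFinite J
  choose C hC using h
  refine ⟨∑ j, max (C j) 0, Finset.sum_nonneg fun j _ => le_max_right _ _, fun i => ?_⟩
  rw [tsum_fintype, ENNReal.ofReal_sum_of_nonneg fun j _ => le_max_right _ _]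
  exact Finset.sum_le_sum fun j _ => (hC j i).trans (ENNReal.ofReal_le_ofReal (le_max_left _ _))

/-- Only finitely many multi-indices occur and each supremum is bounded uniformly over the family,
so one `L` serves all members. Increments in one group of variables are split into coordinate steps.
-/
theorem exists_holderClass_of_anisoHolder (hα : 0 < α) (hβ : 0 < β)
    {f : ι → (Fin d₁ ⊕ Fin d₂ → ℝ) → ℝ} (hf : AnisoHolder (holderWeight α β d₁ d₂) 1 f) :
    ∃ L > 0, ∀ i, HolderClass α β L (fun (x : Euc d₁) (y : Euc d₂) => f i (Sum.elim x y)) := by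
  have ha := holderWeight_pos (d₁ := d₁) (d₂ := d₂) hα hβ
  obtain ⟨D, hD0, hD, hD'⟩ := hf.exists_mixedPartials ha
  have hw : ∀ j : (Fin d₁ → ℕ) × (Fin d₂ → ℕ),
      ∑ k, ((Sum.elim j.1 j.2 : Fin d₁ ⊕ Fin d₂ → ℕ) k : ℝ) * holderWeight α β d₁ d₂ k
        = miSize j.1 / α + miSize j.2 / β := fun j => by
    simp [holderWeight, miSize, Finset.sum_mul, div_eq_mul_inv]
  set E : ι → (Fin d₁ → ℕ) × (Fin d₂ → ℕ) → Euc d₁ → Euc d₂ → ℝ :=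
    fun i j x y => D (Sum.elim j.1 j.2) i (Sum.elim x y) with hE
  have hmp : ∀ i, IsMixedPartials (holderIndex α β d₁ d₂)
      (fun (x : Euc d₁) (y : Euc d₂) => f i (Sum.elim x y)) (E i) := by
    intro i
    refine ⟨?_, fun j₁ j₂ k hk x y => ?_, fun j₁ j₂ k hk x y => ?_⟩
    · have : (Sum.elim 0 0 : Fin d₁ ⊕ Fin d₂ → ℕ) = 0 := by ext (l | l) <;> rfl
      simp only [hE]
      rw [this, hD0]
    · have hk' : _ < (1 : ℝ) := hk
      rw [miSize_add_single, add_div] at hk'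
      have h1 := hD' (Sum.elim j₁ j₂) (Sum.inl k)
        (by rw [hw (j₁, j₂)]; simp only [holderWeight, Sum.elim_inl]; linarith) i (Sum.elim x y)
      have e : (Sum.elim j₁ j₂ + Pi.single (Sum.inl k) 1 : Fin d₁ ⊕ Fin d₂ → ℕ)
          = Sum.elim (j₁ + Pi.single k 1) j₂ := by ext (l | l) <;> simp [Pi.single_apply]
      rw [e] at h1
      unfold HasLineDerivAt at h1 ⊢
      simp only [← Sum.elim_add_smul_coordVec_inl] at h1
      exact h1
    · have hk' : _ < (1 : ℝ) := hk
      rw [miSize_add_single, add_div] at hk'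
      have h1 := hD' (Sum.elim j₁ j₂) (Sum.inr k)
        (by rw [hw (j₁, j₂)]; simp only [holderWeight, Sum.elim_inr]; linarith) i (Sum.elim x y)
      have e : (Sum.elim j₁ j₂ + Pi.single (Sum.inr k) 1 : Fin d₁ ⊕ Fin d₂ → ℕ)
          = Sum.elim j₁ (j₂ + Pi.single k 1) := by ext (l | l) <;> simp [Pi.single_apply]
      rw [e] at h1
      unfold HasLineDerivAt at h1 ⊢
      simp only [← Sum.elim_add_smul_coordVec_inr] at h1
      exact h1
  have hDj : ∀ j ∈ holderIndex α β d₁ d₂, AnisoHolder (holderWeight α β d₁ d₂)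
      (1 - (miSize j.1 / α + miSize j.2 / β)) (D (Sum.elim j.1 j.2)) := fun j hj => by
    have := hD (Sum.elim j.1 j.2) (by rw [hw]; exact hj)
    rwa [hw] at this
  have hpos : ∀ j ∈ holderIndex α β d₁ d₂, 0 < 1 - (miSize j.1 / α + miSize j.2 / β) :=
    fun j hj => sub_pos.2 hj
  have hfin := holderIndex_finite (d₁ := d₁) (d₂ := d₂) hα hβ
  have : Finite (holderIndex α β d₁ d₂) := hfin
  have : Finite {j | j ∈ holderIndex α β d₁ d₂ ∧ 1 ≤ (miSize j.1 + 1) / α + miSize j.2 / β} :=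
    hfin.subset fun j hj => hj.1
  have : Finite {j | j ∈ holderIndex α β d₁ d₂ ∧ 1 ≤ miSize j.1 / α + (miSize j.2 + 1) / β} :=
    hfin.subset fun j hj => hj.1
  obtain ⟨M₀, hM₀, h₀⟩ := exists_tsum_le_ofReal (ι := ι) (J := holderIndex α β d₁ d₂)
    (t := fun i j => ⨆ (x : Euc d₁) (y : Euc d₂), ENNReal.ofReal |E i j x y|) (fun j => by
      obtain ⟨C, -, hC⟩ := (hDj j j.2).bound
      exact ⟨C, fun i => iSup₂_le fun x y => ENNReal.ofReal_le_ofReal (hC i _)⟩)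
  obtain ⟨M₁, hM₁, h₁⟩ := exists_tsum_le_ofReal (ι := ι)
    (J := {j | j ∈ holderIndex α β d₁ d₂ ∧ 1 ≤ (miSize j.1 + 1) / α + miSize j.2 / β})
    (t := fun i j => ⨆ (x : Euc d₁) (x₀ : Euc d₁) (y : Euc d₂) (_ : x ≠ x₀),
        ENNReal.ofReal (|E i j x y - E i j x₀ y| /
          ‖x - x₀‖ ^ (α - miSize j.1.1 - α / β * miSize j.1.2))) (fun j => by
      obtain ⟨j, hj, hj'⟩ := j
      rw [add_div] at hj'
      have hθ : 0 < α - miSize j.1 - α / β * miSize j.2 := by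
        rw [← holder_exponent_fst hα hβ]; exact div_pos (hpos j hj) (by positivity)
      have hC : ∀ k, ∃ C, 0 ≤ C ∧ ∀ i z t, ‖D (Sum.elim j.1 j.2) i (z + t • coordVec (Sum.inl k))
          - D (Sum.elim j.1 j.2) i z‖ ≤ C * |t| ^ (α - miSize j.1 - α / β * miSize j.2) :=
        fun k => (hDj j hj).holder ha (Sum.inl k) hθ (by
          rw [← holder_exponent_fst hα hβ, div_le_one (by positivity)]; linarith) (by
          rw [← holder_exponent_fst hα hβ]
          simp only [holderWeight, Sum.elim_inl]
          rw [div_mul_cancel₀ _ (by positivity)])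
      choose C hC0 hC using hC
      refine ⟨∑ k, C k, fun i => iSup₂_le fun x x₀ => iSup₂_le fun y hx => ?_⟩
      refine ENNReal.ofReal_le_ofReal ?_
      have hx' : 0 < ‖x - x₀‖ := norm_pos_iff.2 (sub_ne_zero.2 hx)
      rw [div_le_iff₀ (Real.rpow_pos_of_pos hx' _)]
      refine (norm_sub_le_sum_of_coord Finset.univ
        (f := fun x : Fin d₁ → ℝ => D (Sum.elim j.1 j.2) i (Sum.elim x y))
        (ω := fun k t => C k * |t| ^ (α - miSize j.1 - α / β * miSize j.2)) (fun k _ z t => ?_)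
        x₀ x (by simp)).trans ?_
      · rw [Sum.elim_add_smul_coordVec_inl]; exact hC k i _ t
      · rw [Finset.sum_mul]
        refine Finset.sum_le_sum fun k _ => mul_le_mul_of_nonneg_left ?_ (hC0 k)
        exact Real.rpow_le_rpow (abs_nonneg _) (PiLp.norm_apply_le (x - x₀) k) hθ.le)
  obtain ⟨M₂, hM₂, h₂⟩ := exists_tsum_le_ofReal (ι := ι)
    (J := {j | j ∈ holderIndex α β d₁ d₂ ∧ 1 ≤ miSize j.1 / α + (miSize j.2 + 1) / β})
    (t := fun i j => ⨆ (x : Euc d₁) (y : Euc d₂) (y₀ : Euc d₂) (_ : y ≠ y₀),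
        ENNReal.ofReal (|E i j x y - E i j x y₀| /
          ‖y - y₀‖ ^ (β - miSize j.1.2 - β / α * miSize j.1.1))) (fun j => by
      obtain ⟨j, hj, hj'⟩ := j
      rw [add_div] at hj'
      have hθ : 0 < β - miSize j.2 - β / α * miSize j.1 := by
        rw [← holder_exponent_snd hα hβ]; exact div_pos (hpos j hj) (by positivity)
      have hC : ∀ k, ∃ C, 0 ≤ C ∧ ∀ i z t, ‖D (Sum.elim j.1 j.2) i (z + t • coordVec (Sum.inr k))
          - D (Sum.elim j.1 j.2) i z‖ ≤ C * |t| ^ (β - miSize j.2 - β / α * miSize j.1) :=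
        fun k => (hDj j hj).holder ha (Sum.inr k) hθ (by
          rw [← holder_exponent_snd hα hβ, div_le_one (by positivity)]; linarith) (by
          rw [← holder_exponent_snd hα hβ]
          simp only [holderWeight, Sum.elim_inr]
          rw [div_mul_cancel₀ _ (by positivity)])
      choose C hC0 hC using hC
      refine ⟨∑ k, C k, fun i => iSup₂_le fun x y => iSup₂_le fun y₀ hy => ?_⟩
      refine ENNReal.ofReal_le_ofReal ?_
      have hy' : 0 < ‖y - y₀‖ := norm_pos_iff.2 (sub_ne_zero.2 hy)
      rw [div_le_iff₀ (Real.rpow_pos_of_pos hy' _)]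
      refine (norm_sub_le_sum_of_coord Finset.univ
        (f := fun y : Fin d₂ → ℝ => D (Sum.elim j.1 j.2) i (Sum.elim x y))
        (ω := fun k t => C k * |t| ^ (β - miSize j.2 - β / α * miSize j.1)) (fun k _ z t => ?_)
        y₀ y (by simp)).trans ?_
      · rw [Sum.elim_add_smul_coordVec_inr]; exact hC k i _ t
      · rw [Finset.sum_mul]
        refine Finset.sum_le_sum fun k _ => mul_le_mul_of_nonneg_left ?_ (hC0 k)
        exact Real.rpow_le_rpow (abs_nonneg _) (PiLp.norm_apply_le (y - y₀) k) hθ.le)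
  refine ⟨M₀ + M₁ + M₂ + 1, by positivity, fun i => ⟨E i, hmp i, ?_⟩⟩
  calc holderSum α β (E i)
      ≤ ENNReal.ofReal M₀ + ENNReal.ofReal M₁ + ENNReal.ofReal M₂ :=
        add_le_add (add_le_add (h₀ i) (h₁ i)) (h₂ i)
    _ = ENNReal.ofReal (M₀ + M₁ + M₂) := by
        rw [ENNReal.ofReal_add (by positivity) hM₂, ENNReal.ofReal_add hM₀ hM₁]
    _ ≤ _ := ENNReal.ofReal_le_ofReal (by linarith)

end Bridge

/-! ### Families defined on subsets. -/

section Extensions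

variable {d₁ d₂ m : ℕ} {α β : ℝ} {Ω : Type*}

theorem HolderClass.mono {L L' : ℝ} (hL : L ≤ L') {f : Euc d₁ → Euc d₂ → ℝ}
    (h : HolderClass α β L f) : HolderClass α β L' f := by
  obtain ⟨D, hD, hs⟩ := h
  exact ⟨D, hD, hs.trans (ENNReal.ofReal_le_ofReal hL)⟩

theorem HolderClassOn.mono {L L' : ℝ} (hL : L ≤ L') {U₁ U₁' : Set (Euc d₁)} {U₂ U₂' : Set (Euc d₂)}
    (h₁ : U₁' ⊆ U₁) (h₂ : U₂' ⊆ U₂) {f : Euc d₁ → Euc d₂ → Euc m}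
    (h : HolderClassOn α β L U₁ U₂ f) : HolderClassOn α β L' U₁' U₂' f := fun i => by
  obtain ⟨g, hg, hgf⟩ := h i
  exact ⟨g, hg.mono hL, fun x hx y hy => hgf x (h₁ hx) y (h₂ hy)⟩

theorem exists_extension_of_holderClassOn (hα : 0 < α) (hβ : 0 < β) {L : ℝ}
    {U₁ : Ω → Set (Euc d₁)} {U₂ : Ω → Set (Euc d₂)} {f : Ω → Euc d₁ → Euc d₂ → Euc m}
    (h : ∀ ω, HolderClassOn α β L (U₁ ω) (U₂ ω) (f ω)) :
    ∃ g : Ω → (Fin d₁ ⊕ Fin d₂ → ℝ) → Euc m, AnisoHolder (holderWeight α β d₁ d₂) 1 g ∧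
      ∀ ω, ∀ x ∈ U₁ ω, ∀ y ∈ U₂ ω, g ω (Sum.elim x y) = f ω x y := by
  have ha := holderWeight_pos (d₁ := d₁) (d₂ := d₂) hα hβ
  choose G hG hGf using h
  refine ⟨fun ω z => (EuclideanSpace.equiv (Fin m) ℝ).symm fun i => eucPair (G ω i) z, ?_,
    fun ω x hx y hy => ?_⟩
  · exact (AnisoHolder.pi (f := fun ω z i => eucPair (G ω i) z) ha one_pos fun i =>
      anisoHolder_of_holderClass hα hβ fun ω => hG ω i).clm ha one_pos
      ((EuclideanSpace.equiv (Fin m) ℝ).symm : (Fin m → ℝ) →L[ℝ] Euc m)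
  · ext i
    simpa [eucPair] using hGf ω i x hx y hy

theorem exists_holderClassOn (hα : 0 < α) (hβ : 0 < β) {g : Ω → (Fin d₁ ⊕ Fin d₂ → ℝ) → Euc m}
    (hg : AnisoHolder (holderWeight α β d₁ d₂) 1 g) :
    ∃ L > 0, ∀ ω (U₁ : Set (Euc d₁)) (U₂ : Set (Euc d₂)) (f : Euc d₁ → Euc d₂ → Euc m),
      (∀ x ∈ U₁, ∀ y ∈ U₂, g ω (Sum.elim x y) = f x y) → HolderClassOn α β L U₁ U₂ f := by
  have ha := holderWeight_pos (d₁ := d₁) (d₂ := d₂) hα hβ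
  have h1 : ∀ i : Fin m, ∃ L > 0, ∀ ω, HolderClass α β L
      (fun (x : Euc d₁) (y : Euc d₂) => g ω (Sum.elim x y) i) := fun i =>
    exists_holderClass_of_anisoHolder hα hβ (f := fun ω z => g ω z i)
      (hg.clm ha one_pos (EuclideanSpace.proj i))
  choose L hL0 hL using h1
  refine ⟨∑ i, L i + 1, by have := Finset.sum_nonneg fun i (_ : i ∈ Finset.univ) => (hL0 i).le
                           linarith, fun ω U₁ U₂ f hf i => ⟨_, (hL i ω).mono ?_,
    fun x hx y hy => by rw [hf x hx y hy]⟩⟩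
  have := Finset.single_le_sum (f := L) (fun j _ => (hL0 j).le) (Finset.mem_univ i)
  linarith

theorem norm_elim_sub_le (z z' : Euc d₁) (x x' : Euc d₂) {r : ℝ} (hz : ‖z - z'‖ ≤ r)
    (hx : ‖x - x'‖ ≤ r) : ‖(Sum.elim z x - Sum.elim z' x' : Fin d₁ ⊕ Fin d₂ → ℝ)‖ ≤ r := by
  rw [pi_norm_le_iff_of_nonneg ((norm_nonneg _).trans hz)]
  rintro (l | l)
  · exact (PiLp.norm_apply_le (z - z') l).trans hz
  · exact (PiLp.norm_apply_le (x - x') l).trans hx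

end Extensions

/-! ### Differentials in the first group of variables. -/

section FirstDerivative

variable {d₁ d₂ : ℕ} {α β : ℝ} {Ω : Type*} {E : Type*} [NormedAddCommGroup E] [NormedSpace ℝ E]
  {g : Ω → (Fin d₁ ⊕ Fin d₂ → ℝ) → E}

/-- The differential with respect to the first group of variables. -/
noncomputable def derivFst (g : Ω → (Fin d₁ ⊕ Fin d₂ → ℝ) → E) :
    Ω → (Fin d₁ ⊕ Fin d₂ → ℝ) → Euc d₁ →L[ℝ] E :=
  fun ω z => ∑ i, (EuclideanSpace.proj (𝕜 := ℝ) i).smulRight (pderivFam (Sum.inl i) g ω z)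

/-- The linear inclusion of the first group of variables. -/
noncomputable def inclFst (d₁ d₂ : ℕ) : Euc d₁ →L[ℝ] (Fin d₁ ⊕ Fin d₂ → ℝ) :=
  ContinuousLinearMap.pi (Sum.elim (fun i => EuclideanSpace.proj i) fun _ => 0)

theorem inclFst_add (z : Euc d₁) (x : Euc d₂) :
    inclFst d₁ d₂ z + Sum.elim (0 : Euc d₁) x = Sum.elim z x := by
  ext (l | l) <;> simp [inclFst]

theorem inclFst_eq_zero (k : Fin d₁ ⊕ Fin d₂) (hk : k ∉ Finset.univ.image Sum.inl) (z : Euc d₁) :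
    inclFst d₁ d₂ z k = 0 := by
  rcases k with k | k
  · simp at hk
  · simp [inclFst]

theorem holderWeight_lt_one (hα : 1 < α) {k : Fin d₁ ⊕ Fin d₂}
    (hk : k ∈ Finset.univ.image Sum.inl) : holderWeight α β d₁ d₂ k < 1 := by
  simp only [Finset.mem_image, Finset.mem_univ, true_and] at hk
  obtain ⟨i, rfl⟩ := hk
  simpa [holderWeight] using inv_lt_one_of_one_lt₀ hα

variable (hα : 2 ≤ α) (hβ : 0 < β) (hg : AnisoHolder (holderWeight α β d₁ d₂) 1 g)
include hα hβ hg

theorem AnisoHolder.hasFDerivAt_fst (ω : Ω) (z : Euc d₁) (x : Euc d₂) :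
    HasFDerivAt (fun z : Euc d₁ => g ω (Sum.elim z x)) (derivFst g ω (Sum.elim z x)) z := by
  have ha := holderWeight_pos (d₁ := d₁) (d₂ := d₂) (show 0 < α by linarith) hβ
  have h1 := hg.hasFDerivAt_affine ha (Finset.univ.image Sum.inl)
    (fun k hk => holderWeight_lt_one (by linarith) hk) (inclFst d₁ d₂)
    inclFst_eq_zero (Sum.elim (0 : Euc d₁) x) ω z
  simp only [inclFst_add] at h1
  refine h1.congr_fderiv ?_
  rw [Finset.sum_image Sum.inl_injective.injOn]
  rfl

theorem AnisoHolder.contDiff_fst (ω : Ω) (x : Euc d₂) :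
    ContDiff ℝ 1 (fun z : Euc d₁ => g ω (Sum.elim z x)) := by
  have ha := holderWeight_pos (d₁ := d₁) (d₂ := d₂) (show 0 < α by linarith) hβ
  have h1 := hg.contDiff_affine ha (Finset.univ.image Sum.inl)
    (fun k hk => holderWeight_lt_one (by linarith) hk) (inclFst d₁ d₂)
    inclFst_eq_zero (Sum.elim (0 : Euc d₁) x) ω
  simpa only [inclFst_add] using h1

theorem AnisoHolder.derivFst :
    AnisoHolder (holderWeight α β d₁ d₂) (1 - 1 / α) (derivFst g) := by
  have ha := holderWeight_pos (d₁ := d₁) (d₂ := d₂) (show 0 < α by linarith) hβ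
  have h1 : 1 / α < 1 := by
    rw [div_lt_one (by linarith)]; linarith
  exact sum ha (sub_pos.2 h1) _ fun i _ => (hg.pderiv (k := Sum.inl i) h1).clm ha (sub_pos.2 h1)
    (ContinuousLinearMap.smulRightL ℝ (Euc d₁) E (EuclideanSpace.proj (𝕜 := ℝ) i))

/-- Second order Taylor estimate in the first group of variables. -/
theorem AnisoHolder.taylor_fst : ∃ C, 0 ≤ C ∧ ∀ ω (z z' : Euc d₁) (x : Euc d₂),
    ‖g ω (Sum.elim z' x) - g ω (Sum.elim z x) - _root_.derivFst g ω (Sum.elim z x) (z' - z)‖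
      ≤ C * ‖z' - z‖ ^ 2 := by
  have hα0 : 0 < α := by linarith
  have ha := holderWeight_pos (d₁ := d₁) (d₂ := d₂) hα0 hβ
  -- The differential has order `1 - 1/α`, which is at least the weight `1/α` because `α ≥ 2`; hence
  -- it is Lipschitz. Here `β_Y ≥ 2` enters in full strength.
  have h1 : ∀ i : Fin d₁, ∃ C, 0 ≤ C ∧ ∀ ω z t,
      ‖_root_.derivFst g ω (z + t • coordVec (Sum.inl i)) - _root_.derivFst g ω z‖
        ≤ C * |t| ^ (1 : ℝ) := fun i =>
    (hg.derivFst hα hβ).holder ha (Sum.inl i) one_pos le_rfl (by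
      simp only [holderWeight, Sum.elim_inl, one_mul]
      have : 1 / α ≤ 1 / 2 := one_div_le_one_div_of_le two_pos hα
      linarith)
  choose C hC0 hC using h1
  have hC0' : 0 ≤ ∑ i, C i := Finset.sum_nonneg fun i _ => hC0 i
  have hlip : ∀ ω (z z' : Euc d₁) (x : Euc d₂), ‖_root_.derivFst g ω (Sum.elim z' x)
      - _root_.derivFst g ω (Sum.elim z x)‖ ≤ (∑ i, C i) * ‖z' - z‖ := fun ω z z' x => by
    refine (norm_sub_le_sum_of_coord Finset.univ
      (f := fun z : Fin d₁ → ℝ => _root_.derivFst g ω (Sum.elim z x))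
      (ω := fun i t => C i * |t| ^ (1 : ℝ)) (fun i _ z t => ?_) z z' (by simp)).trans ?_
    · rw [Sum.elim_add_smul_coordVec_inl]; exact hC i ω _ t
    · rw [Finset.sum_mul]
      refine Finset.sum_le_sum fun i _ => mul_le_mul_of_nonneg_left ?_ (hC0 i)
      rw [Real.rpow_one]
      exact PiLp.norm_apply_le (z' - z) i
  refine ⟨_, hC0', fun ω z z' x => ?_⟩
  have := (convex_closedBall z ‖z' - z‖).norm_image_sub_le_of_norm_hasFDerivWithin_le'
    (f := fun z : Euc d₁ => g ω (Sum.elim z x)) (φ := _root_.derivFst g ω (Sum.elim z x))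
    (C := (∑ i, C i) * ‖z' - z‖)
    (fun w _ => (hg.hasFDerivAt_fst hα hβ ω w x).hasFDerivWithinAt)
    (fun w hw => (hlip ω z w x).trans (by
      gcongr
      rwa [mem_closedBall_iff_norm] at hw)) (mem_closedBall_self (norm_nonneg _))
    (by rw [mem_closedBall_iff_norm])
  rwa [mul_assoc, ← sq] at this

end FirstDerivative

/-! ### Uniform linear algebra for the Jacobian. -/

section LinearAlgebra

variable {n m : ℕ}

theorem norm_adjoint_sq (A : Euc n →L[ℝ] Euc m) (w : Euc m) :
    ‖ContinuousLinearMap.adjoint A w‖ ^ 2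
      = ∑ k, (∑ i, w i * A (EuclideanSpace.single k 1) i) ^ 2 := by
  rw [EuclideanSpace.norm_sq_eq]
  refine Finset.sum_congr rfl fun k _ => ?_
  rw [Real.norm_eq_abs, sq_abs]
  congr 1
  have h1 := ContinuousLinearMap.adjoint_inner_left A (EuclideanSpace.single k 1) w
  rw [EuclideanSpace.inner_single_right] at h1
  simp only [starRingEnd_apply, one_mul, star_trivial] at h1
  rw [h1, PiLp.inner_apply]
  exact Finset.sum_congr rfl fun i _ => by simp [mul_comm]

theorem posSemidef_sub_iff (A : Euc n →L[ℝ] Euc m) {J : Matrix (Fin m) (Fin n) ℝ}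
    (hJ : ∀ i k, J i k = A (EuclideanSpace.single k 1) i) (τ : ℝ) :
    (J * J.transpose - τ • (1 : Matrix (Fin m) (Fin m) ℝ)).PosSemidef ↔
      ∀ w, τ * ‖w‖ ^ 2 ≤ ‖ContinuousLinearMap.adjoint A w‖ ^ 2 := by
  have key : ∀ w : Fin m → ℝ, star w ⬝ᵥ
      (J * J.transpose - τ • (1 : Matrix (Fin m) (Fin m) ℝ)).mulVec w
      = ‖ContinuousLinearMap.adjoint A (WithLp.toLp 2 w)‖ ^ 2 - τ * ‖(WithLp.toLp 2 w : Euc m)‖ ^ 2 := by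
    intro w
    rw [norm_adjoint_sq, EuclideanSpace.norm_sq_eq, Matrix.sub_mulVec, dotProduct_sub,
      ← Matrix.mulVec_mulVec, Matrix.smul_mulVec, Matrix.one_mulVec, dotProduct_smul,
      Matrix.dotProduct_mulVec, Matrix.mulVec_transpose]
    simp only [star_trivial, dotProduct, Matrix.vecMul, smul_eq_mul, Real.norm_eq_abs, sq_abs, hJ]
    simp [sq]
  rw [Matrix.posSemidef_iff_dotProduct_mulVec]
  constructor
  · intro h w
    have := h.2 w
    rw [key] at this
    simpa using this
  · intro h
    refine ⟨?_, fun w => by rw [key]; exact sub_nonneg.2 (h _)⟩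
    refine Matrix.IsHermitian.sub ?_ ?_
    · simpa using Matrix.isHermitian_mul_conjTranspose_self J
    · exact (Matrix.isHermitian_one).smul (IsSelfAdjoint.all τ)

/-- A right inverse with values in the orthogonal complement of the kernel. -/
theorem exists_orthogonal_rightInverse (A : Euc n →L[ℝ] Euc m) {τ : ℝ} (hτ : 0 < τ)
    (h : ∀ w, τ * ‖w‖ ^ 2 ≤ ‖ContinuousLinearMap.adjoint A w‖ ^ 2) :
    ∃ B : Euc m →L[ℝ] Euc n, (∀ w, A (B w) = w) ∧ (∀ w, B w ∈ A.kerᗮ) ∧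
      ∀ w, ‖B w‖ ≤ ‖A‖ / τ * ‖w‖ := by
  -- The right inverse is `A*(AA*)⁻¹`; the lower bound on `A*` gives `‖(AA*)⁻¹‖ ≤ 1/τ`.
  set S : Euc m →L[ℝ] Euc m := A.comp (ContinuousLinearMap.adjoint A) with hS
  have hSw : ∀ w, τ * ‖w‖ ≤ ‖S w‖ := fun w => by
    rcases eq_or_ne w 0 with rfl | hw
    · simp
    have h1 : ‖ContinuousLinearMap.adjoint A w‖ ^ 2 ≤ ‖w‖ * ‖S w‖ := by
      rw [← real_inner_self_eq_norm_sq, ContinuousLinearMap.adjoint_inner_left]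
      exact real_inner_le_norm _ _
    have h2 : ‖w‖ * (τ * ‖w‖) ≤ ‖w‖ * ‖S w‖ := by linarith [h w, sq ‖w‖]
    exact le_of_mul_le_mul_left h2 (norm_pos_iff.2 hw)
  have hinj : Function.Injective S := by
    rw [injective_iff_map_eq_zero]
    intro w hw
    have := hSw w
    rw [hw, norm_zero] at this
    exact norm_eq_zero.1 (le_antisymm (by nlinarith) (norm_nonneg _))
  set e := LinearEquiv.ofInjectiveEndo (S : Euc m →ₗ[ℝ] Euc m) hinj with he
  have heS : ∀ w, S (e.symm w) = w := fun w => e.apply_symm_apply w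
  refine ⟨(ContinuousLinearMap.adjoint A).comp (LinearMap.toContinuousLinearMap
    (e.symm : Euc m →ₗ[ℝ] Euc m)), fun w => heS w, fun w => ?_, fun w => ?_⟩
  · rw [ContinuousLinearMap.orthogonal_ker]
    exact Submodule.le_topologicalClosure _ ⟨_, rfl⟩
  · have h1 : ‖e.symm w‖ ≤ ‖w‖ / τ := by
      rw [le_div_iff₀ hτ, mul_comm]
      simpa [heS] using hSw (e.symm w)
    calc _ ≤ ‖ContinuousLinearMap.adjoint A‖ * ‖e.symm w‖ := ContinuousLinearMap.le_opNorm _ _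
      _ ≤ ‖A‖ * (‖w‖ / τ) := by
        rw [LinearIsometryEquiv.norm_map]; gcongr
      _ = _ := by ring

theorem exists_linearIsometryEquiv {E : Type*} [NormedAddCommGroup E] [InnerProductSpace ℝ E]
    [FiniteDimensional ℝ E] {d : ℕ} (h : Module.finrank ℝ E = d) : Nonempty (Euc d ≃ₗᵢ[ℝ] E) :=
  ⟨((stdOrthonormalBasis ℝ E).reindex (finCongr h)).repr.symm⟩

theorem finrank_ker_of_adjoint_bound (A : Euc n →L[ℝ] Euc m) {τ : ℝ} (hτ : 0 < τ)
    (h : ∀ w, τ * ‖w‖ ^ 2 ≤ ‖ContinuousLinearMap.adjoint A w‖ ^ 2) :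
    Module.finrank ℝ A.ker = n - m := by
  obtain ⟨B, hB, -⟩ := exists_orthogonal_rightInverse A hτ h
  have h1 : A.range = ⊤ := LinearMap.range_eq_top.2 fun w => ⟨B w, hB w⟩
  have h2 := LinearMap.finrank_range_add_finrank_ker (A : Euc n →ₗ[ℝ] Euc m)
  have h3 : Module.finrank ℝ (A : Euc n →ₗ[ℝ] Euc m).range = m := by
    rw [show (A : Euc n →ₗ[ℝ] Euc m).range = ⊤ from h1, finrank_top, finrank_euclideanSpace_fin]
  rw [h3, finrank_euclideanSpace_fin] at h2
  have h4 : Module.finrank ℝ A.ker = Module.finrank ℝ (A : Euc n →ₗ[ℝ] Euc m).ker := rfl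
  omega

/-- Needed because `DY - d` is a truncated subtraction: only for `d ≤ DY` is `DY - (DY - d) = d`. -/
theorem le_of_isSubmanifold {d D : ℕ} {M : Set (Euc D)} (h : IsSubmanifold d M) {p : Euc D}
    (hp : p ∈ M) : d ≤ D := by
  obtain ⟨V, -, hV, U, -, ξ, η, -, hη, -, -, -, hd⟩ := h p hp
  have h1 := LinearMap.finrank_le_finrank_of_injective
    (f := (fderiv ℝ ξ (η p) : Euc d →ₗ[ℝ] Euc D)) (hd _ (hη (mem_of_mem_nhdsWithin hp hV))).2
  simpa using h1

end LinearAlgebra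

/-! ### Affine substitutions and Euclidean forms of the results. -/

section Substitution

variable {Q : Type*} [Fintype Q] [DecidableEq Q] {d n m : ℕ} {α β : ℝ} {Ω : Type*}
  {E : Type*} [NormedAddCommGroup E] [NormedSpace ℝ E]

/-- Selecting coordinates, as a linear map into a Euclidean space. -/
noncomputable def toEuc (σ : Fin n → Q) : (Q → ℝ) →L[ℝ] Euc n :=
  ((EuclideanSpace.equiv (Fin n) ℝ).symm : (Fin n → ℝ) →L[ℝ] Euc n).comp
    (ContinuousLinearMap.pi fun i => ContinuousLinearMap.proj (σ i))

@[simp]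
theorem toEuc_apply (σ : Fin n → Q) (z : Q → ℝ) (i : Fin n) : toEuc σ z i = z (σ i) := rfl

/-- The first group of arguments has the smallest weight, so it accepts any affine map with bounded
linear part. The second may only be translated and relabelled. The translations themselves need not
be bounded. -/
theorem AnisoHolder.substitution {a : Q → ℝ} (ha : ∀ q, 0 < a q) (hα : 0 < α) (hβ : 0 < β)
    {g : Ω → (Fin n ⊕ Fin m → ℝ) → E} (hg : AnisoHolder (holderWeight α β n m) 1 g)
    (haα : ∀ q, 1 / α ≤ a q) {σ : Fin m → Q} (hσ : ∀ i, a (σ i) = 1 / β)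
    {A : Ω → (Q → ℝ) →L[ℝ] Euc n} (hA : ∃ C, ∀ ω, ‖A ω‖ ≤ C) (c : Ω → Euc n) (x : Ω → Euc m) :
    AnisoHolder a 1 (fun ω z => g ω (Sum.elim (c ω + A ω z) (x ω + toEuc σ z))) := by
  obtain ⟨C, hC⟩ := hA
  refine AnisoHolder.comp ha (holderWeight_pos hα hβ) one_pos hg
    (AnisoMap.of_affine ha (A := fun ω k' k => Sum.elim (fun i => A ω (coordVec k) i)
      (fun i => coordVec k (σ i)) k') ?_ ⟨max C 1, ?_⟩ ?_)
  · rintro ω z t k (i | i)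
    · simp [add_assoc]
    · simp [add_assoc]
  · rintro ω (i | i) k
    · refine le_trans ?_ (le_max_left _ _)
      calc |A ω (coordVec k) i| ≤ ‖A ω (coordVec k)‖ := PiLp.norm_apply_le (A ω (coordVec k)) i
        _ ≤ ‖A ω‖ * ‖(coordVec k : Q → ℝ)‖ := (A ω).le_opNorm _
        _ ≤ C := by simpa [coordVec, Pi.norm_single] using hC ω
    · refine le_trans ?_ (le_max_right _ _)
      by_cases h : σ i = k
      · simp [← h]
      · simp [h]
  · rintro ω (i | i) k hk
    · exact absurd (haα k) (not_le.2 hk)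
    · have : σ i ≠ k := by
        rintro rfl
        rw [hσ i] at hk
        exact lt_irrefl _ hk
      simp [this]

/-- The implicit function theorem in anisotropic Hölder classes, in Euclidean norms. -/
theorem AnisoHolder.implicitFunction_euc (hα : 2 ≤ α) (hβ : 0 < β) (hβα : β ≤ α)
    {Φ : Ω → ((Fin d ⊕ Fin n) ⊕ Fin m → ℝ) → Euc m}
    (hΦ : AnisoHolder (Sum.elim (holderWeight α β d n) fun _ => 1 / α) 1 Φ)
    (hΦ0 : ∀ ω, Φ ω 0 = 0) (hΦ1 : ∀ ω, HasFDerivAt (fun w : Euc m => Φ ω (Sum.elim 0 w))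
      (ContinuousLinearMap.id ℝ (Euc m)) 0) {R : ℝ} (hR : 0 < R) :
    ∃ ρ σ : ℝ, 0 < ρ ∧ ρ ≤ R ∧ 0 < σ ∧ ∃ b : Ω → (Fin d ⊕ Fin n → ℝ) → Euc m,
      AnisoHolder (holderWeight α β d n) 1 b ∧ (∀ ω, b ω 0 = 0) ∧
      ∀ ω (u : Euc d) (x : Euc n), ‖u‖ ≤ σ → ‖x‖ ≤ σ → ‖b ω (Sum.elim u x)‖ < ρ ∧
        ∀ w : Euc m, ‖w‖ ≤ ρ →
          (Φ ω (Sum.elim (Sum.elim u x) w) = 0 ↔ w = b ω (Sum.elim u x)) := by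
  have hα0 : 0 < α := by linarith
  have ha := holderWeight_pos (d₁ := d) (d₂ := n) hα0 hβ
  have h0 : 0 < 1 / α := by positivity
  have h01 : 1 / α < 1 := by rw [div_lt_one hα0]; linarith
  -- This is where `β ≤ α` enters: the unknown has weight `1/α` and must be allowed to depend on the
  -- parameters of weight `1/β`.
  have ha₁ : ∀ k, 1 / α ≤ holderWeight α β d n k := by
    rintro (k | k)
    · exact le_rfl
    · exact one_div_le_one_div_of_le hβ hβα
  have ha' : ∀ l, 0 < (Sum.elim (holderWeight α β d n) fun _ : Fin m => 1 / α) l := by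
    rintro (l | l)
    · exact ha l
    · exact h0
  set ε := EuclideanSpace.equiv (Fin m) ℝ with hε
  have hΨ := hΦ.clm ha' one_pos (ε : Euc m →L[ℝ] (Fin m → ℝ))
  obtain ⟨ρ, σ, hρ, hρR, hσ, b, hb, hb0, hbu⟩ := hΨ.implicitFunction ha h0 h01 ha₁
    (fun ω => by simp [hΦ0]) (fun ω => by
      have h1 := hΨ.hasFDerivAt_last ha h0 h01 ω 0 0
      have h2 : HasFDerivAt (fun q : Fin m → ℝ => ε (Φ ω (Sum.elim 0 (ε.symm q))))
          ((ε : Euc m →L[ℝ] (Fin m → ℝ)).comp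
            ((ContinuousLinearMap.id ℝ (Euc m)).comp (ε.symm : (Fin m → ℝ) →L[ℝ] Euc m))) 0 := by
        refine ε.hasFDerivAt.comp 0 (HasFDerivAt.comp (0 : Fin m → ℝ)
          (g := fun w : Euc m => Φ ω (Sum.elim 0 w)) ?_ ε.symm.hasFDerivAt)
        simpa using hΦ1 ω
      have h3 := h1.unique h2
      have hz : (Sum.elim 0 0 : (Fin d ⊕ Fin n) ⊕ Fin m → ℝ) = 0 := by ext (l | l) <;> simp
      rw [hz] at h3
      rw [h3]
      ext q; simp) hR
  have hbE := hb.clm ha one_pos (ε.symm : (Fin m → ℝ) →L[ℝ] Euc m)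
  obtain ⟨δ, hδ, hδ'⟩ := hbE.equicontinuous ha one_pos (half_pos hρ)
  refine ⟨ρ, min σ δ, hρ, hρR, lt_min hσ hδ, _, hbE, fun ω => by simp [hb0],
    fun ω u x hu hx => ⟨?_, fun w hw => ?_⟩⟩
  · have h1 : ‖(Sum.elim u x - 0 : Fin d ⊕ Fin n → ℝ)‖ ≤ δ := by
      have := norm_elim_sub_le u 0 x 0 (r := δ) (by simpa using hu.trans (min_le_right _ _))
        (by simpa using hx.trans (min_le_right _ _))
      convert this using 2
      ext (l | l) <;> simp
    have h2 := hδ' ω 0 (Sum.elim u x) h1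
    rw [hb0, map_zero, sub_zero] at h2
    linarith
  · have h1 : ‖(Sum.elim u x : Fin d ⊕ Fin n → ℝ)‖ ≤ σ :=
      norm_sum_elim hσ.le
        ((pi_norm_le_iff_of_nonneg hσ.le).2 fun i =>
          (PiLp.norm_apply_le u i).trans (hu.trans (min_le_left _ _)))
        ((pi_norm_le_iff_of_nonneg hσ.le).2 fun i =>
          (PiLp.norm_apply_le x i).trans (hx.trans (min_le_left _ _)))
    have h2 := (hbu ω (Sum.elim u x) h1).2 (ε w)
      ((pi_norm_le_iff_of_nonneg hρ.le).2 fun i => (PiLp.norm_apply_le w i).trans hw)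
    have h3 : (Sum.elim (Sum.elim u x) (ε w) : (Fin d ⊕ Fin n) ⊕ Fin m → ℝ)
        = Sum.elim (Sum.elim u x) w := rfl
    rw [h3] at h2
    simp only [ContinuousLinearEquiv.coe_coe]
    rw [← ε.map_eq_zero_iff, ContinuousLinearEquiv.eq_symm_apply]
    exact h2

theorem AnisoHolder.clm_family {G : Type*} [NormedAddCommGroup G] [NormedSpace ℝ G]
    {a : Q → ℝ} {s : ℝ} (ha : ∀ q, 0 < a q) (hs : 0 < s) {f : Ω → (Q → ℝ) → E}
    (hf : AnisoHolder a s f) {A : Ω → E →L[ℝ] G} (hA : ∃ C, ∀ ω, ‖A ω‖ ≤ C) :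
    AnisoHolder a s (fun ω z => A ω (f ω z)) :=
  bilin (ContinuousLinearMap.id ℝ (E →L[ℝ] G)) ha hs (const ha hs hA) hf

/-- The clipped coordinates, as a Euclidean vector. -/
noncomputable def clipEuc (ρ : ℝ) (σ : Fin n → Q) (z : Q → ℝ) : Euc n :=
  (EuclideanSpace.equiv (Fin n) ℝ).symm fun i => clip ρ (z (σ i))

theorem AnisoHolder.clipEuc {a : Q → ℝ} {s ρ : ℝ} (ha : ∀ q, 0 < a q) (hs : 0 < s) (hρ : 0 < ρ)
    (σ : Fin n → Q) : AnisoHolder a s (fun (_ : Ω) z => clipEuc ρ σ z) :=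
  (pi (f := fun (_ : Ω) z i => clip ρ (z (σ i))) ha hs fun i =>
    coord ha hs (contDiff_clip ρ) (hasCompactSupport_clip hρ) (σ i)).clm ha hs
    ((EuclideanSpace.equiv (Fin n) ℝ).symm : (Fin n → ℝ) →L[ℝ] Euc n)

theorem clipEuc_eq {ρ : ℝ} (hρ : 0 < ρ) {σ : Fin n → Q} {z : Q → ℝ} {u : Euc n}
    (h : ∀ i, z (σ i) = u i) (hu : ‖u‖ ≤ ρ) : clipEuc ρ σ z = u := by
  ext i
  show clip ρ (z (σ i)) = u i
  rw [h, clip_of_abs_le hρ ((PiLp.norm_apply_le u i).trans hu)]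

end Substitution

/-! ### From defining equations to charts. -/

section FromEquations

/-- The orthogonal decomposition into `ker A` and its complement, in coordinates: `E` parametrizes
the kernel isometrically, `P` reads off the kernel part, and `B` inverts `A` on the complement. -/
theorem exists_kernel_splitting {n m d : ℕ} (A : Euc n →L[ℝ] Euc m) {τ : ℝ} (hτ : 0 < τ)
    (h : ∀ w, τ * ‖w‖ ^ 2 ≤ ‖ContinuousLinearMap.adjoint A w‖ ^ 2) (hd : n - m = d) :
    ∃ (B : Euc m →L[ℝ] Euc n) (E : Euc d →L[ℝ] Euc n) (P : Euc n →L[ℝ] Euc d),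
      (∀ w, A (B w) = w) ∧ (∀ u, A (E u) = 0) ∧ (∀ u, P (E u) = u) ∧ (∀ w, P (B w) = 0) ∧
      (∀ v, E (P v) + B (A v) = v) ∧ (∀ u, ‖E u‖ = ‖u‖) ∧ (∀ v, ‖P v‖ ≤ ‖v‖) ∧
      ∀ w, ‖B w‖ ≤ ‖A‖ / τ * ‖w‖ := by
  obtain ⟨B, hAB, hBk, hBn⟩ := exists_orthogonal_rightInverse A hτ h
  obtain ⟨e⟩ := exists_linearIsometryEquiv ((finrank_ker_of_adjoint_bound A hτ h).trans hd)
  refine ⟨B, A.ker.subtypeL.comp (e.toContinuousLinearEquiv : Euc d →L[ℝ] A.ker),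
    (e.symm.toContinuousLinearEquiv : A.ker →L[ℝ] Euc d).comp A.ker.orthogonalProjectionOnto,
    hAB, fun u => (e u).2, fun u => by simp, fun w => ?_, fun v => ?_, fun u => e.norm_map u,
    fun v => ?_, hBn⟩
  · simp [Submodule.orthogonalProjectionOnto_apply_of_mem_orthogonal (hBk w)]
  · have h1 : v - B (A v) ∈ A.ker := by simp [hAB]
    have h2 : A.ker.orthogonalProjectionOnto v = ⟨v - B (A v), h1⟩ := by
      rw [← Submodule.orthogonalProjectionOnto_mem_subspace_eq_self ⟨v - B (A v), h1⟩, map_sub,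
        Submodule.orthogonalProjectionOnto_apply_of_mem_orthogonal (hBk _), sub_zero]
    simp [h2]
  · simpa using Submodule.norm_orthogonalProjectionOnto_apply_le A.ker v

variable {DX DY d : ℕ} {βY βX : ℝ} {MX : Set (Euc DX)} {M : Euc DX → Set (Euc DY)}

theorem HasDefiningEquations.hasSmoothCharts (hβX : 0 < βX) (hβY : 2 ≤ βY) (hβ : βX ≤ βY)
    (hM : ∀ x ∈ MX, IsSubmanifold d (M x)) {τ τ₁ L : ℝ} (hτ : 0 < τ) (hτ₁ : 0 < τ₁)
    (h : HasDefiningEquations βY βX τ τ₁ L d MX M) :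
    ∃ τ > 0, ∃ τ₁ > 0, ∃ L > 0, HasSmoothCharts βY βX τ τ₁ L d MX M := by
  have hβY0 : 0 < βY := by linarith
  set Ω := {ω : Euc DX × Euc DY // ω.1 ∈ MX ∧ ω.2 ∈ M ω.1}
  choose F hFH hFz hFJ using fun ω : Ω => h.2 ω.1.1 ω.2.1 ω.1.2 ω.2.2
  obtain ⟨g, hg, hgF⟩ := exists_extension_of_holderClassOn hβY0 hβX (Ω := Ω)
    (U₁ := fun ω => ball ω.1.2 τ) (U₂ := fun ω => MX ∩ ball ω.1.1 τ) (f := F) hFH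
  set A : Ω → Euc DY →L[ℝ] Euc (DY - d) :=
    fun ω => derivFst g ω (Sum.elim ω.1.2 ω.1.1) with hA
  obtain ⟨CA, hCA0, hCA⟩ : ∃ C, 0 ≤ C ∧ ∀ ω, ‖A ω‖ ≤ C := by
    obtain ⟨C, hC0, hC⟩ := (hg.derivFst hβY hβX).bound
    exact ⟨C, hC0, fun ω => hC ω _⟩
  have hadj : ∀ ω w, τ₁ * ‖w‖ ^ 2 ≤ ‖ContinuousLinearMap.adjoint (A ω) w‖ ^ 2 := fun ω => by
    have hx : ω.1.1 ∈ MX ∩ ball ω.1.1 τ := ⟨ω.2.1, mem_ball_self hτ⟩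
    have h1 : HasFDerivAt (fun y' => F ω y' ω.1.1) (A ω) ω.1.2 := by
      refine (hg.hasFDerivAt_fst hβY hβX ω ω.1.2 ω.1.1).congr_of_eventuallyEq ?_
      filter_upwards [ball_mem_nhds ω.1.2 hτ] with y hy
      exact (hgF ω y hy _ hx).symm
    refine (posSemidef_sub_iff (A ω) (fun i k => ?_) τ₁).1 (hFJ ω _ hx _ (mem_ball_self hτ))
    simp [jacobianAt, h1.fderiv]
  choose B E P hAB hAE hPE hPB hdec hEn hPn hBn using fun ω => exists_kernel_splitting (d := d)
    (A ω) hτ₁ (hadj ω) (by have := le_of_isSubmanifold (hM _ ω.2.1) ω.2.2; omega)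
  set CB := CA / τ₁ with hCB
  have hCB0 : 0 ≤ CB := by positivity
  replace hBn : ∀ ω w, ‖B ω w‖ ≤ CB * ‖w‖ := fun ω w => (hBn ω w).trans (by
    rw [hCB]; gcongr; exact hCA ω)
  have hBop : ∀ ω, ‖B ω‖ ≤ CB := fun ω => (B ω).opNorm_le_bound hCB0 (hBn ω)
  have hEop : ∀ ω, ‖E ω‖ ≤ 1 := fun ω =>
    (E ω).opNorm_le_bound zero_le_one fun u => by rw [hEn, one_mul]
  set a' := (Sum.elim (holderWeight βY βX d DX) fun _ : Fin (DY - d) => 1 / βY)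
  have ha := holderWeight_pos (d₁ := d) (d₂ := DX) hβY0 hβX
  have ha' : ∀ l, 0 < a' l := by
    rintro (l | l)
    · exact ha l
    · exact one_div_pos.2 hβY0
  have hinv : 1 / βY ≤ 1 / βX := one_div_le_one_div_of_le hβX hβ
  set ℓ : Ω → ((Fin d ⊕ Fin DX) ⊕ Fin (DY - d) → ℝ) →L[ℝ] Euc DY := fun ω =>
    (E ω).comp (toEuc fun i => Sum.inl (Sum.inl i)) + (B ω).comp (toEuc fun i => Sum.inr i)
    with hℓ
  -- `Φ(u, x, w) = F(y₀ + Eu + Bw, x₀ + x)`, whose `w`-differential at the origin is `AB = 1`.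
  set Φ : Ω → ((Fin d ⊕ Fin DX) ⊕ Fin (DY - d) → ℝ) → Euc (DY - d) := fun ω z =>
    g ω (Sum.elim (ω.1.2 + ℓ ω z) (ω.1.1 + toEuc (fun i => Sum.inl (Sum.inr i)) z)) with hΦdef
  have hΦ : AnisoHolder a' 1 Φ := by
    refine hg.substitution ha' hβY0 hβX ?_ (fun i => rfl)
      ⟨‖(toEuc fun i => Sum.inl (Sum.inl i) :
          ((Fin d ⊕ Fin DX) ⊕ Fin (DY - d) → ℝ) →L[ℝ] Euc d)‖
        + CB * ‖(toEuc fun i => Sum.inr i :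
          ((Fin d ⊕ Fin DX) ⊕ Fin (DY - d) → ℝ) →L[ℝ] Euc (DY - d))‖, fun ω => ?_⟩ _ _
    · rintro ((l | l) | l)
      exacts [le_rfl, hinv, le_rfl]
    · refine (norm_add_le _ _).trans (add_le_add ?_ ?_)
      · refine (ContinuousLinearMap.opNorm_comp_le _ _).trans ?_
        exact mul_le_of_le_one_left (norm_nonneg _) (hEop ω)
      · refine (ContinuousLinearMap.opNorm_comp_le _ _).trans ?_
        gcongr
        exact hBop ω
  have hΦe : ∀ ω (u : Euc d) (x : Euc DX) (w : Euc (DY - d)),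
      Φ ω (Sum.elim (Sum.elim u x) w) = g ω (Sum.elim (ω.1.2 + (E ω u + B ω w) : Euc DY)
        (ω.1.1 + x : Euc DX)) :=
    fun ω u x w => rfl
  obtain ⟨ρ, σ, hρ, hρR, hσ, b, hb, hb0, hbu⟩ := hΦ.implicitFunction_euc hβY hβX hβ
    (fun ω => by
      simp only [hΦdef, map_zero, add_zero, WithLp.ofLp_zero]
      rw [hgF ω _ (mem_ball_self hτ) _ ⟨ω.2.1, mem_ball_self hτ⟩]
      have : ω.1.2 ∈ M ω.1.1 ∩ ball ω.1.2 τ := ⟨ω.2.2, mem_ball_self hτ⟩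
      rw [hFz ω _ ⟨ω.2.1, mem_ball_self hτ⟩] at this
      exact this.2)
    (fun ω => by
      have h1 : HasFDerivAt (fun w => ω.1.2 + B ω w) (B ω) 0 := (B ω).hasFDerivAt.const_add _
      have h2 : HasFDerivAt (fun y : Euc DY => g ω (Sum.elim y ω.1.1)) (A ω)
          (ω.1.2 + B ω 0) := by
        simpa using hg.hasFDerivAt_fst hβY hβX ω ω.1.2 ω.1.1
      have h3 := h2.comp (0 : Euc (DY - d)) h1
      rw [show (A ω).comp (B ω) = ContinuousLinearMap.id ℝ _ from
        ContinuousLinearMap.ext (hAB ω)] at h3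
      refine h3.congr_of_eventuallyEq
        (Filter.Eventually.of_forall fun w => ?_)
      have := hΦe ω 0 0 w
      simpa using! this)
    -- This choice gives `‖Bw‖ ≤ τ/2` for `‖w‖ ≤ ρ`, so that together with `‖u‖ < τ/2` the point
    -- stays where `F` describes the members.
    (R := τ / (2 * (CB + 1))) (by positivity)
  set τ₂ := min σ (τ / 2) with hτ₂
  have hτ₂0 : 0 < τ₂ := lt_min hσ (by positivity)
  have hball : ∀ ω (u : Euc d) (w : Euc (DY - d)), ‖u‖ < τ₂ → ‖w‖ ≤ ρ →
      ω.1.2 + (E ω u + B ω w) ∈ ball ω.1.2 τ := fun ω u w hu hw => by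
    rw [mem_ball_iff_norm, add_sub_cancel_left]
    have h1 : CB * ‖w‖ ≤ τ / 2 := by
      calc CB * ‖w‖ ≤ (CB + 1) * (τ / (2 * (CB + 1))) := by
            gcongr
            · linarith
            · exact hw.trans hρR
        _ = τ / 2 := by field_simp
    have h2 := norm_add_le (E ω u) (B ω w)
    rw [hEn] at h2
    linarith [hBn ω w, hu.trans_le (min_le_right σ (τ / 2))]
  set τ' := min (min τ σ) (min τ₂ (ρ / (CA + 1))) with hτ'
  have hτ'0 : 0 < τ' := lt_min (lt_min hτ hσ) (lt_min hτ₂0 (by positivity))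
  have hτ'τ : τ' ≤ τ := (min_le_left _ _).trans (min_le_left _ _)
  have hτ'σ : τ' ≤ σ := (min_le_left _ _).trans (min_le_right _ _)
  have hτ'2 : τ' ≤ τ₂ := (min_le_right _ _).trans (min_le_left _ _)
  have hτ'ρ : τ' ≤ ρ / (CA + 1) := (min_le_right _ _).trans (min_le_right _ _)
  set G : Ω → (Fin d ⊕ Fin DX → ℝ) → Euc DY := fun ω z => ω.1.2 + (E ω (clipEuc τ₂ Sum.inl z)
    + B ω (b ω (Sum.elim (0 + toEuc Sum.inl z : Euc d) (-ω.1.1 + toEuc Sum.inr z : Euc DX))))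
    with hG
  have hGH : AnisoHolder (holderWeight βY βX d DX) 1 G := by
    -- The family of constants `y₀` must be bounded, which is the assumption that `M_Y` lies in a
    -- ball. The linear term in `u` is clipped for the same reason.
    refine AnisoHolder.add ha one_pos (AnisoHolder.const ha one_pos ⟨L, fun ω => ?_⟩)
      (AnisoHolder.add ha one_pos
        ((AnisoHolder.clipEuc ha one_pos hτ₂0 Sum.inl).clm_family ha one_pos ⟨1, hEop⟩)
        ((hb.substitution ha hβY0 hβX ?_ (fun i => rfl) ⟨_, fun ω => le_rfl⟩
          (fun _ => 0) fun ω => -ω.1.1).clm_family ha one_pos ⟨CB, hBop⟩))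
    · exact (mem_ball_zero_iff.1 (h.1 (mem_biUnion ω.2.1 ω.2.2))).le
    · rintro (l | l)
      exacts [le_rfl, hinv]
  have hGe : ∀ ω (u : Euc d) (x : Euc DX), ‖u‖ < τ₂ → G ω (Sum.elim u x)
      = ω.1.2 + (E ω u + B ω (b ω (Sum.elim u (x - ω.1.1 : Euc DX)))) := fun ω u x hu => by
    have h1 : clipEuc τ₂ Sum.inl (Sum.elim u x : Fin d ⊕ Fin DX → ℝ) = u :=
      clipEuc_eq hτ₂0 (fun i => rfl) hu.le
    have h2 : (toEuc Sum.inl (Sum.elim u x : Fin d ⊕ Fin DX → ℝ) : Euc d) = u := rfl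
    have h3 : (toEuc Sum.inr (Sum.elim u x : Fin d ⊕ Fin DX → ℝ) : Euc DX) = x := rfl
    simp only [hG, h1, h2, h3, zero_add, neg_add_eq_sub]
  obtain ⟨L', hL', hGL⟩ := exists_holderClassOn hβY0 hβX hGH
  refine ⟨τ', hτ'0, τ₂, hτ₂0, max L' 1, lt_max_of_lt_right one_pos, fun x₀ hx₀ y₀ hy₀ => ?_⟩
  set ω : Ω := ⟨(x₀, y₀), hx₀, hy₀⟩ with hω
  set U := totalY MX M ∩ {y | ‖P ω (y - y₀)‖ < τ₂ ∧ ‖A ω (y - y₀)‖ < ρ} with hU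
  have hopen : IsOpen {y | ‖P ω (y - y₀)‖ < τ₂ ∧ ‖A ω (y - y₀)‖ < ρ} :=
    (isOpen_lt (f := fun y => ‖P ω (y - y₀)‖) (by fun_prop) continuous_const).inter
      (isOpen_lt (f := fun y => ‖A ω (y - y₀)‖) (by fun_prop) continuous_const)
  have hx : ∀ x ∈ MX ∩ ball x₀ τ', x ∈ MX ∩ ball ω.1.1 τ ∧ ‖x - x₀‖ ≤ σ := fun x hx =>
    ⟨⟨hx.1, ball_subset_ball hτ'τ hx.2⟩, (mem_ball_iff_norm.1 hx.2).le.trans hτ'σ⟩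
  -- In the coordinates `(u, w)` the member is the graph of `b`; `U` is the box in these
  -- coordinates.
  have hzero : ∀ x ∈ MX ∩ ball x₀ τ', ∀ u : Euc d, ‖u‖ < τ₂ → ∀ w, ‖w‖ ≤ ρ →
      (y₀ + (E ω u + B ω w) ∈ M x ↔ w = b ω (Sum.elim u (x - x₀ : Euc DX))) := fun x hx' u hu w hw => by
    have hb' := hball ω u w hu hw
    have h1 := (hbu ω u (x - x₀) (hu.le.trans (min_le_left _ _)) (hx x hx').2).2 w hw
    rw [← h1, hΦe]
    have h2 : ω.1.1 + (x - x₀) = x := add_sub_cancel _ _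
    rw [h2, hgF ω _ hb' x (hx x hx').1]
    have h3 : y₀ + (E ω u + B ω w) ∈ M x ∩ ball ω.1.2 τ ↔ _ :=
      Set.ext_iff.1 (hFz ω x (hx x hx').1) _
    constructor
    · intro hy
      exact (h3.1 ⟨hy, hb'⟩).2
    · intro hy
      exact (h3.2 ⟨hb', hy⟩).1
  have hPG : ∀ u w, P ω (y₀ + (E ω u + B ω w) - y₀) = u := fun u w => by
    rw [add_sub_cancel_left, map_add, hPE, hPB, add_zero]
  have hAG : ∀ u w, A ω (y₀ + (E ω u + B ω w) - y₀) = w := fun u w => by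
    rw [add_sub_cancel_left, map_add, hAE, hAB, zero_add]
  have hsplit : ∀ y, y = y₀ + (E ω (P ω (y - y₀)) + B ω (A ω (y - y₀))) := fun y => by
    rw [hdec, add_sub_cancel]
  refine ⟨U, inter_subset_left, Filter.inter_mem self_mem_nhdsWithin
    (mem_nhdsWithin_of_mem_nhds (hopen.mem_nhds ⟨by simpa using hτ₂0, by simpa using hρ⟩)),
    fun y _ => P ω (y - y₀), fun u x => G ω (Sum.elim u x), fun x hx' => ⟨?_, ?_, ?_⟩, by simp, ?_⟩
  · rintro y ⟨hyM, hy⟩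
    rw [mem_ball_iff_norm] at hy
    refine ⟨⟨mem_biUnion hx'.1 hyM, ?_, ?_⟩, hyM⟩
    · exact ((hPn ω _).trans_lt hy).trans_le hτ'2
    · have h1 : ‖A ω (y - y₀)‖ ≤ (CA + 1) * ‖y - y₀‖ :=
        ((A ω).le_opNorm _).trans (by gcongr; linarith [hCA ω])
      have h2 := (lt_div_iff₀ (by positivity)).1 (hy.trans_le hτ'ρ)
      linarith
  · have hinvG : ∀ y ∈ U ∩ M x, G ω (Sum.elim (P ω (y - y₀)) x) = y := by
      rintro y ⟨⟨-, hy1, hy2⟩, hyM⟩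
      have h1 := (hzero x hx' _ hy1 _ hy2.le).1 (by rwa [← hsplit])
      rw [hGe ω _ x hy1]
      show y₀ + (E ω (P ω (y - y₀)) + B ω (b ω (Sum.elim (P ω (y - y₀)) (x - x₀ : Euc DX)))) = y
      rw [← h1, ← hsplit]
    refine ⟨?_, ?_, ⟨hinvG, ?_⟩, ?_, ?_⟩
    · rintro y ⟨⟨-, hy, -⟩, -⟩
      simpa using hy
    · intro u hu
      rw [mem_ball_zero_iff] at hu
      have h1 := (hbu ω u (x - x₀) (hu.le.trans (min_le_left _ _)) (hx x hx').2).1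
      have h2 := (hzero x hx' u hu _ h1.le).2 rfl
      have h3 := hGe ω u x hu
      simp only
      rw [h3]
      refine ⟨⟨mem_biUnion hx'.1 h2, ?_, ?_⟩, h2⟩
      · rwa [hPG]
      · rwa [hAG]
    · intro u hu
      rw [mem_ball_zero_iff] at hu
      simp only
      rw [hGe ω u x hu]
      exact hPG _ _
    · fun_prop
    · exact (hGH.contDiff_fst hβY hβX ω x).contDiffOn
  · intro y _ y' _
    rw [← map_sub, sub_sub_sub_cancel_right]
    exact (hPn ω _).trans (le_mul_of_one_le_left (norm_nonneg _) (le_max_right _ _))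
  · exact (hGL ω _ _ _ fun _ _ _ _ => rfl).mono (le_max_left _ _) subset_rfl subset_rfl

end FromEquations

/-! ### Tangent spaces, reach and closedness from charts. -/

section Tangent

variable {d D : ℕ} {M : Set (Euc D)}

theorem range_le_tangentSpaceAt {G : Euc d → Euc D} {A : Euc d →L[ℝ] Euc D} {z : Euc d}
    (hG : ContDiffAt ℝ 1 G z) (hA : HasFDerivAt G A z) (hM : ∀ᶠ w in 𝓝 z, G w ∈ M) (v : Euc d) :
    A v ∈ tangentSpaceAt M (G z) := by
  have hlin : HasDerivAt (fun t : ℝ => z + t • v) v 0 := by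
    simpa using ((hasDerivAt_id (0 : ℝ)).smul_const v).const_add z
  have h0 : z + (0 : ℝ) • v = z := by simp
  refine Submodule.subset_span ⟨fun t => G (z + t • v), ?_, by simp, ?_, ?_⟩
  · refine ContDiffAt.comp (0 : ℝ) (g := G) (f := fun t : ℝ => z + t • v) (by rwa [h0]) ?_
    fun_prop
  · have h1 : Filter.Tendsto (fun t : ℝ => z + t • v) (𝓝 0) (𝓝 z) := by
      simpa [ContinuousAt] using hlin.continuousAt
    exact h1.eventually hM
  · exact ((show HasFDerivAt G A (z + (0 : ℝ) • v) by rwa [h0]).comp_hasDerivAt (0 : ℝ)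
      hlin).deriv

/-- For a curve `c` on `M` the bound on `Q` gives `Q(c t) = O(t)`, so `c'(0)` is the limit of `A(t⁻¹
Q(c t))` and lies in the closed range of `A`. No differentiability of `Q` is needed. -/
theorem tangentSpaceAt_eq_range {G : Euc d → Euc D} {Q : Euc D → Euc d} {A : Euc d →L[ℝ] Euc D}
    {q : Euc D} {L : ℝ} (hG : ContDiffAt ℝ 1 G 0) (hA : HasFDerivAt G A 0) (hG0 : G 0 = q)
    (hM : ∀ᶠ w in 𝓝 0, G w ∈ M) (hQ : ∀ᶠ y in 𝓝[M] q, G (Q y) = y ∧ ‖Q y‖ ≤ L * ‖y - q‖) :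
    tangentSpaceAt M q = A.range := by
  refine le_antisymm (Submodule.span_le.2 ?_) ?_
  · rintro v ⟨c, hc, hc0, hcM, rfl⟩
    have hd : HasDerivAt c (deriv c 0) 0 := (hc.differentiableAt one_ne_zero).hasDerivAt
    have hcq : Filter.Tendsto c (𝓝 0) (𝓝[M] q) :=
      tendsto_nhdsWithin_iff.2 ⟨by simpa [ContinuousAt, hc0] using hd.continuousAt, hcM⟩
    have hQc := hcq.eventually hQ
    have hO : (fun t => c t - q) =O[𝓝 0] fun t : ℝ => t := by
      simpa [hc0] using hd.isBigO_sub
    have hQO : (fun t => Q (c t)) =O[𝓝 0] fun t : ℝ => t :=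
      (Asymptotics.IsBigO.of_bound L (by filter_upwards [hQc] with t ht using ht.2)).trans hO
    have hQ0 : Filter.Tendsto (fun t => Q (c t)) (𝓝 0) (𝓝 0) :=
      hQO.trans_tendsto Filter.tendsto_id
    have ho : (fun t => c t - q - A (Q (c t))) =o[𝓝 0] fun t : ℝ => t := by
      refine Asymptotics.IsLittleO.congr' ?_ ?_ Filter.EventuallyEq.rfl
        (f₁ := fun t => G (Q (c t)) - G 0 - A (Q (c t) - 0))
      · refine (hA.isLittleO.comp_tendsto hQ0).trans_isBigO (hQO.congr_left fun t => ?_)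
        exact (sub_zero _).symm
      · filter_upwards [hQc] with t ht
        rw [ht.1, hG0, sub_zero]
    have h1 := (hasDerivAt_iff_tendsto_slope_zero.1 hd).sub
      (ho.tendsto_inv_smul_nhds_zero.mono_left (nhdsWithin_le_nhds (s := {(0 : ℝ)}ᶜ)))
    rw [sub_zero] at h1
    have hcl : IsClosed (A.range : Set (Euc D)) := Submodule.closed_of_finiteDimensional _
    refine hcl.mem_of_tendsto h1 (Filter.Eventually.of_forall fun t => ?_)
    refine ⟨t⁻¹ • Q (c t), ?_⟩
    simp [hc0, smul_sub]
  · rintro _ ⟨v, rfl⟩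
    rw [← hG0]
    exact range_le_tangentSpaceAt hG hA hM v

theorem norm_le_of_antilipschitz {G : Euc d → Euc D} {A : Euc d →L[ℝ] Euc D} {L : ℝ}
    (hA : HasFDerivAt G A 0) (h : ∀ᶠ z in 𝓝 0, ‖z‖ ≤ L * ‖G z - G 0‖) (u : Euc d) :
    ‖u‖ ≤ L * ‖A u‖ := by
  have hlin : HasDerivAt (fun t : ℝ => t • u) u 0 := by
    simpa using (hasDerivAt_id (0 : ℝ)).smul_const u
  have h1 : HasDerivAt (fun t : ℝ => G (t • u)) (A u) 0 :=
    (show HasFDerivAt G A ((0 : ℝ) • u) by rwa [zero_smul]).comp_hasDerivAt (0 : ℝ) hlin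
  have h2 := (hasDerivAt_iff_tendsto_slope_zero.1 h1).norm.const_mul L
  have h3 : Filter.Tendsto (fun t : ℝ => t • u) (𝓝 0) (𝓝 0) := by
    simpa [ContinuousAt] using hlin.continuousAt
  refine ge_of_tendsto h2 ?_
  filter_upwards [(h3.eventually h).filter_mono nhdsWithin_le_nhds, self_mem_nhdsWithin]
    with t ht ht0
  have ht' : 0 < |t| := abs_pos.2 ht0
  rw [norm_smul, Real.norm_eq_abs] at ht
  rw [zero_add, zero_smul, norm_smul, norm_inv, Real.norm_eq_abs, ← mul_assoc, mul_comm L,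
    mul_assoc, le_inv_mul_iff₀ ht']
  exact ht

theorem inner_eq_zero_of_mem_tangentSpaceAt {p q v : Euc D}
    (h : ∀ y ∈ M, dist p q ≤ dist p y) (hv : v ∈ tangentSpaceAt M q) :
    inner ℝ (p - q) v = 0 := by
  induction hv using Submodule.span_induction with
  | mem v hv =>
    obtain ⟨c, hc, hc0, hcM, rfl⟩ := hv
    have hd : HasDerivAt c (deriv c 0) 0 := (hc.differentiableAt one_ne_zero).hasDerivAt
    have h1 : HasDerivAt (fun t => ‖p - c t‖ ^ 2) (2 * inner ℝ (p - c 0) (-deriv c 0)) 0 :=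
      (hd.const_sub p).norm_sq
    have h2 : IsLocalMin (fun t => ‖p - c t‖ ^ 2) 0 := by
      filter_upwards [hcM] with t ht
      have := h _ ht
      rw [dist_eq_norm, dist_eq_norm] at this
      simp only [hc0]
      gcongr
    have h3 := h2.hasDerivAt_eq_zero h1
    rw [hc0, inner_neg_right] at h3
    linarith
  | zero => simp
  | add v w _ _ hv hw => rw [inner_add_right, hv, hw, add_zero]
  | smul r v _ hv => rw [inner_smul_right, hv, mul_zero]

/-- If `q` and `y` are both nearest to `p`, then `‖y - q‖² = 2⟨p - q, y - q⟩`. As `p - q` is normal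
at `q`, only the quadratic deviation of `y - q` from the tangent space counts, so the right side is
at most `2εCL²‖y - q‖²`, and `y = q`. -/
theorem le_reach_of_taylor {τ C L : ℝ} (hC : 0 ≤ C) (hcl : IsClosed M)
    (h : ∀ q ∈ M, ∃ A : Euc d →L[ℝ] Euc D, (∀ u, A u ∈ tangentSpaceAt M q) ∧
      ∀ y ∈ M, ‖y - q‖ < τ → ∃ z, ‖y - q - A z‖ ≤ C * ‖z‖ ^ 2 ∧ ‖z‖ ≤ L * ‖y - q‖)
    {ε : ℝ} (hε : 2 * ε ≤ τ) (hε' : 2 * ε * (C * L ^ 2) < 1) : ENNReal.ofReal ε ≤ reach M := by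
  refine le_sSup fun p hp => ?_
  have hne : M.Nonempty := by
    by_contra hne
    rw [not_nonempty_iff_eq_empty] at hne
    simp [hne] at hp
  obtain ⟨q, hq, hpq⟩ := hcl.exists_infDist_eq_dist hne p
  have hed : infEDist p M = edist p q := by
    rw [edist_dist, ← hpq, infDist, ENNReal.ofReal_toReal (infEDist_ne_top hne)]
  have hmin : ∀ q', infEDist p M = edist p q' → ∀ y ∈ M, dist p q' ≤ dist p y := fun q' hq' y hy => by
    have := infEDist_le_edist_of_mem (x := p) hy
    rw [hq', edist_dist, edist_dist] at this
    exact (ENNReal.ofReal_le_ofReal_iff dist_nonneg).1 this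
  have hlt : ∀ q', infEDist p M = edist p q' → ‖p - q'‖ < ε := fun q' hq' => by
    rw [hq', edist_dist] at hp
    rw [← dist_eq_norm]
    exact (ENNReal.ofReal_lt_ofReal_iff_of_nonneg dist_nonneg).1 hp
  refine ⟨q, ⟨hq, hed⟩, fun y ⟨hy, hey⟩ => ?_⟩
  have hd : ‖p - y‖ = ‖p - q‖ := by
    rw [← dist_eq_norm, ← dist_eq_norm]
    exact le_antisymm (hmin y hey q hq) (hmin q hed y hy)
  have hyq : ‖y - q‖ < τ := by
    have : y - q = (p - q) - (p - y) := by abel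
    rw [this]
    linarith [norm_sub_le (p - q) (p - y), hlt q hed, hlt y hey]
  obtain ⟨A, hA, hAy⟩ := h q hq
  obtain ⟨z, hz, hzL⟩ := hAy y hy hyq
  have horth := inner_eq_zero_of_mem_tangentSpaceAt (hmin q hed) (hA z)
  have h1 : ‖p - y‖ ^ 2 = ‖p - q‖ ^ 2 - 2 * inner ℝ (p - q) (y - q) + ‖y - q‖ ^ 2 := by
    rw [← norm_sub_sq_real]
    congr 2
    abel
  have h2 : inner ℝ (p - q) (y - q) = inner ℝ (p - q) (y - q - A z) := by
    rw [inner_sub_right _ _ (A z), horth, sub_zero]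
  have h3 : ‖y - q‖ ^ 2 ≤ 2 * ε * (C * L ^ 2) * ‖y - q‖ ^ 2 := by
    calc ‖y - q‖ ^ 2 = 2 * inner ℝ (p - q) (y - q - A z) := by
          rw [hd, h2] at h1
          linarith
      _ ≤ 2 * (‖p - q‖ * ‖y - q - A z‖) := by gcongr; exact real_inner_le_norm _ _
      _ ≤ 2 * (ε * (C * (L * ‖y - q‖) ^ 2)) := by
          gcongr
          · exact (norm_nonneg _).trans (hlt q hed).le
          · exact (hlt q hed).le
          · exact hz.trans (by gcongr)
      _ = _ := by ring
  by_contra hne'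
  have h4 : 0 < ‖y - q‖ ^ 2 := by
    have := norm_pos_iff.2 (sub_ne_zero.2 hne')
    positivity
  nlinarith

/-- Near a limit point, `M` is contained in the image of a compact half-size ball under one chart;
that image is closed and lies in `M`. -/
theorem isClosed_of_uniform_charts {τ τ₁ L : ℝ} (hτ : 0 < τ) (hτ₁ : 0 < τ₁) (hL : 0 < L)
    (h : ∀ q ∈ M, ∃ (Q : Euc D → Euc d) (G : Euc d → Euc D), ContinuousOn G (ball 0 τ₁) ∧
      MapsTo G (ball 0 τ₁) M ∧ ∀ y ∈ M, ‖y - q‖ < τ → G (Q y) = y ∧ ‖Q y‖ ≤ L * ‖y - q‖) :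
    IsClosed M := by
  refine isClosed_of_closure_subset fun y hy => ?_
  set δ := min (τ / 2) (τ₁ / (4 * L)) with hδ
  have hδ0 : 0 < δ := by positivity
  obtain ⟨q, hq, hyq⟩ := Metric.mem_closure_iff.1 hy δ hδ0
  obtain ⟨Q, G, hGc, hGM, hQ⟩ := h q hq
  have hsub : closedBall (0 : Euc d) (τ₁ / 2) ⊆ ball 0 τ₁ := closedBall_subset_ball (by linarith)
  have hK : IsCompact (G '' closedBall 0 (τ₁ / 2)) :=
    (isCompact_closedBall _ _).image_of_continuousOn (hGc.mono hsub)
  have h1 : ball y δ ∩ M ⊆ G '' closedBall 0 (τ₁ / 2) := by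
    rintro w ⟨hw, hwM⟩
    have h2 : ‖w - q‖ < 2 * δ := by
      rw [← dist_eq_norm]
      linarith [dist_triangle w y q, mem_ball.1 hw]
    have h3 := hQ w hwM (h2.trans_le (by linarith [min_le_left (τ / 2) (τ₁ / (4 * L))]))
    refine ⟨Q w, ?_, h3.1⟩
    rw [mem_closedBall_zero_iff]
    calc ‖Q w‖ ≤ L * ‖w - q‖ := h3.2
      _ ≤ L * (2 * (τ₁ / (4 * L))) := by
          gcongr
          exact h2.le.trans (by gcongr; exact min_le_right _ _)
      _ = τ₁ / 2 := by field_simp; norm_num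
  have h2 : y ∈ closure (ball y δ ∩ M) := isOpen_ball.inter_closure ⟨mem_ball_self hδ0, hy⟩
  obtain ⟨z, hz, hzy⟩ := hK.isClosed.closure_subset_iff.2 h1 h2
  exact hzy ▸ hGM (hsub hz)

/-- `C` is orthogonal projection onto the range followed by the inverse of `A` there. -/
theorem exists_range_splitting {n : ℕ} (A : Euc d →L[ℝ] Euc n) {L : ℝ} (hL : 0 ≤ L)
    (h : ∀ u, ‖u‖ ≤ L * ‖A u‖) {T : Submodule ℝ (Euc n)} (hT : T = A.range) :
    Nonempty (Euc d ≃ₗᵢ[ℝ] T) ∧ ∃ C : Euc n →L[ℝ] Euc d, (∀ u, C (A u) = u) ∧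
      (∀ v, A (C v) = T.orthogonalProjectionOnto v) ∧ ∀ v, ‖C v‖ ≤ L * ‖v‖ := by
  subst hT
  have hinj : Function.Injective (A : Euc d →ₗ[ℝ] Euc n) := by
    refine (injective_iff_map_eq_zero _).2 fun u hu => ?_
    have h1 := h u
    rw [show A u = 0 from hu, norm_zero, mul_zero] at h1
    exact norm_le_zero_iff.1 h1
  have hfr : Module.finrank ℝ A.range = d :=
    (LinearMap.finrank_range_of_inj hinj).trans finrank_euclideanSpace_fin
  set e := LinearEquiv.ofInjective (A : Euc d →ₗ[ℝ] Euc n) hinj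
  have he : ∀ w : A.range, A (e.symm w) = w := fun w =>
    congrArg Subtype.val (e.apply_symm_apply w)
  refine ⟨exists_linearIsometryEquiv hfr, (LinearMap.toContinuousLinearMap
    (e.symm : A.range →ₗ[ℝ] Euc d)).comp A.range.orthogonalProjectionOnto, fun u => ?_,
    fun v => he _, fun v => ?_⟩
  · refine hinj ((he _).trans ?_)
    exact congrArg Subtype.val
      (Submodule.orthogonalProjectionOnto_mem_subspace_eq_self (⟨A u, u, rfl⟩ : A.range))
  · refine (h _).trans ?_
    gcongr
    refine (congrArg norm (he _)).trans_le ?_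
    exact Submodule.norm_orthogonalProjectionOnto_apply_le _ v

end Tangent

/-! ### From charts to tangential graphs. -/

section FromCharts

theorem AnisoHolder.comp_fst {d m n : ℕ} {α β : ℝ} {Ω : Type*} {E : Type*}
    [NormedAddCommGroup E] [NormedSpace ℝ E] (hα : 1 ≤ α) (hβ : 0 < β) (hβα : β ≤ α)
    {g : Ω → (Fin m ⊕ Fin n → ℝ) → E} (hg : AnisoHolder (holderWeight α β m n) 1 g)
    {h : Ω → (Fin d ⊕ Fin n → ℝ) → Euc m} (hh : AnisoHolder (holderWeight α β d n) 1 h) :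
    AnisoHolder (holderWeight α β d n) 1
      (fun ω p => g ω (Sum.elim (h ω p) (toEuc Sum.inr p : Euc n))) := by
  have hα0 : 0 < α := by linarith
  have ha := holderWeight_pos (d₁ := d) (d₂ := n) hα0 hβ
  have h0 : 0 < 1 / α := by positivity
  have ha₁ : ∀ k, 1 / α ≤ holderWeight α β d n k := by
    rintro (k | k)
    · exact le_rfl
    · exact one_div_le_one_div_of_le hβ hβα
  have ha' : ∀ l, 0 < (Sum.elim (holderWeight α β d n) fun _ : Fin m => 1 / α) l := by
    rintro (l | l)
    · exact ha l
    · exact h0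
  have hh' := hh.clm ha one_pos (EuclideanSpace.equiv (Fin m) ℝ : Euc m →L[ℝ] (Fin m → ℝ))
  have h1 := AnisoMap.graph ha ha₁ one_pos hh' (fun k => by
    obtain ⟨C, -, hC⟩ := hh'.holder ha k (θ := min 1 (1 / holderWeight α β d n k))
      (lt_min one_pos (one_div_pos.2 (ha k))) (min_le_left _ _)
      ((le_div_iff₀ (ha k)).1 (min_le_right _ _))
    exact ⟨C, fun i p t _ => hC i p t⟩) ((div_le_one hα0).2 hα) le_rfl
  have h2 := hg.substitution ha' hα0 hβ (σ := fun i => Sum.inl (Sum.inr i))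
    (A := fun _ => toEuc fun i : Fin m => Sum.inr i) (by
      rintro (l | l)
      · exact ha₁ l
      · exact le_rfl) (fun i => rfl) ⟨_, fun _ => le_rfl⟩ (fun _ => 0) fun _ => 0
  have h3 := AnisoHolder.comp ha ha' one_pos h2 h1
  simp only [WithLp.ofLp_zero, zero_add] at h3
  exact h3

variable {DX DY d : ℕ} {βY βX : ℝ} {MX : Set (Euc DX)} {M : Euc DX → Set (Euc DY)}

theorem HasSmoothCharts.smoothFamily (hβX : 0 < βX) (hβY : 2 ≤ βY) (hβ : βX ≤ βY)
    (hM : ∀ x ∈ MX, IsSubmanifold d (M x)) {τ τ₁ L : ℝ} (hτ : 0 < τ) (hτ₁ : 0 < τ₁) (hL : 0 < L)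
    (h : HasSmoothCharts βY βX τ τ₁ L d MX M) :
    ∃ τ > 0, ∃ τ₁ > 0, ∃ L > 0, SmoothFamily βY βX τ τ₁ L d MX M := by
  have hβY0 : 0 < βY := by linarith
  have hinv : 1 / βY ≤ 1 / βX := one_div_le_one_div_of_le hβX hβ
  set Ω := {ω : Euc DX × Euc DY // ω.1 ∈ MX ∧ ω.2 ∈ M ω.1}
  choose U hUt hUn Q G hQG hQ0 hGH using fun ω : Ω => h ω.1.1 ω.2.1 ω.1.2 ω.2.2
  obtain ⟨g, hg, hgG⟩ := exists_extension_of_holderClassOn hβY0 hβX (Ω := Ω)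
    (U₁ := fun _ => ball 0 τ₁) (U₂ := fun ω => MX ∩ ball ω.1.1 τ) (f := G) hGH
  have hself : ∀ ω : Ω, ω.1.1 ∈ MX ∩ ball ω.1.1 τ := fun ω => ⟨ω.2.1, mem_ball_self hτ⟩
  have hmem : ∀ (ω : Ω), ∀ x ∈ MX ∩ ball ω.1.1 τ, ∀ z ∈ ball (0 : Euc d) τ₁,
      g ω (Sum.elim z x) ∈ U ω ∩ M x := fun ω x hx z hz => by
    rw [hgG ω z hz x hx]
    exact (hQG ω x hx).2.1.mapsTo_inv hz
  have hQg : ∀ (ω : Ω), ∀ x ∈ MX ∩ ball ω.1.1 τ, ∀ z ∈ ball (0 : Euc d) τ₁,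
      Q ω (g ω (Sum.elim z x)) x = z := fun ω x hx z hz => by
    rw [hgG ω z hz x hx]
    exact (hQG ω x hx).2.1.invOn.2 hz
  have hgQ : ∀ (ω : Ω), ∀ x ∈ MX ∩ ball ω.1.1 τ, ∀ y ∈ U ω ∩ M x,
      Q ω y x ∈ ball 0 τ₁ ∧ g ω (Sum.elim (Q ω y x) x) = y := fun ω x hx y hy => by
    have h1 := (hQG ω x hx).2.1.mapsTo hy
    refine ⟨h1, ?_⟩
    rw [hgG ω _ h1 x hx]
    exact (hQG ω x hx).2.1.invOn.1 hy
  have hloc : ∀ (ω : Ω), ∀ x ∈ MX ∩ ball ω.1.1 τ, ∀ y ∈ M x, ‖y - ω.1.2‖ < τ →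
      y ∈ U ω ∩ M x := fun ω x hx y hy hyτ =>
    (hQG ω x hx).1 ⟨hy, mem_ball_iff_norm.2 hyτ⟩
  have hbase : ∀ ω : Ω, ω.1.2 ∈ U ω ∩ M ω.1.1 := fun ω =>
    hloc ω _ (hself ω) _ ω.2.2 (by simpa using hτ)
  have hg0 : ∀ ω : Ω, g ω (Sum.elim (0 : Euc d) ω.1.1) = ω.1.2 := fun ω => by
    have := (hgQ ω _ (hself ω) _ (hbase ω)).2
    rwa [hQ0] at this
  have hlip0 : ∀ ω : Ω, ∀ y ∈ U ω ∩ M ω.1.1, ‖Q ω y ω.1.1‖ ≤ L * ‖y - ω.1.2‖ := fun ω y hy => by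
    have := (hQG ω _ (hself ω)).2.2 y hy _ (hbase ω)
    rwa [hQ0, sub_zero] at this
  set A : Ω → Euc d →L[ℝ] Euc DY :=
    fun ω => derivFst g ω (Sum.elim (0 : Euc d) ω.1.1) with hA
  have hAd : ∀ ω, HasFDerivAt (fun z : Euc d => g ω (Sum.elim z ω.1.1)) (A ω) 0 := fun ω =>
    hg.hasFDerivAt_fst hβY hβX ω 0 ω.1.1
  -- The Lipschitz bound on `Q` is a lower bound on increments of `G`, and passes to the
  -- differential.
  have hAL : ∀ ω u, ‖u‖ ≤ L * ‖A ω u‖ := fun ω => norm_le_of_antilipschitz (hAd ω) <| by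
    filter_upwards [ball_mem_nhds (0 : Euc d) hτ₁] with z hz
    have := hlip0 ω _ (hmem ω _ (hself ω) z hz)
    rwa [hQg ω _ (hself ω) z hz, ← hg0 ω] at this
  have hT : ∀ ω : Ω, tangentSpaceAt (M ω.1.1) ω.1.2 = (A ω).range := fun ω =>
    tangentSpaceAt_eq_range (Q := fun y => Q ω y ω.1.1) (L := L)
      (hg.contDiff_fst hβY hβX ω ω.1.1).contDiffAt (hAd ω) (hg0 ω)
      (by filter_upwards [ball_mem_nhds (0 : Euc d) hτ₁] with z hz
          exact (hmem ω _ (hself ω) z hz).2)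
      (by filter_upwards [self_mem_nhdsWithin,
            mem_nhdsWithin_of_mem_nhds (ball_mem_nhds ω.1.2 hτ)] with y hy hyτ
          have h1 := hloc ω _ (hself ω) y hy (mem_ball_iff_norm.1 hyτ)
          exact ⟨(hgQ ω _ (hself ω) y h1).2, hlip0 ω y h1⟩)
  have hclosed : ∀ x ∈ MX, IsClosed (M x) := fun x hx =>
    isClosed_of_uniform_charts hτ hτ₁ hL fun q hq => by
      let ω : Ω := ⟨(x, q), hx, hq⟩
      refine ⟨fun y => Q ω y x, fun z => g ω (Sum.elim z x),
        (hg.contDiff_fst hβY hβX ω x).continuous.continuousOn,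
        fun z hz => (hmem ω x (hself ω) z hz).2, fun y hy hyτ => ?_⟩
      have h1 := hloc ω _ (hself ω) y hy hyτ
      exact ⟨(hgQ ω _ (hself ω) y h1).2, hlip0 ω y h1⟩
  obtain ⟨ε, hε, hreach⟩ : ∃ ε > 0, ∀ x ∈ MX, ENNReal.ofReal ε ≤ reach (M x) := by
    obtain ⟨K, hK0, hK⟩ := hg.taylor_fst hβY hβX
    refine ⟨min (τ / 2) (1 / (4 * (K * L ^ 2 + 1))), by positivity, fun x hx =>
      le_reach_of_taylor (τ := τ) (C := K) (L := L) (d := d) hK0 (hclosed x hx) (fun q hq => ?_)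
        (by linarith [min_le_left (τ / 2) (1 / (4 * (K * L ^ 2 + 1)))]) ?_⟩
    · let ω : Ω := ⟨(x, q), hx, hq⟩
      refine ⟨A ω, fun u => ?_, fun y hy hyτ => ⟨Q ω y x, ?_, ?_⟩⟩
      · show A ω u ∈ tangentSpaceAt (M ω.1.1) ω.1.2
        rw [hT]
        exact ⟨u, rfl⟩
      · have h1 := hK ω 0 (Q ω y x) x
        have h2 := hloc ω _ (hself ω) y hy hyτ
        have h3 : g ω (Sum.elim (0 : Euc d) x) = q := hg0 ω
        rw [(hgQ ω x (hself ω) y h2).2, h3, sub_zero] at h1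
        exact h1
      · exact hlip0 ω y (hloc ω _ (hself ω) y hy hyτ)
    · have h1 : 0 ≤ K * L ^ 2 := by positivity
      calc 2 * min (τ / 2) (1 / (4 * (K * L ^ 2 + 1))) * (K * L ^ 2)
          ≤ 2 * (1 / (4 * (K * L ^ 2 + 1))) * (K * L ^ 2 + 1) := by
            gcongr
            · exact min_le_right _ _
            · linarith
        _ = 1 / 2 := by field_simp; norm_num
        _ < 1 := by norm_num
  choose hne C hCA hAC hCn using fun ω => exists_range_splitting (A ω) hL.le (hAL ω) (hT ω)
  set e := fun ω => (hne ω).some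
  have hCop : ∀ ω, ‖C ω‖ ≤ L := fun ω => (C ω).opNorm_le_bound hL.le (hCn ω)
  -- Because `AC` is the projection and `CA = 1`, `C` records exactly the tangential part. It turns
  -- an equation in the varying tangent space into one in a fixed `ℝᵈ`.
  have hPe : ∀ ω v u, C ω v = C ω (e ω u) ↔
      (tangentSpaceAt (M ω.1.1) ω.1.2).orthogonalProjectionOnto v = e ω u := fun ω v u => by
    have h1 : (tangentSpaceAt (M ω.1.1) ω.1.2).orthogonalProjectionOnto (e ω u : Euc DY) = e ω u :=
      Submodule.orthogonalProjectionOnto_mem_subspace_eq_self _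
    constructor
    · intro h
      have h2 := congrArg (A ω) h
      rw [hAC, hAC, h1] at h2
      exact Subtype.ext h2
    · intro h
      rw [← hCA ω (C ω v), hAC, h]
  set Ce : ∀ ω, Euc d →L[ℝ] Euc d := fun ω =>
    (C ω).comp ((tangentSpaceAt (M ω.1.1) ω.1.2).subtypeL.comp
      ((e ω).toContinuousLinearEquiv : Euc d →L[ℝ] _)) with hCe
  have hCeop : ∀ ω, ‖Ce ω‖ ≤ L := fun ω => (Ce ω).opNorm_le_bound hL.le fun u => by
    refine (hCn ω _).trans_eq ?_
    congr 1
    exact (e ω).norm_map u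
  set a' := (Sum.elim (holderWeight βY βX d DX) fun _ : Fin d => 1 / βY)
  have ha := holderWeight_pos (d₁ := d) (d₂ := DX) hβY0 hβX
  have ha' : ∀ l, 0 < a' l := by
    rintro (l | l)
    · exact ha l
    · exact one_div_pos.2 hβY0
  obtain ⟨Cg, hCg0, hCg⟩ := hg.bound
  -- Zeros are the `w` for which the tangential part of `G(w, x₀ + x) - y₀` is `e u`. The
  -- `w`-differential at the origin is `CA = 1`; clipping `u` only keeps the family bounded.
  set Φ : Ω → ((Fin d ⊕ Fin DX) ⊕ Fin d → ℝ) → Euc d := fun ω z =>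
    C ω (g ω (Sum.elim (0 + toEuc (fun i => Sum.inr i) z : Euc d)
      (ω.1.1 + toEuc (fun i => Sum.inl (Sum.inr i)) z : Euc DX)) - ω.1.2)
      - Ce ω (clipEuc 1 (fun i => Sum.inl (Sum.inl i)) z) with hΦdef
  have hΦ : AnisoHolder a' 1 Φ := by
    refine AnisoHolder.sub ha' one_pos (AnisoHolder.clm_family ha' one_pos
      (AnisoHolder.sub ha' one_pos ?_ (AnisoHolder.const ha' one_pos ⟨Cg, fun ω => ?_⟩)) ⟨L, hCop⟩)
      (AnisoHolder.clm_family ha' one_pos (AnisoHolder.clipEuc ha' one_pos one_pos _) ⟨L, hCeop⟩)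
    · refine hg.substitution ha' hβY0 hβX ?_ (fun i => rfl) ⟨_, fun ω => le_rfl⟩ _ _
      rintro ((l | l) | l)
      exacts [le_rfl, hinv, le_rfl]
    · rw [← hg0 ω]
      exact hCg _ _
  have hΦe : ∀ ω (u : Euc d) (x : Euc DX) (w : Euc d), ‖u‖ ≤ 1 →
      Φ ω (Sum.elim (Sum.elim u x) w)
        = C ω (g ω (Sum.elim w (ω.1.1 + x : Euc DX)) - ω.1.2) - C ω (e ω u) :=
    fun ω u x w hu => by
    have h1 : clipEuc 1 (fun i => Sum.inl (Sum.inl i))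
        (Sum.elim (Sum.elim u x) w : (Fin d ⊕ Fin DX) ⊕ Fin d → ℝ) = u :=
      clipEuc_eq one_pos (fun i => rfl) hu
    simp only [hΦdef, h1, zero_add]
    rfl
  obtain ⟨ρ, σ, hρ, hρR, hσ, b, hb, hb0, hbu⟩ := hΦ.implicitFunction_euc hβY hβX hβ
    (fun ω => by
      have h1 := hΦe ω 0 0 0 (by simp)
      rw [add_zero, hg0, sub_self, map_zero, map_zero] at h1
      simpa using! h1)
    (fun ω => by
      have h2 := ((C ω).hasFDerivAt.comp (0 : Euc d) ((hAd ω).sub_const ω.1.2))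
      rw [show (C ω).comp (A ω) = ContinuousLinearMap.id ℝ _ from
        ContinuousLinearMap.ext (hCA ω)] at h2
      refine h2.congr_of_eventuallyEq (Filter.Eventually.of_forall fun w => ?_)
      have := hΦe ω 0 0 w (by simp)
      rw [add_zero, map_zero, Submodule.coe_zero, map_zero, sub_zero] at this
      simpa using! this)
    (R := τ₁ / 2) (by positivity)
  -- Points within `r` of `y₀` will satisfy `‖Q y x‖ ≤ L · 2r ≤ ρ`, so uniqueness of the implicit
  -- solution applies to them.
  set r := min τ (ρ / (2 * L)) with hr
  have hr0 : 0 < r := by positivity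
  -- `δ'` keeps `b` within `δ`, and `δ` keeps `g` within `r/2` of `y₀`, so the parametrized points
  -- lie in the neighbourhood.
  obtain ⟨δ, hδ, hgδ⟩ := hg.equicontinuous ha one_pos (half_pos hr0)
  obtain ⟨δ', hδ', hbδ⟩ := hb.equicontinuous ha one_pos hδ
  set κ := min (min τ σ) (min (min δ δ') 1) with hκ
  have hκ0 : 0 < κ := by positivity
  have hκτ : κ ≤ τ := (min_le_left _ _).trans (min_le_left _ _)
  have hκσ : κ ≤ σ := (min_le_left _ _).trans (min_le_right _ _)
  have hκδ : κ ≤ δ := (min_le_right _ _).trans ((min_le_left _ _).trans (min_le_left _ _))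
  have hκδ' : κ ≤ δ' := (min_le_right _ _).trans ((min_le_left _ _).trans (min_le_right _ _))
  have hκ1 : κ ≤ 1 := (min_le_right _ _).trans (min_le_right _ _)
  set φ : Ω → (Fin d ⊕ Fin DX → ℝ) → Euc DY := fun ω p => g ω (Sum.elim
    (b ω (Sum.elim (0 + toEuc Sum.inl p : Euc d) (-ω.1.1 + toEuc Sum.inr p : Euc DX)))
    (toEuc Sum.inr p : Euc DX)) with hφdef
  have hφ : AnisoHolder (holderWeight βY βX d DX) 1 φ := by
    refine hg.comp_fst (by linarith) hβX hβ (hb.substitution ha hβY0 hβX ?_ (fun i => rfl)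
      ⟨_, fun ω => le_rfl⟩ _ _)
    rintro (l | l)
    exacts [le_rfl, hinv]
  have hφe : ∀ ω (u : Euc d) (x : Euc DX), φ ω (Sum.elim u x)
      = g ω (Sum.elim (b ω (Sum.elim u (x - ω.1.1 : Euc DX))) x) := fun ω u x => by
    have h2 : (toEuc Sum.inl (Sum.elim u x : Fin d ⊕ Fin DX → ℝ) : Euc d) = u := rfl
    have h3 : (toEuc Sum.inr (Sum.elim u x : Fin d ⊕ Fin DX → ℝ) : Euc DX) = x := rfl
    simp only [hφdef, h2, h3, zero_add, neg_add_eq_sub]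
  obtain ⟨L', hL', hφL⟩ := exists_holderClassOn hβY0 hβX hφ
  -- The halving of `ε` makes the bound on the reach strict.
  refine ⟨min κ (ε / 2), by positivity, κ, hκ0, L', hL', hM, hclosed, fun x hx => ?_,
    fun x₀ hx₀ y₀ hy₀ => ?_⟩
  · refine lt_of_lt_of_le ?_ (hreach x hx)
    rw [ENNReal.ofReal_lt_ofReal_iff hε]
    linarith [min_le_right κ (ε / 2)]
  set ω : Ω := ⟨(x₀, y₀), hx₀, hy₀⟩ with hω
  set P : Euc DY →L[ℝ] tangentSpaceAt (M x₀) y₀ :=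
    (tangentSpaceAt (M x₀) y₀).orthogonalProjectionOnto with hP
  have hopen : IsOpen {y | ‖y - y₀‖ < r ∧ ‖P (y - y₀)‖ < κ} :=
    (isOpen_lt (f := fun y => ‖y - y₀‖) (by fun_prop) continuous_const).inter
      (isOpen_lt (f := fun y => ‖P (y - y₀)‖) (by fun_prop) continuous_const)
  have hx : ∀ x ∈ MX ∩ ball x₀ (min κ (ε / 2)), x ∈ MX ∩ ball ω.1.1 τ ∧ ‖x - x₀‖ ≤ κ :=
    fun x hx => by
      have h1 := mem_ball_iff_norm.1 (ball_subset_ball (min_le_left κ (ε / 2)) hx.2)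
      exact ⟨⟨hx.1, mem_ball_iff_norm.2 (h1.trans_le hκτ)⟩, h1.le⟩
  have hsol : ∀ x ∈ MX ∩ ball x₀ (min κ (ε / 2)), ∀ u : Euc d, ‖u‖ ≤ κ → ∀ w : Euc d, ‖w‖ ≤ ρ →
      (P (g ω (Sum.elim w x) - y₀) = e ω u ↔ w = b ω (Sum.elim u (x - x₀ : Euc DX))) :=
    fun x hx' u hu w hw => by
      have h1 := (hbu ω u (x - x₀) (hu.trans hκσ) ((hx x hx').2.trans hκσ)).2 w hw
      have h2 : ω.1.1 + (x - x₀) = x := add_sub_cancel _ _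
      rw [← h1, hΦe ω _ _ _ (hu.trans hκ1), h2, sub_eq_zero, hPe]
  have hbρ : ∀ x ∈ MX ∩ ball x₀ (min κ (ε / 2)), ∀ u : Euc d, ‖u‖ ≤ κ →
      ‖b ω (Sum.elim u (x - x₀ : Euc DX))‖ < ρ := fun x hx' u hu =>
    (hbu ω u (x - x₀) (hu.trans hκσ) ((hx x hx').2.trans hκσ)).1
  refine ⟨totalY MX M ∩ {y | ‖y - y₀‖ < r ∧ ‖P (y - y₀)‖ < κ}, inter_subset_left,
    Filter.inter_mem self_mem_nhdsWithin (mem_nhdsWithin_of_mem_nhds (hopen.mem_nhds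
      ⟨by simpa using hr0, by simpa using hκ0⟩)), fun v x => φ ω (Sum.elim ((e ω).symm v) x),
    fun x hx' => ⟨?_, ?_, ⟨?_, ?_⟩, ?_, ?_⟩, e ω, ?_⟩
  · rintro y ⟨⟨-, -, hy⟩, -⟩
    simpa using hy
  · intro v hv
    rw [mem_ball_zero_iff] at hv
    have hu : ‖(e ω).symm v‖ < κ := by rwa [LinearIsometryEquiv.norm_map]
    have h1 := hbρ x hx' _ hu.le
    have h2 := (hsol x hx' _ hu.le _ h1.le).2 rfl
    rw [LinearIsometryEquiv.apply_symm_apply] at h2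
    have h3 := (hmem ω x (hx x hx').1 _ (mem_ball_zero_iff.2 (by linarith :
      ‖b ω (Sum.elim ((e ω).symm v) (x - x₀ : Euc DX))‖ < τ₁))).2
    have h4 : φ ω (Sum.elim ((e ω).symm v) x) = _ := hφe ω ((e ω).symm v) x
    simp only
    rw [h4]
    refine ⟨⟨mem_biUnion hx'.1 h3, ?_, ?_⟩, h3⟩
    · have h5 : ‖b ω (Sum.elim ((e ω).symm v) (x - x₀ : Euc DX))‖ ≤ δ := by
        have h6 := hbδ ω 0 (Sum.elim ((e ω).symm v) (x - x₀ : Euc DX)) (by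
          have := norm_elim_sub_le ((e ω).symm v) 0 (x - x₀) 0 (r := δ')
            (by simpa using hu.le.trans hκδ') (by simpa using (hx x hx').2.trans hκδ')
          convert this using 2
          ext (l | l) <;> simp)
        rwa [hb0, sub_zero] at h6
      have h6 := hgδ ω (Sum.elim (0 : Euc d) x₀) _ (norm_elim_sub_le
        (b ω (Sum.elim ((e ω).symm v) (x - x₀ : Euc DX))) 0 x x₀ (r := δ) (by rwa [sub_zero])
        ((hx x hx').2.trans hκδ))
      have h7 : g ω (Sum.elim (0 : Euc d) x₀) = y₀ := hg0 ω
      rw [h7] at h6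
      exact h6.trans_lt (half_lt_self hr0)
    · have h5 : ‖P (g ω (Sum.elim (b ω (Sum.elim ((e ω).symm v) (x - x₀ : Euc DX))) x) - y₀)‖ < κ := by
        rwa [h2]
      exact h5
  · rintro y ⟨⟨-, hy1, hy2⟩, hyM⟩
    have h1 := hloc ω x (hx x hx').1 y hyM (hy1.trans_le (min_le_left _ _))
    obtain ⟨h2, h3⟩ := hgQ ω x (hx x hx').1 y h1
    have hu : ‖(e ω).symm (P (y - y₀))‖ < κ := by rwa [LinearIsometryEquiv.norm_map]
    -- `Q(y₀, x)` need not vanish or make sense for `x ≠ x₀`, so `y` is compared with `g(0, x)`,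
    -- whose chart value is `0`.
    have h4 : ‖Q ω y x‖ ≤ ρ := by
      have h0 : (0 : Euc d) ∈ ball (0 : Euc d) τ₁ := mem_ball_self hτ₁
      have h5 := (hQG ω x (hx x hx').1).2.2 y h1 _ (hmem ω x (hx x hx').1 0 h0)
      rw [hQg ω x (hx x hx').1 0 h0, sub_zero] at h5
      have h6 := hgδ ω (Sum.elim (0 : Euc d) x₀) _ (norm_elim_sub_le 0 0 x x₀ (r := δ)
        (by simpa using hδ.le) ((hx x hx').2.trans hκδ))
      have h7 : g ω (Sum.elim (0 : Euc d) x₀) = y₀ := hg0 ω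
      rw [h7] at h6
      have h8 : ‖y - g ω (Sum.elim (0 : Euc d) x)‖ ≤ 2 * r := by
        have h9 := norm_sub_le (y - y₀) (g ω (Sum.elim (0 : Euc d) x) - y₀)
        rw [sub_sub_sub_cancel_right] at h9
        linarith
      calc ‖Q ω y x‖ ≤ L * (2 * (ρ / (2 * L))) := by
            refine h5.trans ?_
            gcongr
            exact h8.trans (by gcongr; exact min_le_right _ _)
        _ = ρ := by field_simp
    have h5 := (hsol x hx' _ hu.le _ h4).1 (by rw [h3, LinearIsometryEquiv.apply_symm_apply])
    have h6 : φ ω (Sum.elim ((e ω).symm (P (y - y₀))) x) = _ := hφe ω _ x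
    simp only
    refine h6.trans ?_
    rw [← h3]
    congr 2
    rw [h3]
    exact congrArg _ h5.symm
  · intro v hv
    rw [mem_ball_zero_iff] at hv
    have hu : ‖(e ω).symm v‖ < κ := by rwa [LinearIsometryEquiv.norm_map]
    have h1 := hbρ x hx' _ hu.le
    have h2 := (hsol x hx' _ hu.le _ h1.le).2 rfl
    rw [LinearIsometryEquiv.apply_symm_apply] at h2
    have h4 : φ ω (Sum.elim ((e ω).symm v) x) = _ := hφe ω ((e ω).symm v) x
    simp only
    rw [h4]
    exact h2
  · fun_prop
  · exact ((hφ.contDiff_fst hβY hβX ω x).comp (e ω).symm.contDiff).contDiffOn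
  · exact hφL ω _ _ _ fun z _ x _ => by simp

end FromCharts

/-! ### Nearest-point projection and local surjectivity of charts. -/

section NearestPoint

variable {d D : ℕ} {M : Set (Euc D)}

theorem existsUnique_nearest_of_lt_reach {τ : ℝ} (h : ENNReal.ofReal τ < reach M) {p q : Euc D}
    (hq : q ∈ M) (hp : ‖p - q‖ < τ) : ∃! q : Euc D, q ∈ M ∧ infEDist p M = edist p q := by
  obtain ⟨ε, hε, hτε⟩ := lt_sSup_iff.1 h
  refine hε p (lt_of_le_of_lt (infEDist_le_edist_of_mem hq) (lt_of_le_of_lt ?_ hτε))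
  rw [edist_dist, dist_eq_norm]
  exact ENNReal.ofReal_le_ofReal hp.le

/-- Nearest points stay in a compact ball, and any cluster point is again nearest, hence equal to
the unique one. -/
theorem continuous_of_isNearest {X : Type*} [TopologicalSpace X] (hM : IsClosed M)
    {p π : X → Euc D} (hp : Continuous p) (hπ : ∀ x, π x ∈ M)
    (hd : ∀ x, infEDist (p x) M = edist (p x) (π x))
    (hu : ∀ x, ∀ q ∈ M, infEDist (p x) M = edist (p x) q → q = π x) : Continuous π := by
  refine continuous_iff_continuousAt.2 fun x₀ => ?_
  have hdist : ∀ x, dist (p x) (π x) ≤ dist (p x) (π x₀) := fun x => by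
    have := infEDist_le_edist_of_mem (x := p x) (hπ x₀)
    rw [hd, edist_dist, edist_dist] at this
    exact (ENNReal.ofReal_le_ofReal_iff dist_nonneg).1 this
  refine (isCompact_closedBall (p x₀) (dist (p x₀) (π x₀) + 2)).tendsto_nhds_of_unique_mapClusterPt
    ?_ fun y _ hy => ?_
  · filter_upwards [hp.continuousAt (ball_mem_nhds _ one_pos)] with x hx
    rw [mem_preimage, mem_ball] at hx
    rw [mem_closedBall]
    have h1 := dist_triangle (π x) (p x) (p x₀)
    have h2 := dist_triangle (p x) (p x₀) (π x₀)
    linarith [hdist x, dist_comm (π x) (p x)]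
  · obtain ⟨F, hF, hFy⟩ := mapClusterPt_iff_ultrafilter.1 hy
    refine hu x₀ y (hM.mem_of_tendsto hFy (Filter.Eventually.of_forall hπ)) ?_
    have h1 : Filter.Tendsto p F (𝓝 (p x₀)) := hp.continuousAt.tendsto.mono_left hF
    refine tendsto_nhds_unique ((continuous_infEDist.tendsto (p x₀)).comp h1) ?_
    refine (h1.edist hFy).congr fun x => (hd x).symm

/-- `P ∘ (φ - q)` is open at `z₀`, so a point of `M` close to `q` has the same projection as some `φ
z ∈ V`; injectivity of the projection on `V` identifies the two. -/
theorem eventually_exists_eq_of_chart {T : Type*} [NormedAddCommGroup T] [NormedSpace ℝ T]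
    [FiniteDimensional ℝ T] {φ : Euc d → Euc D} {A : Euc d →L[ℝ] Euc D} {z₀ : Euc d} {q : Euc D}
    (hφ : HasStrictFDerivAt φ A z₀) (hq : φ z₀ = q) (hM : ∀ᶠ z in 𝓝 z₀, φ z ∈ M)
    {V : Set (Euc D)} (hV : V ∈ 𝓝[M] q) (P : Euc D →L[ℝ] T)
    (hP : ∀ y ∈ V, ∀ y' ∈ V, P (y - q) = P (y' - q) → y = y')
    (hA : (P.comp A).range = ⊤) {N : Set (Euc d)} (hN : N ∈ 𝓝 z₀) :
    ∀ᶠ y in 𝓝[M] q, ∃ z ∈ N, φ z = y := by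
  have h1 : HasStrictFDerivAt (fun z => P (φ z - q)) (P.comp A) z₀ :=
    P.hasStrictFDerivAt.comp z₀ (hφ.sub_const q)
  have h2 := h1.map_nhds_eq_of_surj hA
  rw [hq, sub_self, map_zero] at h2
  have h3 : Filter.Tendsto φ (𝓝 z₀) (𝓝[M] q) :=
    tendsto_nhdsWithin_iff.2 ⟨hq ▸ hφ.continuousAt, hM⟩
  have h4 : (fun z => P (φ z - q)) '' (N ∩ φ ⁻¹' V) ∈ 𝓝 (0 : T) := by
    rw [← h2]
    exact Filter.image_mem_map (Filter.inter_mem hN (h3 hV))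
  have h5 : Filter.Tendsto (fun y => P (y - q)) (𝓝[M] q) (𝓝 0) := by
    have : ContinuousAt (fun y => P (y - q)) q := by fun_prop
    simpa [ContinuousAt] using this.tendsto.mono_left nhdsWithin_le_nhds
  filter_upwards [h5 h4, hV] with y hy hyV
  obtain ⟨z, ⟨hzN, hzV⟩, hz⟩ := hy
  exact ⟨z, hzN, hP _ hzV _ hyV hz⟩

end NearestPoint

/-! ### Graph descriptions on balls of uniform size. -/

section GraphCharts

variable {DX DY d : ℕ} {βY βX : ℝ} {MX : Set (Euc DX)} {M : Euc DX → Set (Euc DY)}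

/-- The points of the total space of a family. -/
abbrev FamilyPoint (MX : Set (Euc DX)) (M : Euc DX → Set (Euc DY)) : Type :=
  {ω : Euc DX × Euc DY // ω.1 ∈ MX ∧ ω.2 ∈ M ω.1}

/-- Near each `ω = (x₀, y₀)`, uniformly in `ω`, the members of the family are the graphs of
`u ↦ g ω (u, x)` over a `d`-dimensional subspace parametrized by the isometry `E ω`. -/
structure IsGraphFamily (βY βX κ κ₁ : ℝ) (MX : Set (Euc DX)) (M : Euc DX → Set (Euc DY))
    (g : FamilyPoint MX M → (Fin d ⊕ Fin DX → ℝ) → Euc DY)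
    (E : FamilyPoint MX M → Euc d →ₗᵢ[ℝ] Euc DY) : Prop where
  smooth : AnisoHolder (holderWeight βY βX d DX) 1 g
  mem : ∀ ω : FamilyPoint MX M, ∀ x ∈ MX, ‖x - ω.1.1‖ < κ → ∀ u : Euc d, ‖u‖ < κ₁ →
    g ω (Sum.elim u x) ∈ M x
  proj : ∀ ω : FamilyPoint MX M, ∀ x ∈ MX, ‖x - ω.1.1‖ < κ → ∀ u : Euc d, ‖u‖ < κ₁ →
    ContinuousLinearMap.adjoint (E ω).toContinuousLinearMap (g ω (Sum.elim u x) - ω.1.2) = u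
  eq : ∀ ω : FamilyPoint MX M, ∀ x ∈ MX, ‖x - ω.1.1‖ < κ → ∀ y ∈ M x, ‖y - ω.1.2‖ < κ →
    g ω (Sum.elim (ContinuousLinearMap.adjoint (E ω).toContinuousLinearMap (y - ω.1.2)) x) = y

theorem adjoint_subtype_comp {T : Submodule ℝ (Euc DY)} (e : Euc d ≃ₗᵢ[ℝ] T) (v : Euc DY) :
    ContinuousLinearMap.adjoint (T.subtypeₗᵢ.comp e.toLinearIsometry).toContinuousLinearMap v
      = e.symm (T.orthogonalProjectionOnto v) := by
  refine ext_inner_right ℝ fun u => ?_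
  rw [ContinuousLinearMap.adjoint_inner_left, ← e.inner_map_map, e.apply_symm_apply]
  exact (Submodule.inner_orthogonalProjectionOnto_eq_of_mem_right (e u) v).symm

/-- The chart neighbourhoods may shrink with `ω`; the reach bound shows nevertheless that a ball of
fixed radius meets each nearby member only along the graph. -/
theorem SmoothFamily.exists_isGraphFamily (hβX : 0 < βX) (hβY : 2 ≤ βY) {τ τ₁ L : ℝ} (hτ : 0 < τ)
    (hτ₁ : 0 < τ₁) (h : SmoothFamily βY βX τ τ₁ L d MX M) :
    ∃ κ > 0, ∃ κ₁ ≥ κ, ∃ (g : FamilyPoint MX M → (Fin d ⊕ Fin DX → ℝ) → Euc DY)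
      (E : FamilyPoint MX M → Euc d →ₗᵢ[ℝ] Euc DY), IsGraphFamily βY βX κ κ₁ MX M g E := by
  have hβY0 : 0 < βY := by linarith
  have ha := holderWeight_pos (d₁ := d) (d₂ := DX) hβY0 hβX
  choose U hUt hUn φ hφ e hφH using fun ω : FamilyPoint MX M => h.projection ω.1.1 ω.2.1 ω.1.2 ω.2.2
  obtain ⟨g, hg, hgφ⟩ := exists_extension_of_holderClassOn hβY0 hβX (Ω := FamilyPoint MX M)
    (U₁ := fun _ => ball 0 τ₁) (U₂ := fun ω => MX ∩ ball ω.1.1 τ)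
    (f := fun ω z x => φ ω (e ω z) x) hφH
  set E : FamilyPoint MX M → Euc d →ₗᵢ[ℝ] Euc DY := fun ω =>
    (tangentSpaceAt (M ω.1.1) ω.1.2).subtypeₗᵢ.comp (e ω).toLinearIsometry with hE
  set P : FamilyPoint MX M → Euc DY →L[ℝ] Euc d := fun ω =>
    ContinuousLinearMap.adjoint (E ω).toContinuousLinearMap with hP
  have hPe : ∀ ω v, P ω v
      = (e ω).symm ((tangentSpaceAt (M ω.1.1) ω.1.2).orthogonalProjectionOnto v) := fun ω v =>
    adjoint_subtype_comp (e ω) v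
  have hPn : ∀ ω v, ‖P ω v‖ ≤ ‖v‖ := fun ω v => by
    rw [hPe, LinearIsometryEquiv.norm_map]
    exact Submodule.norm_orthogonalProjectionOnto_apply_le _ v
  have hself : ∀ ω : FamilyPoint MX M, ω.1.1 ∈ MX ∩ ball ω.1.1 τ := fun ω =>
    ⟨ω.2.1, mem_ball_self hτ⟩
  have hmem : ∀ (ω : FamilyPoint MX M), ∀ x ∈ MX ∩ ball ω.1.1 τ, ∀ u : Euc d, ‖u‖ < τ₁ →
      g ω (Sum.elim u x) ∈ M x ∧ P ω (g ω (Sum.elim u x) - ω.1.2) = u := fun ω x hx u hu => by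
    rw [hgφ ω u (mem_ball_zero_iff.2 hu) x hx, hPe]
    have h1 : e ω u ∈ ball 0 τ₁ := by rwa [mem_ball_zero_iff, LinearIsometryEquiv.norm_map]
    refine ⟨((hφ ω x hx).mapsTo_inv h1).2, ?_⟩
    rw [LinearIsometryEquiv.symm_apply_eq]
    exact (hφ ω x hx).invOn.2 h1
  have hgP : ∀ (ω : FamilyPoint MX M), ∀ x ∈ MX ∩ ball ω.1.1 τ, ∀ y ∈ U ω ∩ M x,
      g ω (Sum.elim (P ω (y - ω.1.2)) x) = y := fun ω x hx y hy => by
    have h1 := (hφ ω x hx).mapsTo hy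
    rw [hgφ ω _ ?_ x hx, hPe, LinearIsometryEquiv.apply_symm_apply]
    · exact (hφ ω x hx).invOn.1 hy
    · rw [hPe, mem_ball_zero_iff, LinearIsometryEquiv.norm_map]
      exact mem_ball_zero_iff.1 h1
  have hbase : ∀ ω : FamilyPoint MX M, ω.1.2 ∈ totalY MX M := fun ω =>
    mem_biUnion ω.2.1 ω.2.2
  have hg0 : ∀ ω : FamilyPoint MX M, g ω (Sum.elim (0 : Euc d) ω.1.1) = ω.1.2 := fun ω => by
    have := hgP ω _ (hself ω) ω.1.2 ⟨mem_of_mem_nhdsWithin (hbase ω) (hUn ω), ω.2.2⟩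
    rwa [sub_self, map_zero] at this
  -- Being on the graph is an open condition along the member. The chart centred at `(x, q)` itself
  -- controls the member near `q`, and the graph fills a neighbourhood because its tangent
  -- directions project isomorphically onto the tangent space at `q`.
  have hopen : ∀ (ω : FamilyPoint MX M), ∀ x ∈ MX ∩ ball ω.1.1 τ, ∀ q ∈ M x,
      ‖q - ω.1.2‖ < τ₁ → g ω (Sum.elim (P ω (q - ω.1.2)) x) = q →
      ∀ᶠ y in 𝓝[M x] q, g ω (Sum.elim (P ω (y - ω.1.2)) x) = y := fun ω x hx q hq hqτ hgq => by
    set ω' : FamilyPoint MX M := ⟨(x, q), hx.1, hq⟩ with hω'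
    set z₀ := P ω (q - ω.1.2) with hz₀
    have hz₀τ : z₀ ∈ ball (0 : Euc d) τ₁ := mem_ball_zero_iff.2 ((hPn ω _).trans_lt hqτ)
    have hball : ball (0 : Euc d) τ₁ ∈ 𝓝 z₀ := isOpen_ball.mem_nhds hz₀τ
    set A := derivFst g ω (Sum.elim z₀ x)
    have hA : HasFDerivAt (fun z : Euc d => g ω (Sum.elim z x)) A z₀ :=
      hg.hasFDerivAt_fst hβY hβX ω z₀ x
    have hC1 : ContDiffAt ℝ 1 (fun z : Euc d => g ω (Sum.elim z x)) z₀ :=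
      (hg.contDiff_fst hβY hβX ω x).contDiffAt
    have hPA : (P ω).comp A = ContinuousLinearMap.id ℝ _ := by
      refine HasFDerivAt.unique ((P ω).hasFDerivAt.comp z₀ (hA.sub_const ω.1.2)) ?_
      refine (hasFDerivAt_id z₀).congr_of_eventuallyEq ?_
      filter_upwards [hball] with z hz
      exact (hmem ω x hx z (mem_ball_zero_iff.1 hz)).2
    have hAM : ∀ᶠ z : Euc d in 𝓝 z₀, g ω (Sum.elim z x) ∈ M x := by
      filter_upwards [hball] with z hz
      exact (hmem ω x hx z (mem_ball_zero_iff.1 hz)).1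
    have hAT : ∀ u, A u ∈ tangentSpaceAt (M x) q := fun u => by
      have := range_le_tangentSpaceAt hC1 hA hAM u
      rwa [hgq] at this
    have hEA : ∀ u, E ω' (P ω' (A u)) = A u := fun u => by
      have h2 : P ω' (A u) = (e ω').symm ⟨A u, hAT u⟩ := by
        rw [hPe]
        congr 1
        exact Submodule.orthogonalProjectionOnto_mem_subspace_eq_self (⟨A u, hAT u⟩ :
          tangentSpaceAt (M x) q)
      rw [h2]
      show (((e ω') ((e ω').symm ⟨A u, hAT u⟩) : tangentSpaceAt (M ω'.1.1) ω'.1.2) : Euc DY) = A u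
      rw [LinearIsometryEquiv.apply_symm_apply]
    have hinj : Function.Injective ((P ω').comp A : Euc d →ₗ[ℝ] Euc d) := by
      refine (injective_iff_map_eq_zero _).2 fun u hu => ?_
      have h2 : A u = 0 := by
        rw [← hEA u, show P ω' (A u) = 0 from hu, map_zero]
      have h3 := congrArg (fun B => B u) hPA
      simpa [h2] using h3.symm
    have hV : U ω' ∩ M x ∈ 𝓝[M x] q :=
      Filter.inter_mem (nhdsWithin_mono q (fun y hy => mem_biUnion hx.1 hy) (hUn ω'))
        self_mem_nhdsWithin
    have h1 := eventually_exists_eq_of_chart (hC1.hasStrictFDerivAt' hA one_ne_zero) hgq hAM hV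
      (P ω') (fun y hy y' hy' hyy => by
        have h2 := hgP ω' x (hself ω') y hy
        have h3 := hgP ω' x (hself ω') y' hy'
        rw [← h2, ← h3]
        congr 3) (LinearMap.range_eq_top.2 (LinearMap.injective_iff_surjective.1 hinj)) hball
    filter_upwards [h1] with y hy
    obtain ⟨z, hz, rfl⟩ := hy
    rw [(hmem ω x hx z (mem_ball_zero_iff.1 hz)).2]
  -- Below, the segment stays within `2r < τ` of the member and its nearest points within `5r < τ₁`
  -- of `y₀`.
  set r := min τ τ₁ / 8 with hr
  have hr0 : 0 < r := by positivity
  have hrτ : 8 * r ≤ τ := by linarith [min_le_left τ τ₁]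
  have hrτ₁ : 8 * r ≤ τ₁ := by linarith [min_le_right τ τ₁]
  obtain ⟨δ, hδ, hgδ⟩ := hg.equicontinuous ha one_pos hr0
  have hκr : min δ r ≤ r := min_le_right _ _
  have hκ : ∀ (ω : FamilyPoint MX M), ∀ x ∈ MX, ‖x - ω.1.1‖ < min δ r →
      x ∈ MX ∩ ball ω.1.1 τ := fun ω x hx hxκ =>
    ⟨hx, mem_ball_iff_norm.2 (by linarith)⟩
  refine ⟨min δ r, by positivity, τ₁, by linarith, g, E, hg,
    fun ω x hx hxκ u hu => (hmem ω x (hκ ω x hx hxκ) u hu).1,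
    fun ω x hx hxκ u hu => (hmem ω x (hκ ω x hx hxκ) u hu).2, fun ω x hx hxκ y hy hyκ => ?_⟩
  have hx' := hκ ω x hx hxκ
  set q₀ := g ω (Sum.elim (0 : Euc d) x) with hq₀
  obtain ⟨hq₀M, hq₀P⟩ := hmem ω x hx' 0 (by simpa using hτ₁)
  have hq₀y : ‖q₀ - ω.1.2‖ ≤ r := by
    rw [← hg0 ω]
    exact hgδ ω _ _ (norm_elim_sub_le 0 0 x ω.1.1 (by simpa using hδ.le)
      (hxκ.le.trans (min_le_left _ _)))
  have hyq₀ : ‖y - q₀‖ ≤ 2 * r := by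
    have : y - q₀ = (y - ω.1.2) - (q₀ - ω.1.2) := by abel
    rw [this]
    linarith [norm_sub_le (y - ω.1.2) (q₀ - ω.1.2)]
  -- The segment from a point of the graph to `y` lies in the tube of unique nearest points;
  -- projecting it gives a path in the member from `q₀` to `y`.
  set p : unitInterval → Euc DY := fun t => q₀ + (t : ℝ) • (y - q₀) with hp
  have hpq : ∀ t, ‖p t - q₀‖ ≤ 2 * r := fun t => by
    rw [hp, add_sub_cancel_left, norm_smul, Real.norm_of_nonneg t.2.1]
    exact (mul_le_of_le_one_left (norm_nonneg _) t.2.2).trans hyq₀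
  have hnear : ∀ t, ∃! q : Euc DY, q ∈ M x ∧ infEDist (p t) (M x) = edist (p t) q := fun t =>
    existsUnique_nearest_of_lt_reach (h.reach_gt x hx) hq₀M (by linarith [hpq t])
  choose π hπ hπu using hnear
  have hπc : Continuous π := continuous_of_isNearest (h.closed x hx) (p := p) (by fun_prop)
    (fun t => (hπ t).1) (fun t => (hπ t).2) fun t q hq hqd => hπu t q ⟨hq, hqd⟩
  have hπq : ∀ t, p t ∈ M x → π t = p t := fun t ht =>
    (hπu t (p t) ⟨ht, by rw [infEDist_zero_of_mem ht, edist_self]⟩).symm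
  have hπy : ∀ t, ‖π t - ω.1.2‖ < τ₁ := fun t => by
    have h1 : ‖p t - π t‖ ≤ 2 * r := by
      have h2 := infEDist_le_edist_of_mem (x := p t) hq₀M
      rw [(hπ t).2, edist_dist, edist_dist] at h2
      have h3 := (ENNReal.ofReal_le_ofReal_iff dist_nonneg).1 h2
      rw [dist_eq_norm, dist_eq_norm] at h3
      exact h3.trans (hpq t)
    have h2 : π t - ω.1.2 = (p t - q₀) + (q₀ - ω.1.2) - (p t - π t) := by abel
    rw [h2]
    linarith [norm_sub_le ((p t - q₀) + (q₀ - ω.1.2)) (p t - π t),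
      norm_add_le (p t - q₀) (q₀ - ω.1.2), hpq t]
  have hgc : Continuous fun y : Euc DY => g ω (Sum.elim (P ω (y - ω.1.2)) x) :=
    (hg.contDiff_fst hβY hβX ω x).continuous.comp
      (show Continuous fun y : Euc DY => P ω (y - ω.1.2) by fun_prop)
  -- Closed by continuity, open by `hopen`, and it contains `0`; so it contains `1`, which is the
  -- claim for `y`.
  have hS : IsClopen {t | g ω (Sum.elim (P ω (π t - ω.1.2)) x) = π t} := by
    refine ⟨isClosed_eq (hgc.comp hπc) hπc, isOpen_iff_mem_nhds.2 fun t ht => ?_⟩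
    exact (tendsto_nhdsWithin_iff.2 ⟨hπc.continuousAt, Filter.Eventually.of_forall
      fun t => (hπ t).1⟩).eventually (hopen ω x hx' (π t) (hπ t).1 (hπy t) ht)
  have hp0 : p 0 = q₀ := by simp [hp]
  have hp1 : p 1 = y := by simp [hp]
  have hS1 : (1 : unitInterval) ∈ {t | g ω (Sum.elim (P ω (π t - ω.1.2)) x) = π t} := by
    rw [hS.eq_univ ⟨0, ?_⟩]
    · exact mem_univ _
    · rw [mem_ofPred_eq, hπq 0 (by rwa [hp0]), hp0, hq₀P]
  rw [mem_ofPred_eq, hπq 1 (by rwa [hp1]), hp1] at hS1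
  exact hS1

end GraphCharts

/-! ### From graphs to defining equations. -/

section FromGraphs

theorem exists_complement_splitting {n d : ℕ} (E : Euc d →ₗᵢ[ℝ] Euc n) :
    ∃ (N : Euc n →L[ℝ] Euc (n - d)) (B : Euc (n - d) →L[ℝ] Euc n),
      (∀ w, N (B w) = w) ∧ (∀ w, ContinuousLinearMap.adjoint E.toContinuousLinearMap (B w) = 0) ∧
      (∀ v, E (ContinuousLinearMap.adjoint E.toContinuousLinearMap v) + B (N v) = v) ∧
      (∀ v, ‖N v‖ ≤ ‖v‖) ∧ ∀ w, ‖B w‖ = ‖w‖ := by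
  set T : Submodule ℝ (Euc n) := LinearMap.range E.toLinearMap with hT
  have hfr : Module.finrank ℝ T = d :=
    (LinearMap.finrank_range_of_inj E.injective).trans finrank_euclideanSpace_fin
  obtain ⟨e⟩ := exists_linearIsometryEquiv (E := Tᗮ) (d := n - d) (by
    have := T.finrank_add_finrank_orthogonal
    rw [finrank_euclideanSpace_fin] at this
    omega)
  have hadj : ∀ v, E (ContinuousLinearMap.adjoint E.toContinuousLinearMap v)
      = T.orthogonalProjectionOnto v := fun v => by
    refine (Submodule.eq_starProjection_of_mem_of_inner_eq_zero
      (LinearMap.mem_range_self E.toLinearMap _) ?_).symm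
    rintro _ ⟨u, rfl⟩
    have h1 : inner ℝ (E (ContinuousLinearMap.adjoint E.toContinuousLinearMap v)) (E u)
        = inner ℝ v (E u) := by
      rw [E.inner_map_map, ContinuousLinearMap.adjoint_inner_left]
      rfl
    exact (inner_sub_left _ _ _).trans (sub_eq_zero.2 h1.symm)
  refine ⟨(e.symm.toContinuousLinearEquiv : Tᗮ →L[ℝ] Euc (n - d)).comp
    Tᗮ.orthogonalProjectionOnto, Tᗮ.subtypeL.comp
    (e.toContinuousLinearEquiv : Euc (n - d) →L[ℝ] Tᗮ), fun w => by simp, fun w => ?_,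
    fun v => ?_, fun v => ?_, fun w => e.norm_map w⟩
  · refine ext_inner_right ℝ fun u => ?_
    rw [ContinuousLinearMap.adjoint_inner_left, inner_zero_left]
    exact Submodule.inner_left_of_mem_orthogonal (K := T) (LinearMap.mem_range_self E.toLinearMap u)
      (e w).2
  · rw [hadj]
    simp
  · exact (e.symm.norm_map _).trans_le (Submodule.norm_orthogonalProjectionOnto_apply_le Tᗮ v)

variable {DX DY d : ℕ} {βY βX κ κ₁ : ℝ} {MX : Set (Euc DX)} {M : Euc DX → Set (Euc DY)}
  {g : FamilyPoint MX M → (Fin d ⊕ Fin DX → ℝ) → Euc DY}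
  {E : FamilyPoint MX M → Euc d →ₗᵢ[ℝ] Euc DY}

theorem norm_adjoint_isometry_le {n : ℕ} (E : Euc d →ₗᵢ[ℝ] Euc n) (v : Euc n) :
    ‖ContinuousLinearMap.adjoint E.toContinuousLinearMap v‖ ≤ ‖v‖ := by
  refine (ContinuousLinearMap.le_opNorm _ v).trans (mul_le_of_le_one_left (norm_nonneg _) ?_)
  rw [LinearIsometryEquiv.norm_map]
  exact E.norm_toContinuousLinearMap_le

theorem IsGraphFamily.base_eq (h : IsGraphFamily βY βX κ κ₁ MX M g E) (hκ : 0 < κ)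
    (ω : FamilyPoint MX M) : g ω (Sum.elim (0 : Euc d) ω.1.1) = ω.1.2 := by
  simpa using h.eq ω ω.1.1 ω.2.1 (by simpa using hκ) ω.1.2 ω.2.2 (by simpa using hκ)

theorem IsGraphFamily.hasDefiningEquations (hβX : 0 < βX) (hβY : 2 ≤ βY) (hβ : βX ≤ βY)
    (hκ : 0 < κ) (hκκ : κ ≤ κ₁) (h : IsGraphFamily βY βX κ κ₁ MX M g E) :
    ∃ τ > 0, ∃ τ₁ > 0, ∃ L > 0, HasDefiningEquations βY βX τ τ₁ L d MX M := by
  have hβY0 : 0 < βY := by linarith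
  have hinv : 1 / βY ≤ 1 / βX := one_div_le_one_div_of_le hβX hβ
  have hg := h.smooth
  have ha := holderWeight_pos (d₁ := DY) (d₂ := DX) hβY0 hβX
  obtain ⟨Cg, hCg0, hCg⟩ := hg.bound
  have hω : ∀ ω : FamilyPoint MX M, ‖ω.1.2‖ ≤ Cg := fun ω => by
    rw [← h.base_eq hκ ω]
    exact hCg _ _
  set P : FamilyPoint MX M → Euc DY →L[ℝ] Euc d := fun ω =>
    ContinuousLinearMap.adjoint (E ω).toContinuousLinearMap with hP
  have hPn : ∀ ω v, ‖P ω v‖ ≤ ‖v‖ := fun ω v => norm_adjoint_isometry_le (E ω) v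
  have hPop : ∀ ω, ‖P ω‖ ≤ 1 := fun ω =>
    (P ω).opNorm_le_bound zero_le_one fun v => by rw [one_mul]; exact hPn ω v
  choose N B hNB hPB hdec hNn hBn using fun ω => exists_complement_splitting (E ω)
  have hNop : ∀ ω, ‖N ω‖ ≤ 1 := fun ω =>
    (N ω).opNorm_le_bound zero_le_one fun v => by rw [one_mul]; exact hNn ω v
  have hR : 0 < Cg + κ := by positivity
  -- The normal part of `y - g(P(y - y₀), x)`. The clipping radius exceeds `‖y‖` on the ball of
  -- radius `κ` about any `y₀`, as `‖y₀‖ = ‖g(0, x₀)‖ ≤ Cg`; this bound also puts `M_Y` in a ball.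
  set F : FamilyPoint MX M → (Fin DY ⊕ Fin DX → ℝ) → Euc (DY - d) := fun ω z =>
    N ω (clipEuc (Cg + κ) Sum.inl z
      - g ω (Sum.elim (-P ω ω.1.2 + (P ω).comp (toEuc Sum.inl) z : Euc d)
        (0 + toEuc Sum.inr z : Euc DX))) with hFdef
  have hF : AnisoHolder (holderWeight βY βX DY DX) 1 F := by
    refine AnisoHolder.clm_family ha one_pos (AnisoHolder.sub ha one_pos
      (AnisoHolder.clipEuc ha one_pos hR _) (hg.substitution ha hβY0 hβX ?_ (fun i => rfl)
      ⟨‖(toEuc Sum.inl : (Fin DY ⊕ Fin DX → ℝ) →L[ℝ] Euc DY)‖, fun ω => ?_⟩ _ _)) ⟨1, hNop⟩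
    · rintro (l | l)
      exacts [le_rfl, hinv]
    · exact (ContinuousLinearMap.opNorm_comp_le _ _).trans
        (mul_le_of_le_one_left (norm_nonneg _) (hPop ω))
  have hFe : ∀ ω (y : Euc DY) (x : Euc DX), ‖y‖ ≤ Cg + κ → F ω (Sum.elim y x)
      = N ω (y - g ω (Sum.elim (P ω (y - ω.1.2)) x)) := fun ω y x hy => by
    have h1 : clipEuc (Cg + κ) Sum.inl (Sum.elim y x : Fin DY ⊕ Fin DX → ℝ) = y :=
      clipEuc_eq hR (fun i => rfl) hy
    have h2 : (toEuc Sum.inl (Sum.elim y x : Fin DY ⊕ Fin DX → ℝ) : Euc DY) = y := rfl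
    have h3 : (toEuc Sum.inr (Sum.elim y x : Fin DY ⊕ Fin DX → ℝ) : Euc DX) = x := rfl
    simp only [hFdef, h1, ContinuousLinearMap.comp_apply, h2, h3, zero_add, map_sub,
      neg_add_eq_sub]
  obtain ⟨L, hL, hFL⟩ := exists_holderClassOn hβY0 hβX hF
  refine ⟨κ, hκ, 1, one_pos, max L (Cg + 1), by positivity, fun y hy => ?_, fun x₀ hx₀ y₀ hy₀ => ?_⟩
  · obtain ⟨x, hx, hyx⟩ := mem_iUnion₂.1 hy
    rw [mem_ball_zero_iff]
    have := hω ⟨(x, y), hx, hyx⟩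
    exact (lt_add_of_le_of_pos this one_pos).trans_le (le_max_right _ _)
  set ω : FamilyPoint MX M := ⟨(x₀, y₀), hx₀, hy₀⟩ with hωdef
  have hball : ∀ y ∈ ball y₀ κ, ‖y‖ ≤ Cg + κ := fun y hy => by
    rw [mem_ball_iff_norm] at hy
    have h1 := norm_add_le y₀ (y - y₀)
    rw [add_sub_cancel] at h1
    linarith [hω ω]
  refine ⟨fun y x => F ω (Sum.elim y x),
    (hFL ω _ _ _ fun _ _ _ _ => rfl).mono (le_max_left _ _) subset_rfl subset_rfl,
    fun x hx => ?_, fun x hx y hy => ?_⟩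
  · have hxκ : ‖x - ω.1.1‖ < κ := mem_ball_iff_norm.1 hx.2
    ext y
    constructor
    · rintro ⟨hyM, hy⟩
      refine ⟨hy, ?_⟩
      simp only
      rw [hFe ω y x (hball y hy), h.eq ω x hx.1 hxκ y hyM (mem_ball_iff_norm.1 hy), sub_self,
        map_zero]
    · rintro ⟨hy, hFy⟩
      simp only at hFy
      rw [hFe ω y x (hball y hy)] at hFy
      have hu : ‖P ω (y - ω.1.2)‖ < κ₁ :=
        ((hPn ω _).trans_lt (mem_ball_iff_norm.1 hy)).trans_le hκκ
      have h1 := h.proj ω x hx.1 hxκ _ hu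
      -- The tangential part vanishes automatically, so a zero normal part forces `y` onto the
      -- graph.
      have h2 : P ω (y - g ω (Sum.elim (P ω (y - ω.1.2)) x)) = 0 := by
        rw [← sub_sub_sub_cancel_right _ _ ω.1.2, map_sub]
        exact sub_eq_zero.2 h1.symm
      have h3 := hdec ω (y - g ω (Sum.elim (P ω (y - ω.1.2)) x))
      rw [hFy, map_zero, add_zero] at h3
      have h4 : E ω (P ω (y - g ω (Sum.elim (P ω (y - ω.1.2)) x))) = _ := h3
      rw [h2, map_zero] at h4
      refine ⟨?_, hy⟩
      rw [sub_eq_zero.1 h4.symm]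
      exact h.mem ω x hx.1 hxκ _ hu
  · set D := derivFst g ω (Sum.elim (P ω (y - ω.1.2)) x)
    have h1 : HasFDerivAt (fun y : Euc DY => P ω (y - ω.1.2)) (P ω) y := by
      simpa only [ContinuousLinearMap.comp_id] using!
        (P ω).hasFDerivAt.comp y ((hasFDerivAt_id y).sub_const ω.1.2)
    have h0 := hg.hasFDerivAt_fst hβY hβX ω (P ω (y - ω.1.2)) x
    have h2 : HasFDerivAt (fun y : Euc DY => g ω (Sum.elim (P ω (y - ω.1.2)) x))
        (D.comp (P ω)) y :=
      HasFDerivAt.comp (g := fun u : Euc d => g ω (Sum.elim u x)) y h0 h1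
    have h3 : HasFDerivAt (fun y' : Euc DY => F ω (Sum.elim y' x))
        ((N ω).comp (ContinuousLinearMap.id ℝ _ - D.comp (P ω))) y := by
      refine ((N ω).hasFDerivAt.comp y ((hasFDerivAt_id y).sub h2)).congr_of_eventuallyEq ?_
      filter_upwards [isOpen_ball.mem_nhds hy] with y' hy'
      exact hFe ω y' x (hball y' hy')
    set J := (N ω).comp (ContinuousLinearMap.id ℝ _ - D.comp (P ω)) with hJ
    refine (posSemidef_sub_iff J (fun i k => ?_) 1).2 fun w => ?_
    · simp [jacobianAt, h3.fderiv]
    · have h4 : J (B ω w) = w := by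
        have : P ω (B ω w) = 0 := hPB ω w
        simp [hJ, this, hNB]
      have h5 : ‖w‖ ^ 2 ≤ ‖ContinuousLinearMap.adjoint J w‖ * ‖w‖ := by
        calc ‖w‖ ^ 2 = inner ℝ w (J (B ω w)) := by rw [h4, real_inner_self_eq_norm_sq]
          _ = inner ℝ (ContinuousLinearMap.adjoint J w) (B ω w) :=
            (ContinuousLinearMap.adjoint_inner_left J _ _).symm
          _ ≤ ‖ContinuousLinearMap.adjoint J w‖ * ‖B ω w‖ := real_inner_le_norm _ _
          _ = _ := by rw [hBn]
      rw [one_mul]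
      nlinarith [norm_nonneg w, norm_nonneg (ContinuousLinearMap.adjoint J w),
        sq_nonneg (‖w‖ - ‖ContinuousLinearMap.adjoint J w‖)]

end FromGraphs

/-! ### The equivalence. -/

theorem mainTheorem9 (DX DY dY : ℕ) (βY βX : ℝ) (hβX : 0 < βX) (hβY : 2 ≤ βY) (hβ : βX ≤ βY)
    (MX : Set (Euc DX)) (M : Euc DX → Set (Euc DY)) (hM : ∀ x ∈ MX, IsSubmanifold dY (M x)) :
    List.TFAE [
      ∃ τ > 0, ∃ τ₁ > 0, ∃ L > 0, SmoothFamily βY βX τ τ₁ L dY MX M,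
      ∃ τ > 0, ∃ τ₁ > 0, ∃ L > 0, HasSmoothCharts βY βX τ τ₁ L dY MX M,
      ∃ τ > 0, ∃ τ₁ > 0, ∃ L > 0, HasDefiningEquations βY βX τ τ₁ L dY MX M] := by
  tfae_have 2 → 1 := fun ⟨_, hτ, _, hτ₁, _, hL, h⟩ =>
    h.smoothFamily hβX hβY hβ hM hτ hτ₁ hL
  tfae_have 3 → 2 := fun ⟨_, hτ, _, hτ₁, _, _, h⟩ => h.hasSmoothCharts hβX hβY hβ hM hτ hτ₁
  tfae_have 1 → 3 := fun ⟨_, hτ, _, hτ₁, _, _, h⟩ => by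
    obtain ⟨_, hκ, _, hκκ, _, _, hg⟩ := h.exists_isGraphFamily hβX hβY hτ hτ₁
    exact hg.hasDefiningEquations hβX hβY hβ hκ hκκ
  tfae_finish
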